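/- Let $D^2\subset\mathbb C$ be the closed unit disk with the area form $\omega=\frac1\pi\,dx\wedge dy$ of total area $1$, and let $\beta=\frac{r^2}{2\pi}\,d\theta$, so $d\beta=\omega$. Let $\theta_0\in\mathbb R$ and let $\varphi:D^2\to D^2$ be a diffeomorphism with $\varphi^*\omega=\omega$ which is the rotation by angle $2\pi\theta_0$ near $\partial D^2$. Let $f:D^2\to\mathbb R$ be the action function of $(\varphi,\theta_0)$, that is, the unique function with $df=\varphi^*\beta-\beta$ and $f|_{\partial D^2}=\theta_0$. The Calabi invariant is $\mathcal V(\varphi,\theta_0)=\int_{D^2}f\,\omega$. Let $\mathcal P(\varphi)$ be the set of periodic orbits $\gamma=(x_1,\dots,x_d)$ of $\varphi$ in $D^2$ (distinct points, $\varphi(x_i)=x_{i+1}$ with indices modulo $d$, considered up to cyclic relabelling), with period $d(\gamma)=d$ and total action $\sum_{i=1}^d f(x_i)$. An open book decomposition of $S^3$ with disk pages is an orientation-preserving diffeomorphism from $([0,1]\times D^2)/\!\sim$ to $S^3$, where $(1,x)\sim(0,\psi(x))$ for some diffeomorphism $\psi$ of $D^2$ that is the identity near $\partial D^2$, and $(t,x)\sim(t',x)$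 for $x\in\partial D^2$. Its pages are the images of the sets $\{t\}\times\operatorname{int}D^2$, and its binding is the image of $[0,1]\times\partial D^2$. A contact form $\lambda$ on $S^3$ (a smooth $1$-form with $\lambda\wedge d\lambda>0$) is compatible with it if its Reeb vector field $R$ (given by $\lambda(R)=1$, $d\lambda(R,\cdot)=0$) is positively transverse to the pages and tangent to the binding. A Reeb orbit is simple if it is an embedded closed orbit of $R$; $\mathcal P(\lambda)$ denotes the set of simple Reeb orbits modulo reparametrization, and the (symplectic) action of $\gamma\in\mathcal P(\lambda)$ is $\int_\gamma\lambda$. A Reeb orbit $\gamma$ of period $T$ is elliptic if the linearized return map on $\xi=\ker\lambda$ at $\gamma(0)$ is a rotation for some symplectic identification of $(\xi_{\gamma(0)},d\lambda)$ with $\mathbb R^2$. In this case choose a symplectic trivialization of $\xi|_\gamma$ for which the pushoff of $\gamma$ has linking number $0$ with $\gamma$ and in which the linearized time-$t$ flow along $\gamma$ is the rotation by angle $2\pi\theta_t$, with $\theta$ continuous on $[0,T]$ and $\theta_0=0$ at $t=0$; the rotation number of $\gamma$ is the value $\theta_T$ at $t=T$. Suppose that $f>0$ everywhere on $D^2$.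 Then there exist a contact form $\lambda$ on $S^3$ and an open book decomposition of $S^3$ with disk pages with which $\lambda$ is compatible, such that: (a) the binding is a simple Reeb orbit $B$ of $\lambda$, which has action $1$ and is elliptic with rotation number $1/\theta_0$; (b) there is a bijection $\{B\}\sqcup\mathcal P(\varphi)\to\mathcal P(\lambda)$ which sends $B$ to $B$ and such that, for each $\gamma\in\mathcal P(\varphi)$, the corresponding Reeb orbit has linking number $d(\gamma)$ with $B$ and action equal to the total action of $\gamma$; (c) $\int_{S^3}\lambda\wedge d\lambda=\mathcal V(\varphi,\theta_0)$. -/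

import Mathlib

open Set Metric MeasureTheory
open scoped ContDiff Real

noncomputable section

/-! ### Area-preserving maps of the closed unit disk -/

namespace DiskMap

/-- The closed unit disk `D²`, in the complex plane. -/
abbrev disk : Set ℂ := closedBall (0 : ℂ) 1

/-- The standard area form rescaled to total area `1`: `ω = π⁻¹ dx ∧ dy`. -/
def areaForm (u v : ℂ) : ℝ := π⁻¹ * (u.re * v.im - u.im * v.re)

/-- The primitive `β = (r² / 2π) dθ = (2π)⁻¹ (x dy - y dx)` of `ω`: its value at `z` on `v`. -/
def beta (z v : ℂ) : ℝ := (2 * π)⁻¹ * (z.re * v.im - z.im * v.re)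

/-- `φ` restricts to a diffeomorphism of the closed disk (smooth up to the boundary). -/
structure IsDiskDiffeo (φ : ℂ → ℂ) : Prop where
  mapsTo : MapsTo φ disk disk
  smooth : ContDiffOn ℝ ∞ φ disk
  exists_inverse : ∃ χ : ℂ → ℂ, MapsTo χ disk disk ∧ ContDiffOn ℝ ∞ χ disk ∧ InvOn χ φ disk disk

/-- `φ^* ω = ω` on the closed disk. -/
def PreservesArea (φ : ℂ → ℂ) : Prop :=
  ∀ z ∈ disk, ∀ u v : ℂ,
    areaForm (fderivWithin ℝ φ disk z u) (fderivWithin ℝ φ disk z v) = areaForm u v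

/-- The point `e^{2πi s}` of the unit circle. -/
def circ (s : ℝ) : ℂ := Complex.exp (2 * π * s * Complex.I)

/-- Near the boundary of the disk, `φ` is the rotation by the angle `2πθ`. -/
def IsRotationNearBoundary (φ : ℂ → ℂ) (θ : ℝ) : Prop :=
  ∃ δ > 0, ∀ z ∈ disk, 1 - δ < ‖z‖ → φ z = circ θ * z

/-- `f` is the action function of `(φ, θ₀)` (with respect to `β`):
`df = φ^* β - β` on the disk, and `f = θ₀` on the boundary circle. -/
structure IsActionFunction (φ : ℂ → ℂ) (θ₀ : ℝ) (f : ℂ → ℝ) : Prop where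
  differentiableOn : DifferentiableOn ℝ f disk
  fderiv_eq : ∀ z ∈ disk, ∀ v : ℂ,
    fderivWithin ℝ f disk z v = beta (φ z) (fderivWithin ℝ φ disk z v) - beta z v
  boundary : ∀ z : ℂ, ‖z‖ = 1 → f z = θ₀

/-- The Calabi invariant `∫_{D²} f ω`. -/
def calabi (f : ℂ → ℝ) : ℝ := ∫ z in disk, f z * π⁻¹

/-- A periodic orbit `(x₁, …, x_d)` of `φ` in the disk: `d ≥ 1`, the points are distinct, and
`φ xᵢ = xᵢ₊₁` with indices modulo `d`. As an element of `Cycle ℂ` it is considered up to cyclic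
relabelling. -/
structure PeriodicOrbit (φ : ℂ → ℂ) where
  pts : Cycle ℂ
  ne_nil : pts ≠ Cycle.nil
  mem_disk : ∀ x ∈ pts, x ∈ disk
  nodup : pts.Nodup
  chain : pts.Chain fun x y => φ x = y

/-- The period `d` of a periodic orbit. -/
def PeriodicOrbit.period {φ : ℂ → ℂ} (c : PeriodicOrbit φ) : ℕ := c.pts.length

/-- The total action `∑ᵢ f xᵢ` of a periodic orbit. -/
def PeriodicOrbit.totalAction {φ : ℂ → ℂ} (f : ℂ → ℝ) (c : PeriodicOrbit φ) : ℝ :=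
  (c.pts.toMultiset.map f).sum

end DiskMap

/-! ### Contact forms on the three-sphere

`S³` is the unit sphere of `ℝ⁴`; its tangent space at `p` is the orthogonal complement of `p`, and
it is oriented as the boundary of the ball. A smooth `1`-form on `S³` is given by a `1`-form
on `ℝ⁴` which is smooth at the points of `S³`; every smooth `1`-form on `S³` is the restriction of
such a form, all the notions below only involve the restriction to `TS³`, and `d` commutes with
restriction. -/

namespace ContactSphere

open DiskMap (disk circ)

/-- The Euclidean space `ℝ⁴`. -/
abbrev E4 : Type := EuclideanSpace ℝ (Fin 4)

/-- The sphere `S³`. -/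
abbrev S3 : Set E4 := sphere (0 : E4) 1

/-- `1`-forms on `ℝ⁴`. -/
abbrev OneForm : Type := E4 → E4 [⋀^Fin 1]→L[ℝ] ℝ

/-- `v` is tangent to `S³` at `p`. -/
def Tangent (p v : E4) : Prop := inner ℝ p v = 0

/-- The determinant of four vectors of `ℝ⁴`. For `p ∈ S³`, a basis `(u, v, w)` of `T_p S³`
is positively oriented if and only if `0 < det4 p u v w`. -/
def det4 (p u v w : E4) : ℝ := Matrix.det (Matrix.of fun i j : Fin 4 => (![p, u, v, w] i) j)

/-- Radial projection to the sphere. -/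
def normalize (x : E4) : E4 := ‖x‖⁻¹ • x

/-- The exterior derivative `dλ_p (u, v)`. -/
def dForm (lam : OneForm) (p u v : E4) : ℝ := extDeriv lam p ![u, v]

/-- The `3`-form `(λ ∧ dλ)_p (u, v, w)`. -/
def wedgeD (lam : OneForm) (p u v w : E4) : ℝ :=
  lam p ![u] * dForm lam p v w - lam p ![v] * dForm lam p u w + lam p ![w] * dForm lam p u v

/-- Together with the next two definitions, an orthonormal frame of `TS³`
(left multiplication by the quaternions `i`, `j`, `k`). -/
def frameI (p : E4) : E4 := !₂[-p 1, p 0, -p 3, p 2]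

def frameJ (p : E4) : E4 := !₂[-p 2, p 3, p 0, -p 1]

def frameK (p : E4) : E4 := !₂[-p 3, -p 2, p 1, p 0]

/-- The frame is positively oriented, of unit volume at the points of the sphere. -/
theorem det4_frame (p : E4) (hp : p ∈ S3) : det4 p (frameI p) (frameJ p) (frameK p) = 1 := by
  have h : p 0 ^ 2 + p 1 ^ 2 + p 2 ^ 2 + p 3 ^ 2 = 1 := by
    have h1 : ‖p‖ = 1 := by simpa using hp
    have h2 := EuclideanSpace.norm_sq_eq p
    rw [h1] at h2
    simp only [Fin.sum_univ_four, Real.norm_eq_abs, sq_abs] at h2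
    linarith
  have h3 : det4 p (frameI p) (frameJ p) (frameK p)
      = (p 0 ^ 2 + p 1 ^ 2 + p 2 ^ 2 + p 3 ^ 2) ^ 2 := by
    simp [det4, frameI, frameJ, frameK, Matrix.det_succ_row_zero, Fin.sum_univ_succ,
      Fin.succAbove]
    ring
  rw [h3, h]; norm_num

theorem tangent_frame (p : E4) :
    Tangent p (frameI p) ∧ Tangent p (frameJ p) ∧ Tangent p (frameK p) := by
  refine ⟨?_, ?_, ?_⟩ <;>
    simp [Tangent, frameI, frameJ, frameK, PiLp.inner_apply, Fin.sum_univ_four] <;> ring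

/-- The function `g` with `λ ∧ dλ = g · vol` along `S³`, where `vol` is the Riemannian volume form
of the round sphere. -/
def contactDensity (lam : OneForm) (p : E4) : ℝ :=
  wedgeD lam p (frameI p) (frameJ p) (frameK p)

/-- `λ` is a (positive) contact form on `S³`: it is smooth, and `λ ∧ dλ > 0` everywhere. -/
structure IsContactForm (lam : OneForm) : Prop where
  smooth : ∀ p ∈ S3, ContDiffAt ℝ ∞ lam p
  pos : ∀ p ∈ S3, 0 < contactDensity lam p

/-- The contact volume `∫_{S³} λ ∧ dλ` (`toSphere` is the surface measure). -/
def contactVolume (lam : OneForm) : ℝ :=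
  ∫ p : S3, contactDensity lam (p : E4) ∂(volume : Measure E4).toSphere

/-! ### Reeb orbits -/

/-- `v` is the value at `p ∈ S³` of the Reeb vector field of `λ`. -/
structure IsReebVector (lam : OneForm) (p v : E4) : Prop where
  tangent : Tangent p v
  lam_eq : lam p ![v] = 1
  dlam_eq : ∀ w, Tangent p w → dForm lam p v w = 0

/-- A parametrized simple Reeb orbit of period `T`. Since `λ (γ') = 1`, the curve is an immersion,
so injectivity on `ℝ / Tℤ` says that `ℝ / Tℤ → S³` is an embedding. -/
structure SimpleReebOrbit (lam : OneForm) where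
  period : ℝ
  curve : ℝ → E4
  period_pos : 0 < period
  smooth : ContDiff ℝ ∞ curve
  mem_sphere : ∀ t, curve t ∈ S3
  periodic : Function.Periodic curve period
  reeb : ∀ t, IsReebVector lam (curve t) (deriv curve t)
  simple : InjOn curve (Ico 0 period)

/-- Simple Reeb orbits are considered modulo reparametrization. -/
instance reebSetoid (lam : OneForm) : Setoid (SimpleReebOrbit lam) where
  r γ γ' := γ.period = γ'.period ∧ ∃ s, ∀ t, γ'.curve t = γ.curve (t + s)
  iseqv :=
    { refl := fun γ => ⟨rfl, 0, fun t => by simp⟩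
      symm := by
        rintro γ γ' ⟨h, s, hs⟩
        exact ⟨h.symm, -s, fun t => by simp [hs]⟩
      trans := by
        rintro γ γ' γ'' ⟨h, s, hs⟩ ⟨h', s', hs'⟩
        refine ⟨h.trans h', s' + s, fun t => ?_⟩
        rw [hs', hs, add_assoc] }

/-- The set of simple Reeb orbits of `λ`. -/
abbrev ReebOrbits (lam : OneForm) : Type := Quotient (reebSetoid lam)

/-- The symplectic action `∫_γ λ`. -/
def SimpleReebOrbit.action {lam : OneForm} (γ : SimpleReebOrbit lam) : ℝ :=
  ∫ t in (0 : ℝ)..γ.period, lam (γ.curve t) ![deriv γ.curve t]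

/-- The Reeb flow `Φ t : S³ → S³` (the values of `Φ t` outside `S³` are irrelevant). -/
structure IsReebFlow (lam : OneForm) (Φ : ℝ → E4 → E4) : Prop where
  mem_sphere : ∀ t, ∀ p ∈ S3, Φ t p ∈ S3
  zero : ∀ p ∈ S3, Φ 0 p = p
  reeb : ∀ t, ∀ p ∈ S3, ∃ v, IsReebVector lam (Φ t p) v ∧ HasDerivAt (fun s => Φ s p) v t

/-- The differential at `p ∈ S³` of `g : S³ → S³` sends the tangent vector `v` to `w`
(`s ↦ normalize (p + s v)` is a curve on `S³` through `p` with velocity `v`). -/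
def HasTangentMap (g : E4 → E4) (p v w : E4) : Prop :=
  HasDerivAt (fun s : ℝ => g (normalize (p + s • v))) w 0

/-- `v` lies in the contact plane `ξ_p = ker λ_p`. -/
def InContactPlane (lam : OneForm) (p v : E4) : Prop := Tangent p v ∧ lam p ![v] = 0

/-- `(e₁, e₂)` is a symplectic basis of `(ξ_p, dλ)`. -/
def IsSymplecticBasis (lam : OneForm) (p e₁ e₂ : E4) : Prop :=
  InContactPlane lam p e₁ ∧ InContactPlane lam p e₂ ∧ dForm lam p e₁ e₂ = 1

/-- The differential at `p` of `g : S³ → S³` maps the span of `(e₁, e₂)` to the span of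
`(e₁', e₂')`, and is the rotation by the angle `α` in these bases. -/
def IsRotationIn (g : E4 → E4) (p e₁ e₂ e₁' e₂' : E4) (α : ℝ) : Prop :=
  ∀ a b : ℝ, HasTangentMap g p (a • e₁ + b • e₂)
    ((a * Real.cos α - b * Real.sin α) • e₁' + (a * Real.sin α + b * Real.cos α) • e₂')

/-- `γ` is elliptic: the linearized return map on `ξ` is a rotation for some
symplectic identification of `ξ_{γ(0)}` with `ℝ²`. -/
def SimpleReebOrbit.IsElliptic {lam : OneForm} (γ : SimpleReebOrbit lam) : Prop :=
  ∃ Φ, IsReebFlow lam Φ ∧ ∃ e₁ e₂ α, IsSymplecticBasis lam (γ.curve 0) e₁ e₂ ∧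
    IsRotationIn (Φ γ.period) (γ.curve 0) e₁ e₂ e₁ e₂ α

/-! ### Linking numbers -/

/-- The closed curves `γ : ℝ / Tℤ → S³` and `κ : ℝ / T'ℤ → S³` are disjoint and have linking
number `n`: `κ` is the boundary of a (singular) disk `u` in `S³` which is transverse to `γ` and
whose algebraic intersection number with `γ` is `n`. By transversality there are only finitely
many intersections, and `n` does not depend on `u` because `H₂(S³) = 0`. -/
def HasLinkingNumber (T : ℝ) (γ : ℝ → E4) (T' : ℝ) (κ : ℝ → E4) (n : ℤ) : Prop :=
  (∀ s t, γ s ≠ κ t) ∧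
  ∃ u : ℂ → E4, MapsTo u disk S3 ∧ ContinuousOn u disk ∧ ContDiffOn ℝ ∞ u (ball 0 1) ∧
    (∀ s : ℝ, u (circ s) = κ (T' * s)) ∧
    ∃ I : Finset (ℝ × ℂ),
      (∀ q : ℝ × ℂ, q ∈ I ↔ q.1 ∈ Ico 0 T ∧ q.2 ∈ ball (0 : ℂ) 1 ∧ u q.2 = γ q.1) ∧
      (∀ q ∈ I, det4 (γ q.1) (deriv γ q.1) (fderiv ℝ u q.2 1) (fderiv ℝ u q.2 Complex.I) ≠ 0) ∧
      n = ∑ q ∈ I, (SignType.sign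
        (det4 (γ q.1) (deriv γ q.1) (fderiv ℝ u q.2 1) (fderiv ℝ u q.2 Complex.I)) : ℤ)

/-- The elliptic simple Reeb orbit `γ`, of period `T`, has rotation number `ρ`. There is a
symplectic trivialization `(e₁, e₂)` of `ξ` along `γ` such that
the pushoff of `γ` by the trivialization has linking number zero with `γ`, and such that the
linearized time `t` Reeb flow `ξ_{γ(0)} → ξ_{γ(t)}` is in this trivialization the rotation by
`2π θ(t)` with `θ` continuous and `θ(0) = 0`; then `ρ = θ(T)`. -/
def SimpleReebOrbit.HasRotationNumber {lam : OneForm} (γ : SimpleReebOrbit lam) (ρ : ℝ) : Prop :=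
  ∃ e₁ e₂ : ℝ → E4, ContDiff ℝ ∞ e₁ ∧ ContDiff ℝ ∞ e₂ ∧
    Function.Periodic e₁ γ.period ∧ Function.Periodic e₂ γ.period ∧
    (∀ t, IsSymplecticBasis lam (γ.curve t) (e₁ t) (e₂ t)) ∧
    (∃ ε₀ > 0, ∀ ε, 0 < ε → ε < ε₀ →
      HasLinkingNumber γ.period (fun t => normalize (γ.curve t + ε • e₁ t))
        γ.period γ.curve 0) ∧
    ∃ Φ, IsReebFlow lam Φ ∧ ∃ θ : ℝ → ℝ, ContinuousOn θ (Icc 0 γ.period) ∧ θ 0 = 0 ∧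
      (∀ t ∈ Icc 0 γ.period,
        IsRotationIn (Φ t) (γ.curve 0) (e₁ 0) (e₂ 0) (e₁ t) (e₂ t) (2 * π * θ t)) ∧
      ρ = θ γ.period

/-! ### Open books -/

/-- An open book decomposition of `S³` whose pages are disks: a diffeomorphism `ψ` of `D²` which is
the identity near the boundary, and an orientation-preserving diffeomorphism from
`([0,1] × D²)/∼`, where `(1,x) ∼ (0,ψ(x))`, and `(t,x) ∼ (t',x)` for `x ∈ ∂D²`, to `S³`.

The diffeomorphism is given by the induced map `Q`, extended from `[0,1] × D²` to `ℝ × D²` by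
`Q (t+1, x) = Q (t, ψ x)`. The smooth structure of the quotient is the usual one: that of the
mapping torus away from `∂D²`, and near the image of `∂D²` the one whose coordinates
`(σ, w)` are related to `t` and the polar coordinates of `x = r e^{2πi σ}` by
`w = ρ e^{2πi t}` and `r² + ρ² = 1`. -/
structure DiskOpenBook where
  ψ : ℂ → ℂ
  diffeo : DiskMap.IsDiskDiffeo ψ
  eq_id : ∃ δ > 0, ∀ z ∈ disk, 1 - δ < ‖z‖ → ψ z = z
  Q : ℝ × ℂ → E4
  shift : ∀ t, ∀ x ∈ disk, Q (t + 1, x) = Q (t, ψ x)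
  collapse : ∀ t t' x, ‖x‖ = 1 → Q (t, x) = Q (t', x)
  mem_sphere : ∀ t, ∀ x ∈ disk, Q (t, x) ∈ S3
  surj : ∀ p ∈ S3, ∃ t ∈ Ico (0 : ℝ) 1, ∃ x ∈ disk, Q (t, x) = p
  inj : ∀ t ∈ Ico (0 : ℝ) 1, ∀ t' ∈ Ico (0 : ℝ) 1, ∀ x ∈ disk, ∀ x' ∈ disk,
    Q (t, x) = Q (t', x') → x = x' ∧ (t = t' ∨ ‖x‖ = 1)
  smooth_interior : ContDiffOn ℝ ∞ Q (univ ×ˢ ball 0 1)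
  oriented_interior : ∀ t, ∀ x ∈ ball (0 : ℂ) 1,
    0 < det4 (Q (t, x)) (fderiv ℝ Q (t, x) (1, 0)) (fderiv ℝ Q (t, x) (0, 1))
      (fderiv ℝ Q (t, x) (0, Complex.I))
  near_binding : ∃ ε > 0, ε ≤ 1 ∧ ∃ N : ℝ × ℂ → E4,
    ContDiffOn ℝ ∞ N (univ ×ˢ ball 0 ε) ∧
    (∀ σ t ρ : ℝ, 0 ≤ ρ → ρ < ε → N (σ, ρ * circ t) = Q (t, Real.sqrt (1 - ρ ^ 2) * circ σ)) ∧
    ∀ σ, ∀ w ∈ ball (0 : ℂ) ε,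
      0 < det4 (N (σ, w)) (fderiv ℝ N (σ, w) (1, 0)) (fderiv ℝ N (σ, w) (0, 1))
        (fderiv ℝ N (σ, w) (0, Complex.I))

/-- The binding, as a subset of `S³`. -/
def DiskOpenBook.binding (b : DiskOpenBook) : Set E4 := (fun x => b.Q (0, x)) '' sphere (0 : ℂ) 1

/-- `λ` is compatible with the open book: its Reeb vector field is positively transverse to the
pages (the images of the sets `{t} × int D²`), and tangent to the binding. -/
structure DiskOpenBook.IsCompatible (b : DiskOpenBook) (lam : OneForm) : Prop where
  transverse : ∀ t, ∀ x ∈ ball (0 : ℂ) 1, ∀ v, IsReebVector lam (b.Q (t, x)) v →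
    0 < det4 (b.Q (t, x)) v (fderiv ℝ b.Q (t, x) (0, 1)) (fderiv ℝ b.Q (t, x) (0, Complex.I))
  tangent : ∀ s v, IsReebVector lam (b.Q (0, circ s)) v →
    ∃ c : ℝ, v = c • deriv (fun s => b.Q (0, circ s)) s

end ContactSphere

end

/-! The contact form is built on the mapping torus of `φ` and carried to the sphere. Extend `φ` to
the plane by the rotation and `f` by the constant `θ₀`, and let `k (τ, z) = (τ - 1, φ z)` on `ℝ ×
ℂ`. If a function `S` satisfies `S ∘ k = S - f`, then `dS + β` is `k`-invariant, because `φ^*β = β +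
df`. Its differential is `ω`, and `(dS + β) ∧ ω = ∂_τ S dτ ∧ ω`, so it is a contact form as soon as
`∂_τ S > 0`, with Reeb field `∂_τ / ∂_τ S`. The Reeb trajectories are the lines `z = const`; they
meet the page `τ = 0` mod `1` along the orbits of `φ`, with return time `S (1, z) - S (0, z) = f z`.
This gives the closed orbits, their actions and their linking numbers with the binding, and
integrating `∂_τ S` over a unit of `τ` gives the volume. Positivity of `f` is what allows an
increasing `S` (`exists_suspension`).

The identification of the mapping torus with `ℝ/ℤ × D²` needs an isotopy `Φ` with `Φ (0, z) = z` and
`Φ (τ + 1, z) = Φ (τ, φ z)`. It need not preserve area, since the form is simply pushed forward. It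
exists because a diffeomorphism `ψ` of the disk which is the identity near the boundary is isotopic
to the identity relative to the boundary (`exists_disk_isotopy`). The argument is Smale's: the field
`ψ_* ∂ₓ` on the plane has no zeros, and its logarithm deforms it to `∂ₓ` through fields without
zeros which equal `∂ₓ` outside a square. By an argument of Poincaré–Bendixson type
(`StripFlow.good`) every orbit of every field of the family crosses the square, so the flows
straighten the fields (`StripFlow.wave`); a correction on the right makes the straightening maps
compactly supported.

Near the boundary `Φ` is the rotation by `θ₀ τ` turns and `S = θ₀ τ`. There the form becomes `θ₀ (1
- |x|²) dτ + β`, which under `bookMap` is the restriction to `S³` of `θ₀ β(w₂) + β(w₁)` and is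
therefore smooth across the binding `w₂ = 0`. The Reeb flow near the binding is linear: the binding
has period `1`, and the normal direction turns by `t / θ₀` turns in time `t`.

The boundary circle of a page collapses to the binding, whereas `𝒫(φ)` contains the periodic orbits
on the boundary circle as well. Since `φ` is a rotation on a collar, the closed disk can be put in
bijection with the open disk compatibly with `φ` and `f` (`exists_retract`), and this absorbs the
boundary orbits. -/

open Filter Topology

/-! ### Smooth dependence of flows on time and initial condition -/

section SmoothFlow

/-- The map `g` is not assumed continuous. The local inverse given by the inverse function theorem
is a right inverse near `f a` and tends to `a`, so `g` has to agree with it. This yields smoothness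
of maps obtained from fixed points or by choice. -/
theorem contDiffAt_of_leftInverse {E F : Type*} [NormedAddCommGroup E] [NormedSpace ℝ E]
    [NormedAddCommGroup F] [NormedSpace ℝ F] [CompleteSpace E] {f : E → F} {f' : E ≃L[ℝ] F}
    {a : E} {g : F → E} {n : WithTop ℕ∞} (hn : n ≠ 0) (hf : ContDiffAt ℝ n f a)
    (hf' : HasFDerivAt f (f' : E →L[ℝ] F) a) (hg : ∀ᶠ x in 𝓝 a, g (f x) = x) :
    ContDiffAt ℝ n g (f a) := by
  have hs : HasStrictFDerivAt f (f' : E →L[ℝ] F) a := hf.hasStrictFDerivAt' hf' hn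
  refine (hf.to_localInverse hf' hn).congr_of_eventuallyEq ?_
  have h1 := hs.eventually_right_inverse
  have h2 := hs.localInverse_tendsto.eventually hg
  filter_upwards [h1, h2] with y hy1 hy2
  rw [hy1] at hy2
  exact hy2

variable {X : Type} [TopologicalSpace X] [CompactSpace X]

/-- Pointwise evaluation of a continuous family of linear maps on a continuous map. -/
noncomputable def pointwiseApply (X E F : Type) [TopologicalSpace X] [CompactSpace X]
    [NormedAddCommGroup E] [NormedSpace ℝ E] [NormedAddCommGroup F] [NormedSpace ℝ F] :
    C(X, E →L[ℝ] F) →L[ℝ] C(X, E) →L[ℝ] C(X, F) :=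
  LinearMap.mkContinuous₂
    (LinearMap.mk₂ ℝ (fun (D : C(X, E →L[ℝ] F)) (h : C(X, E)) =>
        (⟨fun x => D x (h x), D.continuous.clm_apply h.continuous⟩ : C(X, F)))
      (fun _ _ _ => by ext; simp) (fun _ _ _ => by ext; simp)
      (fun _ _ _ => by ext; simp) (fun _ _ _ => by ext; simp)) 1
    (fun D h => by
      rw [one_mul]
      refine (ContinuousMap.norm_le _ (by positivity)).2 fun x => ?_
      exact ((D x).le_opNorm _).trans
        (mul_le_mul (D.norm_coe_le_norm x) (h.norm_coe_le_norm x) (norm_nonneg _) (norm_nonneg D)))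

theorem postcomp_near {E G : Type} [NormedAddCommGroup E] [NormedAddCommGroup G]
    (W : C(E, G)) (γ : C(X, E)) {c : ℝ} (hc : 0 < c) :
    ∃ δ > 0, ∀ γ', dist γ' γ < δ → ∀ x, ‖W (γ' x) - W (γ x)‖ ≤ c := by
  obtain ⟨δ, hδ, h⟩ := Metric.continuousAt_iff.1
    (ContinuousMap.continuous_postcomp (X := X) W).continuousAt c hc
  refine ⟨δ, hδ, fun γ' h' x => ?_⟩
  rw [← dist_eq_norm]
  exact (ContinuousMap.dist_apply_le_dist (f := W.comp γ') (g := W.comp γ) x).trans (h h').le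

/-- The mean value inequality on each segment from `γ x` to `γ' x` bounds the error by a multiple of
`‖γ' - γ‖` uniformly in `x`, because every curve of the segment from `γ` to `γ'` is within `δ` of
`γ`. -/
theorem hasFDerivAt_postcomp {E F : Type} [NormedAddCommGroup E] [NormedSpace ℝ E]
    [NormedAddCommGroup F] [NormedSpace ℝ F] (W : C(E, F)) (W' : C(E, E →L[ℝ] F))
    (hW : ∀ x, HasFDerivAt W (W' x) x) (γ : C(X, E)) :
    HasFDerivAt (fun γ : C(X, E) => W.comp γ) (pointwiseApply X E F (W'.comp γ)) γ := by
  refine HasFDerivAt.of_isLittleO ?_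
  rw [Asymptotics.isLittleO_iff]
  intro c hc
  obtain ⟨δ, hδ, h⟩ := postcomp_near W' γ hc
  filter_upwards [Metric.ball_mem_nhds γ hδ] with γ' hγ'
  refine (ContinuousMap.norm_le _ (by positivity)).2 fun x => ?_
  have key : ‖W (γ' x) - W (γ x) - W' (γ x) (γ' x - γ x)‖ ≤ c * ‖γ' x - γ x‖ := by
    refine Convex.norm_image_sub_le_of_norm_hasFDerivWithin_le' (s := segment ℝ (γ x) (γ' x))
      (f' := fun y => W' y) (fun y _ => (hW y).hasFDerivWithinAt) ?_ (convex_segment _ _)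
      (left_mem_segment _ _ _) (right_mem_segment _ _ _)
    intro y hy
    rw [segment_eq_image'] at hy
    obtain ⟨s, hs, rfl⟩ := hy
    have hd : dist (γ + s • (γ' - γ)) γ < δ := by
      rw [dist_eq_norm, add_sub_cancel_left, norm_smul, Real.norm_of_nonneg hs.1]
      rw [mem_ball, dist_eq_norm] at hγ'
      exact (mul_le_of_le_one_left (norm_nonneg _) hs.2).trans_lt hγ'
    exact h _ hd x
  refine le_trans (le_of_eq ?_) (key.trans
    (mul_le_mul_of_nonneg_left ((γ' - γ).norm_coe_le_norm x) hc.le))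
  rfl

/-- The derivative is again a post-composition, by a map with values in another space, followed by a
continuous linear map; this is why the spaces are quantified inside the induction. -/
theorem contDiff_postcomp_nat (n : ℕ) : ∀ {E F : Type} [NormedAddCommGroup E] [NormedSpace ℝ E]
    [NormedAddCommGroup F] [NormedSpace ℝ F] (W : C(E, F)), ContDiff ℝ n W →
    ContDiff ℝ n (fun γ : C(X, E) => W.comp γ) := by
  induction n with
  | zero =>
    intro E F _ _ _ _ W _
    exact contDiff_zero.2 (ContinuousMap.continuous_postcomp W)
  | succ n ih =>
    intro E F _ _ _ _ W hW
    push_cast at hW ⊢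
    obtain ⟨W', hW', hd⟩ := contDiff_succ_iff_hasFDerivAt.1 hW
    refine contDiff_succ_iff_hasFDerivAt.2
      ⟨fun γ => pointwiseApply X E F ((⟨W', hW'.continuous⟩ : C(E, E →L[ℝ] F)).comp γ), ?_, ?_⟩
    · exact (pointwiseApply X E F).contDiff.comp (ih ⟨W', hW'.continuous⟩ hW')
    · exact hasFDerivAt_postcomp W ⟨W', hW'.continuous⟩ hd

theorem contDiff_postcomp {E F : Type} [NormedAddCommGroup E] [NormedSpace ℝ E]
    [NormedAddCommGroup F] [NormedSpace ℝ F] (W : C(E, F)) (hW : ContDiff ℝ ∞ W) :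
    ContDiff ℝ ∞ (fun γ : C(X, E) => W.comp γ) :=
  contDiff_infty.2 fun n => contDiff_postcomp_nat n W (contDiff_infty.1 hW n)

variable {E : Type} [NormedAddCommGroup E] [NormedSpace ℝ E]

/-- The operator `γ ↦ ∫₀ᵘ γ` on curves over the unit interval. -/
noncomputable def primitiveCLM (E : Type) [NormedAddCommGroup E] [NormedSpace ℝ E] :
    C(Icc (0 : ℝ) 1, E) →L[ℝ] C(Icc (0 : ℝ) 1, E) :=
  LinearMap.mkContinuous
    { toFun := fun γ => ⟨fun u => ∫ v in (0 : ℝ)..u, γ (projIcc 0 1 zero_le_one v), by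
        have : Continuous fun v : ℝ => γ (projIcc 0 1 zero_le_one v) :=
          γ.continuous.comp continuous_projIcc
        exact (intervalIntegral.continuous_primitive
          (fun a b => this.intervalIntegrable a b) 0).comp continuous_subtype_val⟩
      map_add' := fun γ γ' => by
        ext u
        have h (γ : C(Icc (0 : ℝ) 1, E)) :
            Continuous fun v : ℝ => γ (projIcc 0 1 zero_le_one v) :=
          γ.continuous.comp continuous_projIcc
        exact intervalIntegral.integral_add ((h γ).intervalIntegrable _ _)
          ((h γ').intervalIntegrable _ _)
      map_smul' := fun c γ => by
        ext u
        exact intervalIntegral.integral_smul _ _ } 1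
    (fun γ => by
      rw [one_mul]
      refine (ContinuousMap.norm_le _ (norm_nonneg _)).2 fun u => ?_
      refine (intervalIntegral.norm_integral_le_of_norm_le_const (C := ‖γ‖)
        fun v _ => γ.norm_coe_le_norm _).trans ?_
      rw [sub_zero, abs_of_nonneg u.2.1]
      exact mul_le_of_le_one_right (norm_nonneg _) u.2.2)

theorem primitiveCLM_apply (γ : C(Icc (0 : ℝ) 1, E)) (u : Icc (0 : ℝ) 1) :
    primitiveCLM E γ u = ∫ v in (0 : ℝ)..u, γ (projIcc 0 1 zero_le_one v) := rfl

theorem norm_primitiveCLM_le : ‖primitiveCLM E‖ ≤ 1 :=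
  LinearMap.mkContinuous_norm_le _ zero_le_one _

/-- A bounded Lipschitz vector field has complete integral curves. -/
theorem exists_global_integralCurve [CompleteSpace E] (W : E → E) {K M : NNReal} (hK : LipschitzWith K W)
    (hM : ∀ x, ‖W x‖ ≤ M) (z : E) :
    ∃ α : ℝ → E, α 0 = z ∧ ∀ t, HasDerivAt α (W (α t)) t := by
  -- The speed is at most `M`, so over a time `n + 1` a solution stays in the ball of radius `M (n +
  -- 1)`, and the Picard–Lindelöf theorem applies for each `n`.
  have h1 : ∀ n : ℕ, ∃ α : ℝ → E, α 0 = z ∧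
      ∀ t ∈ Ioo (-((n : ℝ) + 1)) ((n : ℝ) + 1), HasDerivAt α (W (α t)) t := by
    intro n
    have hn : (0 : ℝ) ≤ (n : ℝ) + 1 := by positivity
    have hP : IsPicardLindelof (fun _ => W) (tmin := -((n : ℝ) + 1)) (tmax := (n : ℝ) + 1)
        ⟨0, by constructor <;> linarith⟩ z (M * (n + 1)) 0 M K :=
      { lipschitzOnWith := fun t _ => hK.lipschitzOnWith
        continuousOn := fun x _ => continuousOn_const
        norm_le := fun t _ x _ => hM x
        mul_max_le := by simp }
    obtain ⟨α, h0, h⟩ := hP.exists_eq_forall_mem_Icc_hasDerivWithinAt₀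
    refine ⟨α, h0, fun t ht => (h t (Ioo_subset_Icc_self ht)).hasDerivAt ?_⟩
    exact Icc_mem_nhds ht.1 ht.2
  choose α h0 hα using h1
  have huniq : ∀ m n : ℕ, m ≤ n →
      EqOn (α m) (α n) (Ioo (-((m : ℝ) + 1)) ((m : ℝ) + 1)) := by
    intro m n hmn
    have hmn' : (m : ℝ) ≤ n := by exact_mod_cast hmn
    refine ODE_solution_unique_of_mem_Ioo (v := fun _ => W) (s := fun _ => univ) (K := K) (t₀ := 0)
      (fun t _ => hK.lipschitzOnWith) ⟨by linarith [(Nat.cast_nonneg m : (0:ℝ) ≤ m)],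
        by positivity⟩
      (fun t ht => ⟨hα m t ht, mem_univ _⟩) (fun t ht => ⟨hα n t ⟨?_, ?_⟩, mem_univ _⟩) ?_
    · linarith [ht.1]
    · linarith [ht.2]
    · rw [h0, h0]
  -- By uniqueness the local solutions agree where they are both defined, so near a given time the
  -- glued curve is one of them.
  refine ⟨fun t => α ⌈|t|⌉₊ t, by simp [h0], fun t => ?_⟩
  set n := ⌈|t|⌉₊ with hn
  have ht : |t| ≤ n := Nat.le_ceil _
  have hmem : t ∈ Ioo (-((n : ℝ) + 1)) ((n : ℝ) + 1) := by
    constructor <;> linarith [abs_le.1 ht]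
  refine (hα n t hmem).congr_of_eventuallyEq ?_
  filter_upwards [Ioo_mem_nhds hmem.1 hmem.2] with u hu
  have hu' : |u| < n + 1 := abs_lt.2 ⟨by linarith [hu.1], hu.2⟩
  have hun : ⌈|u|⌉₊ ≤ n + 1 := Nat.ceil_le.2 (by push_cast; exact hu'.le)
  have hu2 : u ∈ Ioo (-((⌈|u|⌉₊ : ℝ) + 1)) ((⌈|u|⌉₊ : ℝ) + 1) := by
    have := Nat.le_ceil |u|
    constructor <;> linarith [abs_le.1 this]
  rw [huniq _ _ hun hu2, huniq n (n + 1) (Nat.le_succ _) hu]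

theorem integralCurve_unique {W : E → E} {K : NNReal} (hK : LipschitzWith K W) {α β : ℝ → E}
    (hα : ∀ t, HasDerivAt α (W (α t)) t) (hβ : ∀ t, HasDerivAt β (W (β t)) t) {t₀ : ℝ}
    (h : α t₀ = β t₀) : α = β :=
  ODE_solution_unique_univ (v := fun _ => W) (s := fun _ => univ) (K := K)
    (fun _ => hK.lipschitzOnWith) (fun t => ⟨hα t, mem_univ _⟩) (fun t => ⟨hβ t, mem_univ _⟩) h

/-- For small `t`, the map `(t, γ) ↦ (t, γ - t J (N γ))` has a smooth inverse. -/
theorem exists_smooth_resolvent {C : Type*} [NormedAddCommGroup C] [NormedSpace ℝ C]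
    [CompleteSpace C] (J : C →L[ℝ] C) (hJ1 : ‖J‖ ≤ 1) (N : C → C) (hN : ContDiff ℝ ∞ N)
    {K : NNReal} (hK : LipschitzWith K N) :
    ∃ ε > 0, ∃ g : ℝ → C → C,
      (∀ t, |t| < ε → ∀ γ, g t (γ - t • J (N γ)) = γ) ∧
      ∀ t, |t| < ε → ∀ c, ContDiffAt ℝ ∞ (fun q : ℝ × C => g q.1 q.2) (t, c) := by
  -- For `|t| < ε` the Picard map `γ ↦ c + t J (N γ)` contracts by the factor `1/2`; `g t c` is its
  -- fixed point.
  set ε : ℝ := (2 * ((K : ℝ) + 1))⁻¹ with hε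
  have hεpos : 0 < ε := by positivity
  have hεK : ε * K ≤ 1 / 2 := by
    rw [hε, inv_mul_le_iff₀ (by positivity)]
    linarith [K.2]
  have hcontr : ∀ t, |t| < ε → ∀ c : C, ContractingWith (1 / 2) (fun γ : C => c + t • J (N γ)) := by
    intro t ht c
    refine ⟨by rw [← NNReal.coe_lt_coe]; norm_num, LipschitzWith.of_dist_le_mul fun γ γ' => ?_⟩
    rw [dist_add_left, dist_smul₀]
    have h1 : dist (J (N γ)) (J (N γ')) ≤ K * dist γ γ' :=
      (J.lipschitz.dist_le_mul _ _).trans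
        ((mul_le_of_le_one_left dist_nonneg hJ1).trans (hK.dist_le_mul _ _))
    calc ‖t‖ * dist (J (N γ)) (J (N γ')) ≤ ε * (K * dist γ γ') :=
          mul_le_mul ht.le h1 dist_nonneg hεpos.le
      _ = (ε * K) * dist γ γ' := by ring
      _ ≤ (1 / 2) * dist γ γ' := mul_le_mul_of_nonneg_right hεK dist_nonneg
      _ = _ := by norm_num
  classical
  let g : ℝ → C → C := fun t c =>
    if h : |t| < ε then (hcontr t h c).fixedPoint _ else 0
  have hg1 : ∀ t, |t| < ε → ∀ γ, g t (γ - t • J (N γ)) = γ := by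
    intro t ht γ
    simp only [g, dif_pos ht]
    refine ((hcontr t ht _).fixedPoint_unique ?_).symm
    simp [Function.IsFixedPt]
  have hg2 : ∀ t, |t| < ε → ∀ c, g t c - t • J (N (g t c)) = c := by
    intro t ht c
    have := (hcontr t ht c).fixedPoint_isFixedPt
    simp only [g, dif_pos ht]
    conv_lhs => enter [1]; rw [← this.eq]
    simp
  refine ⟨ε, hεpos, g, hg1, fun t ht c => ?_⟩
  -- The derivative of `H` is invertible by the Neumann series, since `t J DN` has norm less than
  -- `1`. As `(t, c) ↦ (t, g t c)` is a left inverse of `H`, it is smooth.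
  let H : ℝ × C → ℝ × C := fun q => (q.1, q.2 - q.1 • J (N q.2))
  have hH : ContDiff ℝ ∞ H :=
    contDiff_fst.prodMk (contDiff_snd.sub
      (contDiff_fst.smul (J.contDiff.comp (hN.comp contDiff_snd))))
  set γ := g t c with hγ
  have hHγ : H (t, γ) = (t, c) := by simp only [H, hγ]; rw [hg2 t ht c]
  set DN := fderiv ℝ N γ
  have hDN : HasFDerivAt N DN γ := (hN.differentiable (by simp) γ).hasFDerivAt
  have hDNn : ‖DN‖ ≤ K := norm_fderiv_le_of_lipschitz ℝ hK
  have hsmall : ‖t • (J.comp DN)‖ < 1 := by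
    rw [norm_smul]
    have : ‖J.comp DN‖ ≤ K := (J.opNorm_comp_le DN).trans
      ((mul_le_mul hJ1 hDNn (norm_nonneg _) zero_le_one).trans (by simp))
    calc ‖t‖ * ‖J.comp DN‖ ≤ ε * K := mul_le_mul ht.le this (norm_nonneg _) hεpos.le
      _ ≤ 1 / 2 := hεK
      _ < 1 := by norm_num
  let e : C ≃L[ℝ] C := ContinuousLinearEquiv.unitsEquiv ℝ C (Units.oneSub _ hsmall)
  have he : ∀ x, e x = x - t • J (DN x) := fun x => by
    simp [e, ContinuousLinearEquiv.unitsEquiv_apply]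
  set w : C := J (N γ) with hw
  let f' : (ℝ × C) ≃L[ℝ] (ℝ × C) := ContinuousLinearEquiv.equivOfInverse
    ((ContinuousLinearMap.fst ℝ ℝ C).prod ((e : C →L[ℝ] C).comp (ContinuousLinearMap.snd ℝ ℝ C)
      - (ContinuousLinearMap.fst ℝ ℝ C).smulRight w))
    ((ContinuousLinearMap.fst ℝ ℝ C).prod ((e.symm : C →L[ℝ] C).comp
      (ContinuousLinearMap.snd ℝ ℝ C + (ContinuousLinearMap.fst ℝ ℝ C).smulRight w)))
    (fun q => by ext1 <;> simp) (fun q => by ext1 <;> simp)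
  have hf' : HasFDerivAt H (f' : ℝ × C →L[ℝ] ℝ × C) (t, γ) := by
    have h1 : HasFDerivAt (fun q : ℝ × C => J (N q.2))
        (J.comp (DN.comp (ContinuousLinearMap.snd ℝ ℝ C))) (t, γ) :=
      J.hasFDerivAt.comp (t, γ) (HasFDerivAt.comp (t, γ) (f := Prod.snd)
        (g := N) hDN hasFDerivAt_snd)
    have h2 := (hasFDerivAt_fst (𝕜 := ℝ) (p := (t, γ))).prodMk
      ((hasFDerivAt_snd (𝕜 := ℝ) (p := (t, γ))).sub
        ((hasFDerivAt_fst (𝕜 := ℝ) (p := (t, γ))).smul h1))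
    refine h2.congr_fderiv ?_
    refine ContinuousLinearMap.ext fun q => Prod.ext ?_ ?_
    · simp [f']
    · simp [f', he, hw, sub_sub]
  have := contDiffAt_of_leftInverse (f := H) (f' := f') (a := (t, γ)) (n := ∞)
    (g := fun q : ℝ × C => (q.1, g q.1 q.2)) (by simp) hH.contDiffAt hf' (by
      have : ∀ᶠ q : ℝ × C in 𝓝 (t, γ), |q.1| < ε :=
        (continuous_abs.comp continuous_fst).continuousAt.eventually_lt
          continuousAt_const ht
      filter_upwards [this] with q hq
      simp only [H]
      rw [hg1 q.1 hq])
  rw [hHγ] at this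
  exact this.snd

/-- The flow of a bounded Lipschitz smooth vector field is smooth in time and space. -/
theorem exists_smooth_flow [CompleteSpace E] (W : E → E) (hW : ContDiff ℝ ∞ W) {K M : NNReal}
    (hK : LipschitzWith K W) (hM : ∀ x, ‖W x‖ ≤ M) :
    ∃ F : ℝ → E → E, (∀ z, F 0 z = z) ∧ (∀ t z, HasDerivAt (fun s => F s z) (W (F t z)) t) ∧
      (∀ s t z, F (s + t) z = F s (F t z)) ∧ ContDiff ℝ ∞ (fun q : ℝ × E => F q.1 q.2) := by
  choose α h0 hα using exists_global_integralCurve W hK hM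
  have hadd : ∀ s t z, α z (s + t) = α (α z t) s := by
    intro s t z
    have := integralCurve_unique hK (α := fun s => α z (s + t)) (β := α (α z t)) (t₀ := 0)
      (fun s => (hα z (s + t)).comp_add_const s t) (hα _) (by simp [h0])
    exact congrFun this s
  refine ⟨fun t z => α z t, h0, fun t z => hα z t, hadd, ?_⟩
  obtain ⟨ε, hε, g, hg, hgs⟩ := exists_smooth_resolvent (primitiveCLM E) norm_primitiveCLM_le
    (fun γ : C(Icc (0 : ℝ) 1, E) => (⟨W, hW.continuous⟩ : C(E, E)).comp γ)
    (contDiff_postcomp ⟨W, hW.continuous⟩ hW) (K := K) (LipschitzWith.of_dist_le_mul fun γ γ' =>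
      (ContinuousMap.dist_le (by positivity)).2 fun x => (hK.dist_le_mul _ _).trans
        (mul_le_mul_of_nonneg_left (ContinuousMap.dist_apply_le_dist x) K.2))
  -- The curve `u ↦ α z (t u)` on the unit interval solves `γ - t J (W ∘ γ) = const z`, so it is the
  -- resolvent applied to a constant curve. Time has become a parameter, and the flow is the value
  -- at `u = 1`.
  have hαg : ∀ t, |t| < ε → ∀ z, α z t = g t (ContinuousMap.const _ z) ⟨1, by simp⟩ := by
    intro t ht z
    let γ : C(Icc (0 : ℝ) 1, E) := ⟨fun u => α z (t * u), by
      have : Continuous (α z) := continuous_iff_continuousAt.2 fun t => (hα z t).continuousAt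
      fun_prop⟩
    have h1 : γ - t • primitiveCLM E ((⟨W, hW.continuous⟩ : C(E, E)).comp γ)
        = ContinuousMap.const _ z := by
      ext u
      have hc : Continuous (α z) := continuous_iff_continuousAt.2 fun t => (hα z t).continuousAt
      have h2 : ∀ v : ℝ, HasDerivAt (fun v => α z (t * v)) (t • W (α z (t * v))) v := by
        intro v
        have h3 : HasDerivAt (fun v : ℝ => t * v) t v := by
          simpa using (hasDerivAt_id v).const_mul t
        exact HasDerivAt.scomp v (hα z (t * v)) h3
      have h3 := intervalIntegral.integral_eq_sub_of_hasDerivAt (a := 0) (b := (u : ℝ))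
        (fun v _ => h2 v) (by
          apply Continuous.intervalIntegrable
          have := hW.continuous
          fun_prop)
      rw [intervalIntegral.integral_smul] at h3
      have h4 : primitiveCLM E ((⟨W, hW.continuous⟩ : C(E, E)).comp γ) u
          = ∫ v in (0 : ℝ)..u, W (α z (t * v)) := by
        rw [primitiveCLM_apply]
        refine intervalIntegral.integral_congr fun v hv => ?_
        rw [uIcc_of_le u.2.1] at hv
        have : projIcc (0 : ℝ) 1 zero_le_one v = ⟨v, hv.1, hv.2.trans u.2.2⟩ :=
          projIcc_of_mem _ ⟨hv.1, hv.2.trans u.2.2⟩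
        simp [γ, this]
      simp only [ContinuousMap.sub_apply, ContinuousMap.smul_apply, ContinuousMap.const_apply]
      rw [h4, h3]
      simp [γ, h0]
    have h2 := hg t ht γ
    rw [h1] at h2
    rw [h2]
    simp [γ]
  have hsmall : ∀ t, |t| < ε → ∀ z, ContDiffAt ℝ ∞ (fun q : ℝ × E => α q.2 q.1) (t, z) := by
    intro t ht z
    have h1 : ContDiffAt ℝ ∞ (fun q : ℝ × E => g q.1 (ContinuousMap.const _ q.2)
        (⟨1, by simp⟩ : Icc (0 : ℝ) 1)) (t, z) := by
      have h2 : ContDiff ℝ ∞ (fun q : ℝ × E =>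
          (q.1, (ContinuousLinearMap.const ℝ (Icc (0 : ℝ) 1) : E →L[ℝ] C(Icc (0 : ℝ) 1, E)) q.2)) :=
        contDiff_fst.prodMk ((ContinuousLinearMap.contDiff _).comp contDiff_snd)
      have h3 : ContDiffAt ℝ ∞ (fun q : ℝ × E => g q.1 (ContinuousMap.const _ q.2)) (t, z) :=
        ContDiffAt.comp (t, z) (g := fun q : ℝ × C(Icc (0 : ℝ) 1, E) => g q.1 q.2)
          (hgs t ht _) h2.contDiffAt
      exact (ContinuousMap.evalCLM ℝ (⟨1, by simp⟩ : Icc (0 : ℝ) 1)).contDiff.contDiffAt.comp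
        (t, z) h3
    refine h1.congr_of_eventuallyEq ?_
    have : ∀ᶠ q : ℝ × E in 𝓝 (t, z), |q.1| < ε :=
      (continuous_abs.comp continuous_fst).continuousAt.eventually_lt continuousAt_const ht
    filter_upwards [this] with q hq
    exact hαg q.1 hq q.2
  -- The factorization of the time `t` flow into times `a t` and `(1 - a) t`, with `a = (n + 1) / (n
  -- + 2)`, splits off a step shorter than `ε` and extends smoothness from `|t| < (n + 1) ε` to `|t|
  -- < (n + 2) ε`.
  have hind : ∀ n : ℕ, ∀ t, |t| < (n + 1) * ε → ∀ z,
      ContDiffAt ℝ ∞ (fun q : ℝ × E => α q.2 q.1) (t, z) := by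
    intro n
    induction n with
    | zero => intro t ht; exact hsmall t (by simpa using ht)
    | succ n ih =>
      intro t ht z
      push_cast at ht
      set a : ℝ := ((n : ℝ) + 1) / (n + 1 + 1) with ha
      have h1 : |a * t| < (n + 1) * ε := by
        rw [abs_mul, abs_of_nonneg (by positivity), ha, div_mul_eq_mul_div,
          div_lt_iff₀ (by positivity)]
        have : (0 : ℝ) < n + 1 := by positivity
        nlinarith
      have h2 : |(1 - a) * t| < ε := by
        have h3 : (1 - a) = 1 / ((n : ℝ) + 1 + 1) := by
          rw [ha]; field_simp; ring
        rw [abs_mul, h3, abs_of_nonneg (by positivity), div_mul_eq_mul_div,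
          div_lt_iff₀ (by positivity)]
        linarith
      have h3 : (fun q : ℝ × E => α q.2 q.1)
          = fun q : ℝ × E => α (α q.2 (a * q.1)) ((1 - a) * q.1) := by
        funext q
        rw [← hadd]; congr 1; ring
      rw [h3]
      have h4 : ContDiffAt ℝ ∞ (fun q : ℝ × E => α q.2 (a * q.1)) (t, z) := by
        have : ContDiffAt ℝ ∞ (fun q : ℝ × E => (a * q.1, q.2)) (t, z) := by fun_prop
        exact ContDiffAt.comp (t, z) (g := fun q : ℝ × E => α q.2 q.1) (ih (a * t) h1 z) this
      have h5 : ContDiffAt ℝ ∞ (fun q : ℝ × E => ((1 - a) * q.1, α q.2 (a * q.1))) (t, z) :=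
        (contDiffAt_const.mul contDiffAt_fst).prodMk h4
      exact ContDiffAt.comp (t, z) (g := fun q : ℝ × E => α q.2 q.1)
        (hsmall ((1 - a) * t) h2 _) h5
  refine contDiff_iff_contDiffAt.2 fun ⟨t, z⟩ => ?_
  obtain ⟨n, hn⟩ := exists_nat_gt (|t| / ε)
  refine hind n t ?_ z
  rw [div_lt_iff₀ hε] at hn
  nlinarith

end SmoothFlow

/-! ### Nonvanishing vector fields on the plane which are horizontal outside a square -/

/-- The flows of a family of nonvanishing vector fields on the plane, which are equal to `∂ₓ`
outside a square, and everywhere for the parameter `0`. -/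
structure StripFlow where
  V : ℝ → ℂ → ℂ
  F : ℝ → ℝ → ℂ → ℂ
  r : ℝ
  M : ℝ
  r_pos : 0 < r
  V_cont : Continuous (fun q : ℝ × ℂ => V q.1 q.2)
  V_out : ∀ s z, (r ≤ |z.re| ∨ r ≤ |z.im|) → V s z = 1
  V_zero : ∀ z, V 0 z = 1
  V_ne : ∀ s z, V s z ≠ 0
  V_le : ∀ s z, ‖V s z‖ ≤ M
  smooth : ContDiff ℝ ∞ (fun q : ℝ × ℝ × ℂ => F q.1 q.2.1 q.2.2)
  zero : ∀ s z, F s 0 z = z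
  hasDerivAt : ∀ s t z, HasDerivAt (fun t => F s t z) (V s (F s t z)) t
  add : ∀ s t t' z, F s (t + t') z = F s t (F s t' z)
  unif : ∀ s w t, 0 ≤ t → (∀ u ∈ Icc 0 t, V s (w + (u : ℝ)) = 1) → F s t w = w + (t : ℝ)

namespace StripFlow

variable (fl : StripFlow)

theorem M_pos : 0 < fl.M := (norm_pos_iff.2 (fl.V_ne 0 0)).trans_le (fl.V_le 0 0)

theorem neg_cancel (s t z) : fl.F s (-t) (fl.F s t z) = z := by
  rw [← fl.add, neg_add_cancel, fl.zero]

theorem cancel_neg (s t z) : fl.F s t (fl.F s (-t) z) = z := by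
  rw [← fl.add, add_neg_cancel, fl.zero]

theorem comm (s t t' z) : fl.F s t (fl.F s t' z) = fl.F s t' (fl.F s t z) := by
  rw [← fl.add, ← fl.add, add_comm]

theorem right {s t : ℝ} {z : ℂ} (hz : fl.r ≤ z.re) (ht : 0 ≤ t) : fl.F s t z = z + t := by
  refine fl.unif s z t ht fun u hu => fl.V_out _ _ (Or.inl ?_)
  refine le_trans ?_ (le_abs_self _)
  simp only [Complex.add_re, Complex.ofReal_re]
  linarith [hu.1]

theorem left {s t : ℝ} {z : ℂ} (hz : z.re ≤ -fl.r) (ht : 0 ≤ t) : fl.F s (-t) z = z - t := by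
  have h : fl.F s t (z - t) = z := by
    have := fl.unif s (z - t) t ht fun u hu => fl.V_out _ _ (Or.inl ?_)
    · simpa using this
    · refine le_trans ?_ (neg_le_abs _)
      simp only [Complex.add_re, Complex.sub_re, Complex.ofReal_re]
      linarith [hu.2]
  conv_lhs => rw [← h]
  exact fl.neg_cancel _ _ _

theorem horiz {s : ℝ} {z : ℂ} (hz : fl.r ≤ |z.im|) (t : ℝ) : fl.F s t z = z + t := by
  have key : ∀ t : ℝ, 0 ≤ t → ∀ z : ℂ, fl.r ≤ |z.im| → fl.F s t z = z + t :=
    fun t ht z hz => fl.unif s z t ht fun u _ => fl.V_out _ _ (Or.inr (by simpa using hz))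
  rcases le_total 0 t with ht | ht
  · exact key t ht z hz
  · have h := key (-t) (by linarith) (z + t) (by simpa using hz)
    have h2 : fl.F s (-t) (z + t) = z := by simpa using h
    conv_lhs => rw [← h2]
    exact fl.cancel_neg _ _ _

theorem stay {s t t' : ℝ} {z : ℂ} (h : fl.r < (fl.F s t z).re) (ht : t ≤ t') :
    fl.F s t' z = fl.F s t z + ((t' - t : ℝ) : ℂ) := by
  have := fl.right (s := s) h.le (sub_nonneg.2 ht)
  rwa [← fl.add, sub_add_cancel] at this

theorem stay_lt {s t t' : ℝ} {z : ℂ} (h : fl.r < (fl.F s t z).re) (ht : t ≤ t') :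
    fl.r < (fl.F s t' z).re := by
  rw [fl.stay h ht, Complex.add_re, Complex.ofReal_re]
  linarith

theorem cont : Continuous (fun q : ℝ × ℝ × ℂ => fl.F q.1 q.2.1 q.2.2) := fl.smooth.continuous

theorem smooth_apply (s t : ℝ) : ContDiff ℝ ∞ (fl.F s t) :=
  fl.smooth.comp (contDiff_const.prodMk (contDiff_const.prodMk contDiff_id))

theorem hasFDerivAt (s t z) : HasFDerivAt (fl.F s t) (fderiv ℝ (fl.F s t) z) z :=
  ((fl.smooth_apply s t).differentiable (by simp) z).hasFDerivAt

theorem fderiv_V (s t z) :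
    fderiv ℝ (fl.F s t) z (fl.V s z) = fl.V s (fl.F s t z) := by
  have h1 : HasDerivAt (fun u => fl.F s t (fl.F s u z)) (fderiv ℝ (fl.F s t) z (fl.V s z)) 0 := by
    have h2 := fl.hasDerivAt s 0 z
    rw [fl.zero] at h2
    have h3 := fl.hasFDerivAt s t z
    rw [← fl.zero s z] at h3
    have := h3.comp_hasDerivAt (0 : ℝ) (h2)
    rwa [fl.zero] at this
  have h2 : HasDerivAt (fun u => fl.F s (t + u) z) (fl.V s (fl.F s (t + 0) z)) 0 := by
    have := fl.hasDerivAt s (t + 0) z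
    exact this.comp_const_add t 0
  rw [add_zero] at h2
  refine h1.unique ?_
  simpa only [fl.add] using h2

theorem fderiv_injective (s t z) : Function.Injective (fderiv ℝ (fl.F s t) z) := by
  have h : HasFDerivAt (fun z => fl.F s (-t) (fl.F s t z))
      ((fderiv ℝ (fl.F s (-t)) (fl.F s t z)).comp (fderiv ℝ (fl.F s t) z)) z :=
    (fl.hasFDerivAt s (-t) _).comp z (fl.hasFDerivAt s t z)
  simp only [fl.neg_cancel] at h
  have h2 := h.unique (hasFDerivAt_id z)
  intro u v huv
  have := congrArg (fun L : ℂ →L[ℝ] ℂ => L (u - v)) h2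
  simp only [ContinuousLinearMap.comp_apply, map_sub, huv, sub_self,
    ContinuousLinearMap.id_apply] at this
  exact (sub_eq_zero.1 this.symm)

/-! ### Poincaré–Bendixson argument: all orbits of the family escape to the right. -/

/-- Every orbit escapes to the right. -/
def Good (s : ℝ) : Prop := ∀ z, ∃ t, 0 ≤ t ∧ fl.r < (fl.F s t z).re

theorem good_zero : fl.Good 0 := by
  intro z
  refine ⟨|fl.r| + |z.re| + 1, by positivity, ?_⟩
  rw [fl.unif 0 z _ (by positivity) fun u _ => fl.V_zero _]
  simp only [Complex.add_re, Complex.ofReal_re]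
  linarith [le_abs_self fl.r, neg_abs_le z.re]

theorem good_of_square {s : ℝ}
    (h : ∀ z ∈ Icc (-fl.r) fl.r ×ℂ Icc (-fl.r) fl.r, ∃ t, 0 ≤ t ∧ fl.r < (fl.F s t z).re) :
    fl.Good s := by
  intro z
  by_cases h1 : fl.r ≤ |z.im|
  · refine ⟨|fl.r| + |z.re| + 1, by positivity, ?_⟩
    rw [fl.horiz h1]
    simp only [Complex.add_re, Complex.ofReal_re]
    linarith [le_abs_self fl.r, neg_abs_le z.re]
  have him := abs_lt.1 (not_le.1 h1)
  by_cases h2 : fl.r < z.re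
  · exact ⟨0, le_rfl, by rwa [fl.zero]⟩
  by_cases h3 : -fl.r ≤ z.re
  · exact h z ⟨⟨h3, not_lt.1 h2⟩, ⟨him.1.le, him.2.le⟩⟩
  have h3 := not_le.1 h3
  obtain ⟨t, ht, h4⟩ := h (z + ((-fl.r - z.re : ℝ) : ℂ))
    ⟨by simp [fl.r_pos.le], by simpa using ⟨him.1.le, him.2.le⟩⟩
  refine ⟨t + (-fl.r - z.re), by linarith, ?_⟩
  rw [fl.add, fl.unif s z _ (by linarith) fun u hu => fl.V_out _ _ (Or.inl ?_)]
  · exact h4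
  · refine le_trans ?_ (neg_le_abs _)
    simp only [Complex.add_re, Complex.ofReal_re]
    linarith [hu.2]

theorem isCompact_square (r : ℝ) : IsCompact (Icc (-r) r ×ℂ Icc (-r) r) :=
  isCompact_Icc.reProdIm isCompact_Icc

/-- Having escaped by a fixed time is an open condition in the parameter and the point, and only the
starting points in the compact square have to be checked. -/
theorem isOpen_good : IsOpen {s | fl.Good s} := by
  refine isOpen_iff_eventually.2 ?_
  intro s hs
  have h := (isCompact_square fl.r).eventually_forall_of_forall_eventually (x₀ := s)
    (P := fun s z => ∃ t, 0 ≤ t ∧ fl.r < (fl.F s t z).re) ?_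
  · exact h.mono fun s' hs' => fl.good_of_square hs'
  · intro z _
    obtain ⟨t, ht, h⟩ := hs z
    have hc : Continuous fun q : ℝ × ℂ => (fl.F q.1 t q.2).re :=
      Complex.continuous_re.comp (fl.cont.comp (by fun_prop : Continuous
        fun q : ℝ × ℂ => (q.1, t, q.2)))
    filter_upwards [hc.continuousAt.eventually (lt_mem_nhds (a := fl.r) (b := _) h)] with q hq
    exact ⟨t, ht, hq⟩

/-- An escaped orbit stays escaped, so the open sets of points that have escaped by time `n`
increase with `n`, and compactness selects one of them. -/
theorem exists_uniform_escape {K : Set (ℝ × ℂ)} (hK : IsCompact K) (h : ∀ q ∈ K, fl.Good q.1) :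
    ∃ T, 0 ≤ T ∧ ∀ q ∈ K, fl.r < (fl.F q.1 T q.2).re := by
  obtain ⟨n, hn⟩ := hK.elim_directed_cover (fun n : ℕ => {q | fl.r < (fl.F q.1 n q.2).re})
    (fun n => isOpen_lt continuous_const (Complex.continuous_re.comp (fl.cont.comp (by fun_prop :
      Continuous fun q : ℝ × ℂ => (q.1, (n : ℝ), q.2)))))
    (fun q hq => by
      obtain ⟨t, ht, h1⟩ := h q hq q.2
      obtain ⟨n, hn⟩ := exists_nat_ge t
      exact mem_iUnion.2 ⟨n, fl.stay_lt h1 hn⟩)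
    (directed_of_isDirected_le fun m n hmn q hq =>
      fl.stay_lt hq (by exact_mod_cast hmn))
  exact ⟨n, Nat.cast_nonneg n, fun q hq => hn hq⟩

theorem norm_F_sub_le (s t z) : ‖fl.F s t z - z‖ ≤ fl.M * |t| := by
  have := convex_univ.norm_image_sub_le_of_norm_hasDerivWithin_le (f := fun t => fl.F s t z)
    (x := (0 : ℝ)) (y := t)
    (fun t _ => (fl.hasDerivAt s t z).hasDerivWithinAt) (fun t _ => fl.V_le _ _) (mem_univ _)
    (mem_univ _)
  simpa [fl.zero] using this

/-- An orbit close to `p` crosses the transversal line at `p`. -/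
theorem exists_cross {s : ℝ} {p q n : ℂ} {η m : ℝ} (hη : 0 < η)
    (hV : ∀ q', ‖q' - p‖ < 2 * η → m ≤ (fl.V s q' * starRingEnd ℂ n).re)
    (hq : ‖q - p‖ < η) (hq2 : |((q - p) * starRingEnd ℂ n).re| ≤ m * (η / fl.M)) :
    ∃ t, |t| ≤ η / fl.M ∧ ((fl.F s t q - p) * starRingEnd ℂ n).re = 0 ∧
      ‖fl.F s t q - p‖ < 2 * η := by
  have hM := fl.M_pos
  set c := η / fl.M with hc
  have hcpos : 0 < c := by positivity
  have hball : ∀ t, |t| ≤ c → ‖fl.F s t q - p‖ < 2 * η := by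
    intro t ht
    have h1 := fl.norm_F_sub_le s t q
    have h2 : fl.M * |t| ≤ η := by
      calc fl.M * |t| ≤ fl.M * c := by gcongr
        _ = η := by rw [hc]; field_simp
    calc ‖fl.F s t q - p‖ = ‖(fl.F s t q - q) + (q - p)‖ := by ring_nf
      _ ≤ _ := norm_add_le _ _
      _ < 2 * η := by linarith
  set g : ℝ → ℝ := fun t => ((fl.F s t q - p) * starRingEnd ℂ n).re with hg
  have hgd : ∀ t, HasDerivAt g ((fl.V s (fl.F s t q) * starRingEnd ℂ n).re) t := by
    intro t
    have h1 := (((fl.hasDerivAt s t q).sub_const p).mul_const (starRingEnd ℂ n))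
    exact (Complex.reCLM.hasFDerivAt.comp_hasDerivAt t h1)
  have hgc : Continuous g := continuous_iff_continuousAt.2 fun t => (hgd t).continuousAt
  -- For `|t| ≤ c` the orbit stays where the component of the field along `n` is at least `m`. So
  -- `g` grows at rate at least `m`, and it reaches `0` because `|g 0| ≤ m c`.
  have hmono : ∀ a b, -c ≤ a → a ≤ b → b ≤ c → m * (b - a) ≤ g b - g a := by
    intro a b ha hab hb
    refine (convex_Icc (-c) c).mul_sub_le_image_sub_of_le_deriv hgc.continuousOn
      (fun t _ => (hgd t).differentiableAt.differentiableWithinAt) ?_ a ⟨ha, hab.trans hb⟩ b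
      ⟨ha.trans hab, hb⟩ hab
    intro t ht
    rw [interior_Icc] at ht
    rw [(hgd t).deriv]
    exact hV _ (hball t (abs_le.2 ⟨ht.1.le, ht.2.le⟩))
  have hg0 : g 0 = ((q - p) * starRingEnd ℂ n).re := by simp [hg, fl.zero]
  have h1 := hmono 0 c (by linarith) hcpos.le le_rfl
  have h2 := hmono (-c) 0 le_rfl (by linarith) hcpos.le
  rw [← hg0] at hq2
  have h3 := abs_le.1 hq2
  have hmem : (0 : ℝ) ∈ Icc (g (-c)) (g c) := ⟨by linarith [h3.2], by linarith [h3.1]⟩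
  obtain ⟨t, ht, h4⟩ := intermediate_value_Icc (by linarith : -c ≤ c) hgc.continuousOn hmem
  exact ⟨t, abs_le.2 ht, h4, hball t (abs_le.2 ht)⟩

/-- If all orbits escape, then an orbit crosses a transversal segment at most once. -/
theorem Good.not_cross_twice {s : ℝ} (hs : fl.Good s) {p q n : ℂ} {η m D : ℝ} (hm : 0 < m)
    (hV : ∀ q', ‖q' - p‖ < 2 * η → m ≤ (fl.V s q' * starRingEnd ℂ n).re)
    (hq : ‖q - p‖ < 2 * η) (hq0 : ((q - p) * starRingEnd ℂ n).re = 0) (hD : 0 < D)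
    (hqD : ‖fl.F s D q - p‖ < 2 * η) (hqD0 : ((fl.F s D q - p) * starRingEnd ℂ n).re = 0) :
    False := by
  -- The ends of the chord from `q` to `q₂` lie on one orbit. At a time `T` when the whole chord has
  -- been carried to the region where the flow is horizontal, the images of the ends have the same
  -- height. By Rolle the differential of the time `T` flow sends the chord direction to a
  -- horizontal vector at some point `x`, that is, to a multiple of the image of `V s x`.
  -- Injectivity of the differential makes the chord parallel to `V s x`, which contradicts
  -- transversality.
  set q₂ := fl.F s D q with hq₂
  obtain ⟨T, hT, h⟩ := fl.exists_uniform_escape (K := {s} ×ˢ segment ℝ q q₂)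
    (isCompact_singleton.prod (by
      rw [segment_eq_image']; exact isCompact_Icc.image (by fun_prop)))
    (fun x hx => by rw [mem_singleton_iff.1 hx.1]; exact hs)
  have hseg : ∀ x ∈ segment ℝ q q₂, fl.r < (fl.F s T x).re := fun x hx => h (s, x) ⟨rfl, hx⟩
  have hend : fl.F s T q₂ = fl.F s T q + (D : ℂ) := by
    rw [hq₂, fl.comm, fl.right (hseg q (left_mem_segment _ _ _)).le hD.le]
  have hne : q₂ - q ≠ 0 := by
    intro h0
    rw [sub_eq_zero.1 h0] at hend
    have : (D : ℂ) = 0 := by simpa using hend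
    exact hD.ne' (by exact_mod_cast this)
  let g : ℝ → ℝ := fun y => (fl.F s T (q + (y : ℝ) • (q₂ - q))).im
  have hgd : ∀ y, HasDerivAt g
      ((fderiv ℝ (fl.F s T) (q + (y : ℝ) • (q₂ - q)) (q₂ - q)).im) y := by
    intro y
    have h1 : HasDerivAt (fun y : ℝ => q + y • (q₂ - q)) (q₂ - q) y := by
      simpa using ((hasDerivAt_id y).smul_const (q₂ - q)).const_add q
    exact Complex.imCLM.hasFDerivAt.comp_hasDerivAt y
      ((fl.hasFDerivAt s T _).comp_hasDerivAt y h1)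
  obtain ⟨y, hy, hy0⟩ := exists_hasDerivAt_eq_zero (zero_lt_one' ℝ)
    (continuous_iff_continuousAt.2 fun t => (hgd t).continuousAt).continuousOn
    (by simp [g, hend]) (fun y _ => hgd y)
  set x := q + (y : ℝ) • (q₂ - q) with hx
  have hxseg : x ∈ segment ℝ q q₂ := by
    rw [segment_eq_image']; exact ⟨y, Ioo_subset_Icc_self hy, rfl⟩
  have hxball : ‖x - p‖ < 2 * η := by
    have := (convex_ball p (2 * η)).segment_subset (mem_ball_iff_norm.2 hq)
      (mem_ball_iff_norm.2 hqD) hxseg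
    exact mem_ball_iff_norm.1 this
  have hVx := hV x hxball
  set L := fderiv ℝ (fl.F s T) x
  have hL1 : L (fl.V s x) = 1 := by
    rw [fl.fderiv_V, fl.V_out _ _ (Or.inl ((hseg x hxseg).le.trans (le_abs_self _)))]
  set a := (L (q₂ - q)).re with ha
  have hL2 : L (q₂ - q) = L (a • fl.V s x) := by
    rw [map_smul, hL1]
    apply Complex.ext
    · simp [ha]
    · simpa using hy0
  have h3 := fl.fderiv_injective s T x hL2
  have h4 : ((q₂ - q) * starRingEnd ℂ n).re = 0 := by
    have : (q₂ - q) * starRingEnd ℂ n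
        = (q₂ - p) * starRingEnd ℂ n - (q - p) * starRingEnd ℂ n := by ring
    rw [this, Complex.sub_re, hqD0, hq0, sub_zero]
  have h5 : a * (fl.V s x * starRingEnd ℂ n).re = 0 := by
    rw [← h4, h3, smul_mul_assoc, Complex.smul_re, smul_eq_mul]
  have ha0 : a = 0 := by
    rcases mul_eq_zero.1 h5 with h | h
    · exact h
    · linarith
  exact hne (by rw [h3, ha0, zero_smul])

/-- Let a trapped orbit for a limit parameter `s` be given. It stays in a compact set and
accumulates at a point `p`, hence comes close to `p` at two widely separated times. For a good
parameter `s'` near `s` the orbit of the same point does so too, and thus crosses a transversal at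
`p` twice, which `Good.not_cross_twice` forbids. -/
theorem isClosed_good : IsClosed {s | fl.Good s} := by
  refine isClosed_of_closure_subset fun s hs => ?_
  by_contra hbad
  simp only [mem_ofPred_eq, Good, not_forall, not_exists, not_and, not_lt] at hbad
  obtain ⟨z, hz⟩ := hbad
  have him : |z.im| < fl.r := by
    by_contra h1
    have := hz (|fl.r| + |z.re| + 1) (by positivity)
    rw [fl.horiz (not_lt.1 h1)] at this
    simp only [Complex.add_re, Complex.ofReal_re] at this
    linarith [le_abs_self fl.r, neg_abs_le z.re]
  -- The trapped orbit cannot go further left than its starting point or the left edge, nor leave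
  -- the strip, because outside the square the flow is a translation to the right.
  have hmem : ∀ n : ℕ, fl.F s n z ∈ Icc (min z.re (-fl.r)) fl.r ×ℂ Icc (-fl.r) fl.r := by
    intro n
    have hn : (0 : ℝ) ≤ n := Nat.cast_nonneg n
    refine ⟨⟨?_, hz n hn⟩, ?_⟩
    · by_contra h
      obtain ⟨h1, h2⟩ := lt_min_iff.1 (not_le.1 h)
      have h3 := fl.left (s := s) h2.le hn
      rw [fl.neg_cancel] at h3
      have h4 := congrArg Complex.re h3
      simp only [Complex.sub_re, Complex.ofReal_re] at h4
      linarith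
    · by_contra h
      have h1 : fl.r ≤ |(fl.F s n z).im| := by
        by_contra h2
        exact h ⟨(abs_lt.1 (not_le.1 h2)).1.le, (abs_lt.1 (not_le.1 h2)).2.le⟩
      have h3 := fl.horiz (s := s) h1 (-(n : ℝ))
      rw [fl.neg_cancel] at h3
      have h4 := congrArg Complex.im h3
      simp only [Complex.add_im, Complex.ofReal_im, add_zero] at h4
      rw [← h4] at h1
      linarith
  obtain ⟨p, -, k, hk, hlim⟩ := (isCompact_Icc.reProdIm isCompact_Icc).tendsto_subseq hmem
  have hM := fl.M_pos
  set n := fl.V s p with hn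
  have hn0 : 0 < ‖n‖ := norm_pos_iff.2 (fl.V_ne s p)
  set m := ‖n‖ ^ 2 / 2 with hm
  have hmpos : 0 < m := by positivity
  have hnear : ∀ᶠ x : ℝ × ℂ in 𝓝 (s, p), m < (fl.V x.1 x.2 * starRingEnd ℂ n).re := by
    have hc : Continuous fun x : ℝ × ℂ => (fl.V x.1 x.2 * starRingEnd ℂ n).re :=
      Complex.continuous_re.comp (fl.V_cont.mul continuous_const)
    refine hc.continuousAt.eventually (lt_mem_nhds ?_)
    simp only [← hn, Complex.mul_conj, Complex.ofReal_re, Complex.normSq_eq_norm_sq]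
    rw [hm]; linarith [pow_pos hn0 2]
  obtain ⟨ε, hε, hball⟩ := Metric.eventually_nhds_iff_ball.1 hnear
  set η := ε / 2 with hη
  have hηpos : 0 < η := by positivity
  have hV : ∀ s', dist s' s < ε → ∀ q', ‖q' - p‖ < 2 * η →
      m ≤ (fl.V s' q' * starRingEnd ℂ n).re := by
    intro s' hs' q' hq'
    refine (hball (s', q') ?_).le
    rw [mem_ball, Prod.dist_eq]
    refine max_lt hs' ?_
    rw [dist_eq_norm]; linarith
  -- The second term bounds the distance to the transversal line in the way that `exists_cross`
  -- requires.
  set η' := min η (m * (η / fl.M) / ‖n‖) with hη'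
  have hη'pos : 0 < η' := by positivity
  have hev : ∀ᶠ i in atTop, ‖fl.F s (k i) z - p‖ < η' := by
    have := Metric.tendsto_nhds.1 hlim η' hη'pos
    filter_upwards [this] with i hi
    rwa [dist_eq_norm] at hi
  obtain ⟨i, hi⟩ := hev.exists
  -- Each crossing time is within `η / M` of the corresponding time, so a gap of more than `2 η / M`
  -- keeps the two crossings distinct and in order.
  obtain ⟨j, hj, hji⟩ := (hev.and ((tendsto_natCast_atTop_atTop.comp hk.tendsto_atTop).eventually
    (eventually_gt_atTop ((k i : ℝ) + 2 * (η / fl.M))))).exists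
  simp only [Function.comp_apply] at hji
  have hcs : ∀ N : ℝ, ‖fl.F s N z - p‖ < η' → ∀ᶠ s' in 𝓝 s, ‖fl.F s' N z - p‖ < η' := by
    intro N hN
    have hc : Continuous fun s' => ‖fl.F s' N z - p‖ :=
      ((fl.cont.comp (by fun_prop : Continuous fun s' : ℝ => (s', N, z))).sub
        continuous_const).norm
    exact hc.continuousAt.eventually (gt_mem_nhds hN)
  obtain ⟨s', hgood, hs', hi', hj'⟩ := ((mem_closure_iff_frequently.1 hs).and_eventually
    ((Metric.eventually_nhds_iff.2 ⟨ε, hε, fun {y} h => h⟩ : ∀ᶠ s' in 𝓝 s, dist s' s < ε).and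
      ((hcs _ hi).and (hcs _ hj)))).exists
  have hclose : ∀ N : ℝ, ‖fl.F s' N z - p‖ < η' →
      |((fl.F s' N z - p) * starRingEnd ℂ n).re| ≤ m * (η / fl.M) := by
    intro N hN
    refine (Complex.abs_re_le_norm _).trans ?_
    rw [norm_mul, RCLike.norm_conj]
    have := (hN.trans_le (min_le_right _ _)).le
    rwa [le_div_iff₀ hn0] at this
  obtain ⟨t₁, ht₁, h10, h1b⟩ := fl.exists_cross hηpos (hV s' hs')
    (hi'.trans_le (min_le_left _ _)) (hclose _ hi')
  obtain ⟨t₂, ht₂, h20, h2b⟩ := fl.exists_cross hηpos (hV s' hs')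
    (hj'.trans_le (min_le_left _ _)) (hclose _ hj')
  have hD : fl.F s' (t₂ + k j - (t₁ + k i)) (fl.F s' t₁ (fl.F s' (k i) z))
      = fl.F s' t₂ (fl.F s' (k j) z) := by
    rw [← fl.add, ← fl.add, ← fl.add]; congr 1; ring
  refine Good.not_cross_twice fl hgood (q := fl.F s' t₁ (fl.F s' (k i) z))
    (D := t₂ + k j - (t₁ + k i)) hmpos (hV s' hs') h1b h10 ?_ ?_ ?_
  · linarith [(abs_le.1 ht₁).2, (abs_le.1 ht₂).1]
  · rwa [hD]
  · rwa [hD]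

/-- The good parameters form a clopen set containing `0`, where the field is `∂ₓ`, and the parameter
line is connected. -/
theorem good (s : ℝ) : fl.Good s := by
  have : {s | fl.Good s} = univ :=
    IsClopen.eq_univ ⟨fl.isClosed_good, fl.isOpen_good⟩ ⟨0, fl.good_zero⟩
  exact (this ▸ mem_univ s : s ∈ {s | fl.Good s})

/-- The flow conjugated by `z ↦ -z` and with time reversed. -/
def reflect : StripFlow where
  V := fun s z => fl.V s (-z)
  F := fun s t z => -fl.F s (-t) (-z)
  r := fl.r
  M := fl.M
  r_pos := fl.r_pos
  V_cont := fl.V_cont.comp (by fun_prop : Continuous fun q : ℝ × ℂ => (q.1, -q.2))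
  V_out := fun s z h => fl.V_out s (-z) (by simpa using h)
  V_zero := fun z => fl.V_zero _
  V_ne := fun s z => fl.V_ne _ _
  V_le := fun s z => fl.V_le _ _
  smooth := (fl.smooth.comp (by fun_prop :
    ContDiff ℝ ∞ fun q : ℝ × ℝ × ℂ => (q.1, -q.2.1, -q.2.2))).neg
  zero := fun s z => by simp [fl.zero]
  hasDerivAt := fun s t z => by
    have h := (fl.hasDerivAt s (-t) (-z)).scomp t (hasDerivAt_neg t)
    have h2 := h.neg
    rw [neg_one_smul, neg_neg] at h2
    change HasDerivAt (fun t => -fl.F s (-t) (-z)) (fl.V s (- -fl.F s (-t) (-z))) t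
    rw [neg_neg]
    exact h2
  add := fun s t t' z => by
    rw [neg_add, fl.add, neg_neg]
  unif := fun s w t ht h => by
    have h1 := fl.unif s (-w - t) t ht fun u hu => by
      have := h (t - u) ⟨by linarith [hu.2], by linarith [hu.1]⟩
      rw [← this]; congr 1; push_cast; ring
    have h2 : fl.F s t (-w - t) = -w := by rw [h1]; ring
    rw [← h2, fl.neg_cancel]; ring

/-- This is forward escape for the reflected, time-reversed flow. -/
theorem exists_backward (s : ℝ) (z : ℂ) : ∃ T, 0 ≤ T ∧ (fl.F s (-T) z).re < -fl.r := by
  obtain ⟨T, hT, h⟩ := fl.reflect.good s (-z)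
  refine ⟨T, hT, ?_⟩
  simp only [reflect, neg_neg, Complex.neg_re] at h
  linarith

/-! ### Straightening maps of the fields, and their inverses. -/

/-- The map which straightens the orbits: it sends `∂ₓ` to the vector field `V s`, and is the
identity on the left. -/
def wave (s : ℝ) (z : ℂ) : ℂ := fl.F s (z.re + fl.r) (z - ((z.re + fl.r : ℝ) : ℂ))

/-- To the left of the square the flow is a translation, so the base point may be moved further left
without changing the result. -/
theorem wave_eq {s T : ℝ} {z : ℂ} (hT : z.re + fl.r ≤ T) : fl.wave s z = fl.F s T (z - T) := by
  set w := z - ((z.re + fl.r : ℝ) : ℂ) with hw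
  set u := T - (z.re + fl.r) with hu
  have hwre : w.re ≤ -fl.r := by simp [hw]
  have h1 := fl.left (s := s) hwre (sub_nonneg.2 hT)
  have h2 : z - (T : ℂ) = fl.F s (-(T - (z.re + fl.r))) w := by
    rw [h1, hw]; push_cast; ring
  rw [h2, ← fl.add, wave]
  congr 1; ring

/-- The inverse of `wave`. -/
noncomputable def waveInv (s : ℝ) (z : ℂ) : ℂ :=
  fl.F s (-(fl.exists_backward s z).choose) z + ((fl.exists_backward s z).choose : ℂ)

/-- The formula does not depend on the backward time once the left region is reached. The time may
therefore be kept constant near a given point, which makes the chosen inverse smooth. -/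
theorem waveInv_eq {s T : ℝ} {z : ℂ} (hT : (fl.F s (-T) z).re ≤ -fl.r) :
    fl.waveInv s z = fl.F s (-T) z + T := by
  have key : ∀ T T' : ℝ, (fl.F s (-T) z).re ≤ -fl.r → T ≤ T' →
      fl.F s (-T') z + T' = fl.F s (-T) z + T := by
    intro T T' h h'
    have h1 := fl.left (s := s) h (sub_nonneg.2 h')
    rw [← fl.add] at h1
    have : -(T' - T) + -T = -T' := by ring
    rw [this] at h1
    rw [h1]; push_cast; ring
  have h0 := (fl.exists_backward s z).choose_spec.2.le
  rcases le_total T (fl.exists_backward s z).choose with h | h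
  · exact key _ _ hT h
  · exact (key _ _ h0 h).symm

theorem waveInv_wave (s z) : fl.waveInv s (fl.wave s z) = z := by
  set T := z.re + fl.r with hT
  have h1 : fl.F s (-T) (fl.wave s z) = z - T := fl.neg_cancel _ _ _
  rw [fl.waveInv_eq (T := T) (by rw [h1]; simp [hT]), h1, sub_add_cancel]

theorem wave_waveInv (s z) : fl.wave s (fl.waveInv s z) = z := by
  obtain ⟨T, -, hT⟩ := fl.exists_backward s z
  rw [fl.waveInv_eq hT.le, fl.wave_eq (T := T), add_sub_cancel_right, fl.cancel_neg]
  simp only [Complex.add_re, Complex.ofReal_re]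
  linarith

theorem contDiff_wave : ContDiff ℝ ∞ (fun q : ℝ × ℂ => fl.wave q.1 q.2) := by
  have h1 : ContDiff ℝ ∞ fun q : ℝ × ℂ => q.2.re := Complex.reCLM.contDiff.comp contDiff_snd
  have h2 : ContDiff ℝ ∞ fun q : ℝ × ℂ => (q.1, q.2.re + fl.r, q.2 - ((q.2.re + fl.r : ℝ) : ℂ)) :=
    contDiff_fst.prodMk ((h1.add contDiff_const).prodMk
      (contDiff_snd.sub (Complex.ofRealCLM.contDiff.comp (h1.add contDiff_const))))
  exact fl.smooth.comp h2

theorem contDiff_waveInv : ContDiff ℝ ∞ (fun q : ℝ × ℂ => fl.waveInv q.1 q.2) := by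
  refine contDiff_iff_contDiffAt.2 fun ⟨s, z⟩ => ?_
  obtain ⟨T, -, hT⟩ := fl.exists_backward s z
  have h1 : ContDiff ℝ ∞ fun q : ℝ × ℂ => fl.F q.1 (-T) q.2 :=
    fl.smooth.comp (contDiff_fst.prodMk (contDiff_const.prodMk contDiff_snd))
  refine (h1.add (contDiff_const (c := (T : ℂ)))).contDiffAt.congr_of_eventuallyEq ?_
  have h2 : Continuous fun q : ℝ × ℂ => (fl.F q.1 (-T) q.2).re :=
    Complex.continuous_re.comp h1.continuous
  filter_upwards [h2.continuousAt.eventually (gt_mem_nhds hT)] with q hq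
  exact fl.waveInv_eq hq.le

theorem wave_left {s : ℝ} {z : ℂ} (hz : z.re ≤ -fl.r) : fl.wave s z = z := by
  rw [fl.wave_eq (T := 0) (by linarith), fl.zero]; simp

theorem wave_horiz {s : ℝ} {z : ℂ} (hz : fl.r ≤ |z.im|) : fl.wave s z = z := by
  rw [wave, fl.horiz (by simpa using hz)]; ring

theorem wave_id {s : ℝ} (h : ∀ z, fl.V s z = 1) (z : ℂ) : fl.wave s z = z := by
  rw [fl.wave_eq (T := |z.re + fl.r|) (le_abs_self _),
    fl.unif _ _ _ (abs_nonneg _) fun u _ => h _]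
  ring

theorem wave_add {s u : ℝ} {z : ℂ} (hz : fl.r ≤ (fl.wave s z).re) (hu : 0 ≤ u) :
    fl.wave s (z + u) = fl.wave s z + u := by
  rw [← fl.right hz hu, wave, wave, ← fl.add]
  congr 1
  · simp; ring
  · simp only [Complex.add_re, Complex.ofReal_re]; push_cast; ring

/-- For parameters in `[a, b]` a single time carries the whole left edge of the square past the
right edge, by compactness; for the other parameters `wave` is the identity. -/
theorem exists_right_escape {a b : ℝ} (hab : ∀ s, s ∉ Icc a b → ∀ z, fl.V s z = 1) :
    ∃ m, fl.r ≤ m ∧ ∀ s (z : ℂ), m ≤ z.re → fl.r ≤ (fl.wave s z).re := by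
  obtain ⟨T₀, hT₀, h⟩ := fl.exists_uniform_escape
    (K := Icc a b ×ˢ ({-fl.r} ×ℂ Icc (-fl.r) fl.r))
    (isCompact_Icc.prod (isCompact_singleton.reProdIm isCompact_Icc)) fun q _ => fl.good q.1
  set T := max T₀ (2 * fl.r) with hT
  have hT2 : 2 * fl.r ≤ T := le_max_right _ _
  refine ⟨T - fl.r, by linarith, fun s z hz => ?_⟩
  by_cases hs : s ∈ Icc a b
  swap
  · rw [fl.wave_id (hab s hs)]; linarith
  by_cases hz2 : fl.r ≤ |z.im|
  · rw [fl.wave_horiz hz2]; linarith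
  have him := abs_lt.1 (not_le.1 hz2)
  have h1 := h (s, z - ((z.re + fl.r : ℝ) : ℂ)) ⟨hs, by simp, by simpa using ⟨him.1.le, him.2.le⟩⟩
  exact (fl.stay_lt h1 (le_trans (le_max_left _ _) (by linarith : T ≤ z.re + fl.r))).le

end StripFlow

/-! ### Inverting families of increasing functions -/

/-- Each function is strictly increasing and at bounded distance from the identity, hence bijective.
Joint smoothness of the inverses comes from the inverse function theorem for `(p, x) ↦ (p, k (p,
x))`. -/
theorem exists_smooth_inverse_family {P : Type*} [NormedAddCommGroup P] [NormedSpace ℝ P]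
    [CompleteSpace P] (k : P × ℝ → ℝ) (hk : ContDiff ℝ ∞ k)
    (hpos : ∀ p x, 0 < deriv (fun x => k (p, x)) x) {C : ℝ} (hC : ∀ p x, |k (p, x) - x| ≤ C) :
    ∃ l : P × ℝ → ℝ, ContDiff ℝ ∞ l ∧ (∀ p x, k (p, l (p, x)) = x) ∧
      ∀ p x, l (p, k (p, x)) = x := by
  have hcont : ∀ p, Continuous fun x => k (p, x) := fun p =>
    hk.continuous.comp (by fun_prop)
  have hmono : ∀ p, StrictMono fun x => k (p, x) := fun p => strictMono_of_deriv_pos (hpos p)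
  have hsurj : ∀ p, Function.Surjective fun x => k (p, x) := fun p =>
    (hcont p).surjective
      (tendsto_atTop_mono (fun x => by simp only [id]; linarith [(abs_le.1 (hC p x)).1])
        (tendsto_atTop_add_const_right atTop (-C) tendsto_id))
      (tendsto_atBot_mono (fun x => by simp only [id]; linarith [(abs_le.1 (hC p x)).2])
        (tendsto_atBot_add_const_right atBot C tendsto_id))
  choose l hl using hsurj
  have hl2 : ∀ p x, l p (k (p, x)) = x := fun p x => (hmono p).injective (hl p _)
  refine ⟨fun q => l q.1 q.2, contDiff_iff_contDiffAt.2 fun ⟨p, y⟩ => ?_, hl, hl2⟩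
  set x := l p y with hx
  have hxy : k (p, x) = y := hl p y
  set L := fderiv ℝ k (p, x)
  have hL : HasFDerivAt k L (p, x) := (hk.differentiable (by simp) _).hasFDerivAt
  set d := L (0, 1) with hd
  have hdpos : 0 < d := by
    have h1 : HasDerivAt (fun x => k (p, x)) d x :=
      hL.comp_hasDerivAt x ((hasDerivAt_const x p).prodMk (hasDerivAt_id x))
    rw [← h1.deriv]; exact hpos p x
  have hsplit : ∀ v : P × ℝ, L v = L (v.1, 0) + d * v.2 := by
    intro v
    have : v = (v.1, 0) + v.2 • ((0, 1) : P × ℝ) := by ext <;> simp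
    conv_lhs => rw [this]
    rw [map_add, map_smul, smul_eq_mul, mul_comm]
  let f' : (P × ℝ) ≃L[ℝ] (P × ℝ) := ContinuousLinearEquiv.equivOfInverse
    ((ContinuousLinearMap.fst ℝ P ℝ).prod L)
    ((ContinuousLinearMap.fst ℝ P ℝ).prod (d⁻¹ • (ContinuousLinearMap.snd ℝ P ℝ -
      L.comp ((ContinuousLinearMap.inl ℝ P ℝ).comp (ContinuousLinearMap.fst ℝ P ℝ)))))
    (fun v => by
      refine Prod.ext (by simp) ?_
      simp [hsplit v]
      field_simp)
    (fun v => by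
      refine Prod.ext (by simp) ?_
      have : L (v.1, d⁻¹ * (v.2 - L (v.1, 0))) = v.2 := by
        rw [hsplit]
        simp only
        field_simp
        ring
      exact this)
  have h := contDiffAt_of_leftInverse (f := fun q : P × ℝ => (q.1, k q)) (f' := f')
    (a := (p, x)) (g := fun q => (q.1, l q.1 q.2)) (n := ∞) (by simp)
    (contDiff_fst.prodMk hk).contDiffAt (hasFDerivAt_fst.prodMk hL)
    (Eventually.of_forall fun q => by simp [hl2])
  rw [hxy] at h
  exact h.snd

theorem exists_deriv_smoothTransition_le : ∃ C, ∀ x, |deriv Real.smoothTransition x| ≤ C := by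
  have hc : Continuous (deriv Real.smoothTransition) :=
    (Real.smoothTransition.contDiff (n := 1)).continuous_deriv le_rfl
  obtain ⟨C, hC⟩ := (isCompact_Icc (a := (0 : ℝ)) (b := 1)).exists_bound_of_continuousOn
    hc.continuousOn
  refine ⟨max C 0, fun x => ?_⟩
  by_cases hx : x ∈ Icc (0 : ℝ) 1
  · exact (hC x hx).trans (le_max_left _ _)
  · rw [mem_Icc, not_and_or, not_le, not_le] at hx
    have : deriv Real.smoothTransition x = 0 := by
      rcases hx with hx | hx
      · have : Real.smoothTransition =ᶠ[𝓝 x] fun _ => 0 := by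
          filter_upwards [gt_mem_nhds hx] with y hy
          exact Real.smoothTransition.zero_of_nonpos hy.le
        rw [this.deriv_eq]; simp
      · have : Real.smoothTransition =ᶠ[𝓝 x] fun _ => 1 := by
          filter_upwards [lt_mem_nhds hx] with y hy
          exact Real.smoothTransition.one_of_one_le hy.le
        rw [this.deriv_eq]; simp
    rw [this]; simp

/-! ### Isotopies from the straightening maps -/

namespace StripFlow

variable (fl : StripFlow)

/-- The displacement of `wave` on the far right. -/
theorem exists_displacement {a b : ℝ} (hab : ∀ s, s ∉ Icc a b → ∀ z, fl.V s z = 1) :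
    ∃ (m : ℝ) (c : ℝ × ℝ → ℂ), fl.r ≤ m ∧ ContDiff ℝ ∞ c ∧
      (∀ s (z : ℂ), m ≤ z.re → fl.wave s z = z + c (s, z.im)) ∧
      (∀ s y, fl.r ≤ |y| → c (s, y) = 0) ∧
      (∀ s, (∀ z : ℂ, fl.r ≤ z.re → fl.wave s z = z) → ∀ y, c (s, y) = 0) ∧
      (∃ C, ∀ q, ‖c q‖ ≤ C) ∧
      ∀ s y, 0 < 1 + (deriv (fun y => c (s, y)) y).im := by
  obtain ⟨m, hm, hesc⟩ := fl.exists_right_escape hab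
  let e : ℝ × ℝ → ℂ := fun q => (m : ℂ) + q.2 * Complex.I
  have he : ContDiff ℝ ∞ e := by
    have : ContDiff ℝ ∞ fun q : ℝ × ℝ => (q.2 : ℂ) := Complex.ofRealCLM.contDiff.comp contDiff_snd
    exact contDiff_const.add (this.mul contDiff_const)
  have here : ∀ q, (e q).re = m := fun q => by simp [e]
  have heim : ∀ q, (e q).im = q.2 := fun q => by simp [e]
  let c : ℝ × ℝ → ℂ := fun q => fl.wave q.1 (e q) - e q
  have hc : ContDiff ℝ ∞ c := (fl.contDiff_wave.comp (contDiff_fst.prodMk he)).sub he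
  have hright : ∀ s (z : ℂ), m ≤ z.re → fl.wave s z = z + c (s, z.im) := by
    intro s z hz
    have h1 : z = e (s, z.im) + ((z.re - m : ℝ) : ℂ) := by
      apply Complex.ext <;> simp [e]
    have h2 := fl.wave_add (hesc s (e (s, z.im)) (here _).ge) (sub_nonneg.2 hz)
    rw [← h1] at h2
    rw [h2]
    simp only [c]
    conv_rhs => rw [h1]
    simp only [e, Complex.add_im, Complex.ofReal_im, Complex.mul_I_im, Complex.ofReal_re,
      zero_add, add_zero]
    ring
  have hout : ∀ s y, fl.r ≤ |y| → c (s, y) = 0 := by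
    intro s y hy
    simp only [c]
    rw [fl.wave_horiz (by rwa [heim]), sub_self]
  have hid : ∀ s, (∀ z : ℂ, fl.r ≤ z.re → fl.wave s z = z) → ∀ y, c (s, y) = 0 := by
    intro s h y
    simp only [c]
    rw [h _ (by rw [here]; exact hm), sub_self]
  refine ⟨m, c, hm, hc, hright, hout, hid, ?_, ?_⟩
  · obtain ⟨C, hC⟩ := ((isCompact_Icc (a := a) (b := b)).prod
      (isCompact_Icc (a := -fl.r) (b := fl.r))).exists_bound_of_continuousOn hc.continuous.continuousOn
    refine ⟨max C 0, fun q => ?_⟩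
    by_cases hq : q ∈ Icc a b ×ˢ Icc (-fl.r) fl.r
    · exact (hC q hq).trans (le_max_left _ _)
    · have : c q = 0 := by
        rw [mem_prod, not_and_or] at hq
        rcases hq with hq | hq
        · exact hid q.1 (fun z _ => fl.wave_id (hab q.1 hq) z) q.2
        · refine hout q.1 q.2 ?_
          by_contra h
          exact hq ⟨(abs_lt.1 (not_le.1 h)).1.le, (abs_lt.1 (not_le.1 h)).2.le⟩
      rw [this]; simp
  · intro s
    have hcs : ContDiff ℝ ∞ fun y => c (s, y) := hc.comp (contDiff_const.prodMk contDiff_id)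
    have hd : ∀ y, HasDerivAt (fun y => c (s, y)) (deriv (fun y => c (s, y)) y) y := fun y =>
      (hcs.differentiable (by simp) y).hasDerivAt
    -- Far to the right the differential of `wave` is `v ↦ v + (Im v) c'`, with determinant `1 + Im
    -- c'`. If this vanished, `-Re c' + i` would be in its kernel, although `waveInv` is a
    -- differentiable inverse. Since the value is `1` beyond the square, it is positive everywhere
    -- by the intermediate value theorem.
    have hne : ∀ y, 1 + (deriv (fun y => c (s, y)) y).im ≠ 0 := by
      intro y h0
      set c' := deriv (fun y => c (s, y)) y with hc'
      set z : ℂ := ((m + 1 : ℝ) : ℂ) + y * Complex.I with hz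
      have hzim : z.im = y := by simp [hz]
      have h1 : HasFDerivAt (fun z : ℂ => z + c (s, z.im))
          (ContinuousLinearMap.id ℝ ℂ + Complex.imCLM.smulRight c') z := by
        refine (hasFDerivAt_id z).add ?_
        have h2 := hd z.im
        rw [hzim, ← hc'] at h2
        rw [← hzim] at h2
        have h3 := HasFDerivAt.comp (f := fun z : ℂ => z.im) z h2.hasFDerivAt
          Complex.imCLM.hasFDerivAt
        refine h3.congr_fderiv (ContinuousLinearMap.ext fun v => ?_)
        simp
      have h2 : HasFDerivAt (fl.wave s)
          (ContinuousLinearMap.id ℝ ℂ + Complex.imCLM.smulRight c') z := by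
        refine h1.congr_of_eventuallyEq ?_
        have : ∀ᶠ w : ℂ in 𝓝 z, m < w.re :=
          Complex.continuous_re.continuousAt.eventually (lt_mem_nhds (by simp [hz]))
        filter_upwards [this] with w hw
        exact hright s w hw.le
      have h3 : DifferentiableAt ℝ (fl.waveInv s) (fl.wave s z) :=
        (fl.contDiff_waveInv.comp (contDiff_const.prodMk contDiff_id) :
          ContDiff ℝ ∞ (fun z => fl.waveInv s z)).differentiable (by simp) _
      have h4 := h3.hasFDerivAt.comp z h2
      have h5 : (fl.waveInv s ∘ fl.wave s) = id := funext fun w => fl.waveInv_wave s w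
      rw [h5] at h4
      have h6 := congrArg (fun L : ℂ →L[ℝ] ℂ => L (-(c'.re : ℂ) + Complex.I))
        (h4.unique (hasFDerivAt_id z))
      have h7 : (ContinuousLinearMap.id ℝ ℂ + Complex.imCLM.smulRight c')
          (-(c'.re : ℂ) + Complex.I) = 0 := by
        apply Complex.ext
        · simp
        · simpa using h0
      simp only [ContinuousLinearMap.comp_apply, h7, map_zero, ContinuousLinearMap.id_apply] at h6
      have := congrArg Complex.im h6
      simp at this
    have hcont : Continuous fun y => 1 + (deriv (fun y => c (s, y)) y).im :=
      continuous_const.add (Complex.continuous_im.comp (hcs.continuous_deriv (by simp)))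
    intro y
    by_contra hy
    have hfar : 1 + (deriv (fun y => c (s, y)) (fl.r + 1)).im = 1 := by
      have : (fun y => c (s, y)) =ᶠ[𝓝 (fl.r + 1)] fun _ => 0 := by
        filter_upwards [lt_mem_nhds (lt_add_one fl.r)] with w hw
        exact hout s w (hw.le.trans (le_abs_self _))
      rw [this.deriv_eq]; simp
    obtain ⟨w, hw⟩ := mem_range_of_exists_le_of_exists_ge hcont ⟨y, not_lt.1 hy⟩
      ⟨fl.r + 1, by rw [hfar]; exact zero_le_one⟩
    exact hne w hw

/-- The straightening maps, corrected on the right so as to have compact support. -/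
theorem exists_isotopy {a b : ℝ} (hab : ∀ s, s ∉ Icc a b → ∀ z, fl.V s z = 1) :
    ∃ (R : ℝ) (H G : ℝ × ℂ → ℂ), 0 < R ∧ ContDiff ℝ ∞ H ∧ ContDiff ℝ ∞ G ∧
      (∀ s z, H (s, G (s, z)) = z) ∧ (∀ s z, G (s, H (s, z)) = z) ∧
      (∀ s z, R ≤ ‖z‖ → H (s, z) = z) ∧
      ∀ s, (∀ z : ℂ, fl.r ≤ z.re → fl.wave s z = z) → ∀ z, H (s, z) = fl.wave s z := by
  obtain ⟨m, c, hm, hc, hright, hout, hid, ⟨C, hC⟩, hpos⟩ := fl.exists_displacement hab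
  have hC0 : 0 ≤ C := (norm_nonneg _).trans (hC (0, 0))
  obtain ⟨D, hD⟩ := exists_deriv_smoothTransition_le
  have hD0 : 0 ≤ D := (abs_nonneg _).trans (hD 0)
  -- The horizontal correction is spread over a length `L` so that its slope is at most `D C / L <
  -- 1`.
  set L := D * C + 1 with hL
  have hLpos : 0 < L := by positivity
  have hst : ContDiff ℝ ∞ Real.smoothTransition := Real.smoothTransition.contDiff
  -- the correction in the direction of `x`
  let k₁ : (ℝ × ℝ) × ℝ → ℝ := fun q => q.2 + Real.smoothTransition (q.2 / L) * (c q.1).re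
  have hk₁ : ContDiff ℝ ∞ k₁ := by
    have h1 : ContDiff ℝ ∞ fun q : (ℝ × ℝ) × ℝ => (c q.1).re :=
      Complex.reCLM.contDiff.comp (hc.comp contDiff_fst)
    exact contDiff_snd.add ((hst.comp (contDiff_snd.div_const L)).mul h1)
  have hk₁C : ∀ p x, |k₁ (p, x) - x| ≤ C := by
    intro p x
    simp only [k₁, add_sub_cancel_left, abs_mul]
    rw [abs_of_nonneg (Real.smoothTransition.nonneg _)]
    exact (mul_le_of_le_one_left (abs_nonneg _) (Real.smoothTransition.le_one _)).trans
      ((Complex.abs_re_le_norm _).trans (hC p))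
  obtain ⟨l₁, hl₁, hkl₁, hlk₁⟩ := exists_smooth_inverse_family k₁ hk₁ (fun p x => by
    have h1 : HasDerivAt (fun x => k₁ (p, x))
        (1 + (deriv Real.smoothTransition (x / L) * (1 / L)) * (c p).re) x := by
      have h2 := (hst.differentiable (by simp) (x / L)).hasDerivAt.comp x
        ((hasDerivAt_id x).div_const L)
      exact (hasDerivAt_id x).add (h2.mul_const (c p).re)
    rw [h1.deriv]
    have h2 : |(deriv Real.smoothTransition (x / L) * (1 / L)) * (c p).re| < 1 := by
      rw [abs_mul, abs_mul, abs_of_pos (by positivity : 0 < 1 / L)]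
      have h3 : |deriv Real.smoothTransition (x / L)| * |(c p).re| ≤ D * C :=
        mul_le_mul (hD _) ((Complex.abs_re_le_norm _).trans (hC p)) (abs_nonneg _) hD0
      calc _ = (|deriv Real.smoothTransition (x / L)| * |(c p).re|) / L := by ring
        _ ≤ D * C / L := by gcongr
        _ < 1 := by rw [div_lt_one hLpos]; linarith
    linarith [(abs_lt.1 h2).1]) hk₁C
  -- the correction in the direction of `y`
  let k₂ : (ℝ × ℝ) × ℝ → ℝ := fun q =>
    q.2 + Real.smoothTransition q.1.2 * (c (q.1.1, q.2)).im
  have hk₂ : ContDiff ℝ ∞ k₂ := by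
    have h1 : ContDiff ℝ ∞ fun q : (ℝ × ℝ) × ℝ => (c (q.1.1, q.2)).im :=
      Complex.imCLM.contDiff.comp (hc.comp (by fun_prop))
    exact contDiff_snd.add ((hst.comp (by fun_prop)).mul h1)
  obtain ⟨l₂, hl₂, hkl₂, hlk₂⟩ := exists_smooth_inverse_family k₂ hk₂ (fun p x => by
    have hcs : ContDiff ℝ ∞ fun y => c (p.1, y) := hc.comp (contDiff_const.prodMk contDiff_id)
    have h1 : HasDerivAt (fun x => k₂ (p, x))
        (1 + Real.smoothTransition p.2 * (deriv (fun y => c (p.1, y)) x).im) x := by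
      have h2 := Complex.imCLM.hasFDerivAt.comp_hasDerivAt x
        (hcs.differentiable (by simp) x).hasDerivAt
      exact (hasDerivAt_id x).add (h2.const_mul (Real.smoothTransition p.2))
    rw [h1.deriv]
    have h2 := hpos p.1 x
    have h3 := Real.smoothTransition.nonneg p.2
    have h4 := Real.smoothTransition.le_one p.2
    -- The derivative is a convex combination of `1` and `1 + Im c'`, both positive; this is where
    -- the sign of the determinant enters.
    rcases h4.lt_or_eq with h4 | h4
    · nlinarith
    · rw [h4]; linarith) (C := C) (fun p x => by
    simp only [k₂, add_sub_cancel_left, abs_mul]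
    rw [abs_of_nonneg (Real.smoothTransition.nonneg _)]
    exact (mul_le_of_le_one_left (abs_nonneg _) (Real.smoothTransition.le_one _)).trans
      ((Complex.abs_im_le_norm _).trans (hC _)))
  let mk : ℝ → ℝ → ℂ := fun x y => (x : ℂ) + y * Complex.I
  have hmk : ∀ {f g : ℝ × ℂ → ℝ}, ContDiff ℝ ∞ f → ContDiff ℝ ∞ g →
      ContDiff ℝ ∞ fun q => mk (f q) (g q) := fun hf hg =>
    (Complex.ofRealCLM.contDiff.comp hf).add
      ((Complex.ofRealCLM.contDiff.comp hg).mul contDiff_const)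
  have mkre : ∀ x y, (mk x y).re = x := fun x y => by simp [mk]
  have mkim : ∀ x y, (mk x y).im = y := fun x y => by simp [mk]
  have mkeq : ∀ z : ℂ, mk z.re z.im = z := fun z => by simp [mk]
  have hre : ContDiff ℝ ∞ fun q : ℝ × ℂ => q.2.re := Complex.reCLM.contDiff.comp contDiff_snd
  have him : ContDiff ℝ ∞ fun q : ℝ × ℂ => q.2.im := Complex.imCLM.contDiff.comp contDiff_snd
  let D₁ : ℝ × ℂ → ℂ := fun q => mk (k₁ ((q.1, q.2.im), q.2.re)) q.2.im
  let E₁ : ℝ × ℂ → ℂ := fun q => mk (l₁ ((q.1, q.2.im), q.2.re)) q.2.im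
  let D₂ : ℝ × ℂ → ℂ := fun q => mk q.2.re (k₂ ((q.1, q.2.re), q.2.im))
  let E₂ : ℝ × ℂ → ℂ := fun q => mk q.2.re (l₂ ((q.1, q.2.re), q.2.im))
  have hD₁ : ContDiff ℝ ∞ D₁ := hmk (hk₁.comp ((contDiff_fst.prodMk him).prodMk hre)) him
  have hE₁ : ContDiff ℝ ∞ E₁ := hmk (hl₁.comp ((contDiff_fst.prodMk him).prodMk hre)) him
  have hD₂ : ContDiff ℝ ∞ D₂ := hmk hre (hk₂.comp ((contDiff_fst.prodMk hre).prodMk him))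
  have hE₂ : ContDiff ℝ ∞ E₂ := hmk hre (hl₂.comp ((contDiff_fst.prodMk hre).prodMk him))
  have hDE₁ : ∀ s z, D₁ (s, E₁ (s, z)) = z := fun s z => by
    simp only [D₁, E₁, mkre, mkim, hkl₁, mkeq]
  have hED₁ : ∀ s z, E₁ (s, D₁ (s, z)) = z := fun s z => by
    simp only [D₁, E₁, mkre, mkim, hlk₁, mkeq]
  have hDE₂ : ∀ s z, D₂ (s, E₂ (s, z)) = z := fun s z => by
    simp only [D₂, E₂, mkre, mkim, hkl₂, mkeq]
  have hED₂ : ∀ s z, E₂ (s, D₂ (s, z)) = z := fun s z => by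
    simp only [D₂, E₂, mkre, mkim, hlk₂, mkeq]
  -- On the far right `D₂ ∘ D₁` displaces by `c`, exactly as `wave` does, and on the far left both
  -- are the identity; so `wave ∘ (D₂ ∘ D₁)⁻¹` has compact support. Where `c (s, ·) = 0` nothing is
  -- corrected, which preserves the ends of the isotopy.
  let H : ℝ × ℂ → ℂ := fun q => fl.wave q.1 (E₁ (q.1, E₂ (q.1, q.2)))
  let G : ℝ × ℂ → ℂ := fun q => D₂ (q.1, D₁ (q.1, fl.waveInv q.1 q.2))
  have hHD : ∀ s z, H (s, D₂ (s, D₁ (s, z))) = fl.wave s z := fun s z => by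
    simp only [H, hED₂, hED₁]
  have hDid : ∀ s, ∀ z : ℂ, (∀ q, c (s, q) = 0) → D₂ (s, D₁ (s, z)) = z := by
    intro s z h
    simp [D₁, D₂, k₁, k₂, h, mkeq]
  have hDout : ∀ s, ∀ z : ℂ, c (s, z.im) = 0 → D₂ (s, D₁ (s, z)) = z := by
    intro s z h
    simp [D₁, D₂, k₁, k₂, h, mkeq]
  set R₀ := max m (L + 1 + C) with hR₀
  refine ⟨2 * (R₀ + C), H, G, ?_, ?_, ?_, ?_, ?_, ?_, ?_⟩
  · have : L + 1 + C ≤ R₀ := le_max_right _ _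
    linarith
  · exact fl.contDiff_wave.comp (contDiff_fst.prodMk
      (hE₁.comp (contDiff_fst.prodMk hE₂)))
  · exact hD₂.comp (contDiff_fst.prodMk (hD₁.comp (contDiff_fst.prodMk fl.contDiff_waveInv)))
  · intro s z
    simp only [G, hHD, fl.wave_waveInv]
  · intro s z
    simp only [H, G, fl.waveInv_wave, hDE₁, hDE₂]
  · intro s z hz
    have hr : fl.r ≤ R₀ := hm.trans (le_max_left _ _)
    have h0 := hz.trans (Complex.norm_le_abs_re_add_abs_im z)
    by_cases h1 : fl.r ≤ |z.im|
    · have := hHD s z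
      rwa [hDout s z (hout s _ h1), fl.wave_horiz h1] at this
    have h2 : R₀ + C ≤ |z.re| := by linarith [not_le.1 h1]
    rcases le_abs.1 h2 with h3 | h3
    · set w := E₁ (s, E₂ (s, z)) with hw
      have hDw : D₂ (s, D₁ (s, w)) = z := by rw [hw, hDE₁, hDE₂]
      have hzre : z.re = k₁ ((s, w.im), w.re) := by
        rw [← hDw]; simp only [D₂, D₁, mkre]
      have h4 := (abs_le.1 (hk₁C (s, w.im) w.re)).2
      have hwre : R₀ ≤ w.re := by linarith
      have hw1 : 1 ≤ w.re / L := by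
        rw [le_div_iff₀ hLpos]
        linarith [le_max_right m (L + 1 + C)]
      have hw2 : 1 ≤ k₁ ((s, w.im), w.re) := by
        rw [← hzre]; linarith [le_max_right m (L + 1 + C)]
      have h5 := hright s w ((le_max_left _ _).trans hwre)
      have h6 : D₂ (s, D₁ (s, w)) = w + c (s, w.im) := by
        simp only [D₂, D₁, mkre, mkim]
        simp only [k₂, Real.smoothTransition.one_of_one_le hw2]
        simp only [k₁, Real.smoothTransition.one_of_one_le hw1]
        apply Complex.ext <;> simp [mk]
      have h7 := hHD s w
      rw [hDw] at h7
      rw [h7, h5, ← h6, hDw]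
    · have h4 : z.re ≤ -fl.r := by linarith
      have h5 : z.re ≤ 0 := by linarith [fl.r_pos]
      have h6 : D₂ (s, D₁ (s, z)) = z := by
        have h7 : z.re / L ≤ 0 := div_nonpos_of_nonpos_of_nonneg h5 hLpos.le
        simp only [D₁, k₁, Real.smoothTransition.zero_of_nonpos h7, zero_mul, add_zero, mkeq]
        simp only [D₂, k₂, Real.smoothTransition.zero_of_nonpos h5, zero_mul, add_zero, mkeq]
      have := hHD s z
      rwa [h6, fl.wave_left h4] at this
  · intro s hs z
    rw [← hHD, hDid s z (hid s hs)]

end StripFlow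

/-! ### Logarithms of nonvanishing functions on the plane -/

theorem eq_of_exp_eq_one {h h' : ℝ → ℂ} (hd : ∀ t, HasDerivAt h (h' t) t)
    (he : ∀ t, Complex.exp (h t) = 1) (a b : ℝ) : h a = h b := by
  refine is_const_of_deriv_eq_zero (fun t => (hd t).differentiableAt) (fun t => ?_) a b
  have h1 := (hd t).cexp
  simp only [he, one_mul] at h1
  rw [(hd t).deriv]
  exact h1.unique (hasDerivAt_const t _)

/-- The logarithm is the integral of `∂ₓ v / v` along horizontal lines coming from the left, where
`v = 1`. It vanishes outside a slightly larger square. -/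
theorem exists_smooth_log {v : ℂ → ℂ} (hv : ContDiff ℝ ∞ v) (hne : ∀ z, v z ≠ 0) {ρ : ℝ}
    (hout : ∀ z : ℂ, (ρ ≤ |z.re| ∨ ρ ≤ |z.im|) → v z = 1) :
    ∃ g : ℂ → ℂ, ContDiff ℝ ∞ g ∧ (∀ z, Complex.exp (g z) = v z) ∧
      ∀ z : ℂ, (ρ + 1 ≤ |z.re| ∨ ρ + 1 ≤ |z.im|) → g z = 0 := by
  set r := ρ + 1 with hr
  let e : ℂ → ℝ → ℂ := fun z x => (x : ℂ) + z.im * Complex.I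
  have he : Continuous (Function.uncurry e) := by
    simp only [e, Function.uncurry_def]; fun_prop
  let w : ℂ → ℂ := fun z => fderiv ℝ v z 1 / v z
  have hw : Continuous w :=
    ((hv.continuous_fderiv (by simp)).clm_apply continuous_const).div hv.continuous hne
  have hwout : ∀ z : ℂ, (ρ < |z.re| ∨ ρ < |z.im|) → w z = 0 := by
    intro z hz
    have : v =ᶠ[𝓝 z] fun _ => 1 := by
      rcases hz with hz | hz
      · filter_upwards [(continuous_abs.comp Complex.continuous_re).continuousAt.eventually
          (lt_mem_nhds hz)] with y hy
        exact hout y (Or.inl (le_of_lt hy))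
      · filter_upwards [(continuous_abs.comp Complex.continuous_im).continuousAt.eventually
          (lt_mem_nhds hz)] with y hy
        exact hout y (Or.inr (le_of_lt hy))
    simp [w, this.fderiv_eq]
  let g : ℂ → ℂ := fun z => ∫ x in (-r)..z.re, w (e z x)
  have hgc : Continuous g :=
    intervalIntegral.continuous_parametric_intervalIntegral_of_continuous
      (f := fun z x => w (e z x)) (hw.comp he) Complex.continuous_re
  have hexp : ∀ z, Complex.exp (g z) = v z := by
    intro z
    have hc : Continuous fun x => w (e z x) := hw.comp (he.comp (by fun_prop :
      Continuous fun x : ℝ => (z, x)))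
    have h1 : ∀ x : ℝ, HasDerivAt (fun x : ℝ => ∫ t in (-r)..x, w (e z t)) (w (e z x)) x :=
      fun x => hc.integral_hasStrictDerivAt (-r) x |>.hasDerivAt
    have h2 : ∀ x : ℝ, HasDerivAt (fun x : ℝ => v (e z x)) (fderiv ℝ v (e z x) 1) x := by
      intro x
      have h3 : HasDerivAt (fun x : ℝ => e z x) 1 x := by
        simpa [e] using (Complex.ofRealCLM.hasDerivAt (x := x)).add_const (z.im * Complex.I)
      exact (hv.differentiable (by simp) (e z x)).hasFDerivAt.comp_hasDerivAt x h3
    have h3 : ∀ x : ℝ, HasDerivAt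
        (fun x : ℝ => Complex.exp (-∫ t in (-r)..x, w (e z t)) * v (e z x)) 0 x := by
      intro x
      refine (((h1 x).neg.cexp).mul (h2 x)).congr_deriv ?_
      have := hne (e z x)
      simp only [w]
      field_simp
      simp
    have h4 := is_const_of_deriv_eq_zero (fun x => (h3 x).differentiableAt)
      (fun x => (h3 x).deriv) z.re (-r)
    have h5 : e z z.re = z := by apply Complex.ext <;> simp [e]
    have h6 : v (e z (-r)) = 1 := hout _ (Or.inl (by
      refine le_trans ?_ (neg_le_abs _); simp [e]; linarith))
    simp only [h5, h6, intervalIntegral.integral_same, neg_zero, Complex.exp_zero, mul_one] at h4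
    rw [Complex.exp_neg] at h4
    have h7 : v z = Complex.exp (g z) := by
      have := Complex.exp_ne_zero (g z)
      change (Complex.exp (g z))⁻¹ * v z = 1 at h4
      field_simp at h4
      exact h4
    exact h7.symm
  -- Continuity of `g` together with `exp g = v` identifies `g` near each point with a shifted
  -- principal logarithm, so no differentiation under the integral is needed.
  have hgs : ContDiff ℝ ∞ g := by
    refine contDiff_iff_contDiffAt.2 fun z₀ => ?_
    have h1 : ContDiffAt ℝ ∞ (fun z => g z₀ + Complex.log (v z / v z₀)) z₀ := by
      have h2 : ContDiffAt ℝ ∞ (fun z => v z / v z₀) z₀ := (hv.div_const (v z₀)).contDiffAt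
      have h3 : ContDiffAt ℂ ∞ Complex.log (v z₀ / v z₀) := by
        rw [div_self (hne z₀)]
        exact Complex.contDiffAt_log (by simp [Complex.slitPlane])
      exact contDiffAt_const.add (ContDiffAt.comp z₀ (g := Complex.log)
        (h3.restrict_scalars ℝ) h2)
    refine h1.congr_of_eventuallyEq ?_
    have h2 : ∀ᶠ z in 𝓝 z₀, ‖g z - g z₀‖ < 1 := by
      have : Continuous fun z => ‖g z - g z₀‖ := (hgc.sub continuous_const).norm
      exact this.continuousAt.eventually (gt_mem_nhds (by simp))
    filter_upwards [h2] with z hz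
    rw [← hexp z, ← hexp z₀, ← Complex.exp_sub]
    have h3 := (Complex.abs_im_le_norm _).trans hz.le
    have h4 := abs_le.1 h3
    rw [Complex.log_exp (by linarith [Real.pi_gt_three]) (by linarith [Real.pi_gt_three])]
    ring
  refine ⟨g, hgs, hexp, ?_⟩
  have him : ∀ z : ℂ, r ≤ |z.im| → g z = 0 := by
    intro z hz
    have : ∀ x ∈ uIcc (-r) z.re, w (e z x) = 0 := fun x _ =>
      hwout _ (Or.inr (by simp [e]; linarith))
    simp only [g]
    rw [intervalIntegral.integral_congr this]; simp
  -- On the right `exp g = 1` makes `g` constant along vertical lines, and higher up, above the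
  -- square, it is known to vanish.
  have hright : ∀ z : ℂ, r ≤ z.re → g z = 0 := by
    intro z hz
    have h1 : ∀ t : ℝ, HasDerivAt (fun t : ℝ => g (z + t * Complex.I))
        (fderiv ℝ g (z + t * Complex.I) Complex.I) t := by
      intro t
      have h3 : HasDerivAt (fun t : ℝ => z + t * Complex.I) Complex.I t := by
        simpa using ((Complex.ofRealCLM.hasDerivAt (x := t)).mul_const Complex.I).const_add z
      exact (hgs.differentiable (by simp) _).hasFDerivAt.comp_hasDerivAt t h3
    have h2 := eq_of_exp_eq_one h1 (fun t => by
      rw [hexp]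
      refine hout _ (Or.inl ?_)
      refine le_trans ?_ (le_abs_self _)
      simp; linarith) 0 (r - z.im)
    simp only [Complex.ofReal_zero, zero_mul, add_zero] at h2
    rw [h2]
    refine him _ (le_trans ?_ (le_abs_self _))
    simp
  rintro z (hz | hz)
  · rcases le_abs.1 hz with h | h
    · exact hright z h
    · have : ∀ x ∈ uIcc (-r) z.re, w (e z x) = 0 := fun x hx => by
        rw [uIcc_of_ge (by linarith)] at hx
        refine hwout _ (Or.inl (lt_of_lt_of_le ?_ (neg_le_abs _)))
        simp [e]; linarith [hx.2]
      simp only [g]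
      rw [intervalIntegral.integral_congr this]; simp
  · exact him z hz

/-! ### The flow of a family of vector fields -/

/-- The family of flows of `exp (σ g)`, where `σ` is a bump function with `σ 0 = 0`, `σ 1 = 1`. -/
theorem exists_stripFlow {g : ℂ → ℂ} (hg : ContDiff ℝ ∞ g) {r : ℝ} (hr : 0 < r)
    (hout : ∀ z : ℂ, (r ≤ |z.re| ∨ r ≤ |z.im|) → g z = 0) :
    ∃ fl : StripFlow, fl.r = r ∧ (∀ s, s ∉ Icc (0 : ℝ) 2 → ∀ z, fl.V s z = 1) ∧
      (∀ z, fl.V 1 z = Complex.exp (g z)) ∧ ∃ K, LipschitzWith K (fl.V 1) := by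
  -- Since `σ` vanishes outside `(0, 2)`, the difference `V - 1` is compactly supported in the
  -- parameter and the point jointly. This supplies uniform bounds and a uniform Lipschitz constant.
  let σ : ℝ → ℝ := fun s => Real.smoothTransition s * Real.smoothTransition (2 - s)
  have hst : ContDiff ℝ ∞ Real.smoothTransition := Real.smoothTransition.contDiff
  have hσ : ContDiff ℝ ∞ σ := hst.mul (hst.comp (contDiff_const.sub contDiff_id))
  have hσ0 : ∀ s, s ≤ 0 → σ s = 0 := fun s hs => by
    simp [σ, Real.smoothTransition.zero_of_nonpos hs]
  have hσ2 : ∀ s, 2 ≤ s → σ s = 0 := fun s hs => by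
    simp [σ, Real.smoothTransition.zero_of_nonpos (by linarith : 2 - s ≤ 0)]
  have hσ1 : σ 1 = 1 := by
    simp only [σ]
    rw [Real.smoothTransition.one_of_one_le le_rfl,
      Real.smoothTransition.one_of_one_le (by norm_num), mul_one]
  let V : ℝ → ℂ → ℂ := fun s z => Complex.exp (σ s * g z)
  have hV : ContDiff ℝ ∞ fun q : ℝ × ℂ => V q.1 q.2 :=
    ((Complex.ofRealCLM.contDiff.comp (hσ.comp contDiff_fst)).mul (hg.comp contDiff_snd)).cexp
  have hVs : ∀ s, s ∉ Icc (0 : ℝ) 2 → ∀ z, V s z = 1 := by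
    intro s hs z
    have : σ s = 0 := by
      rcases not_and_or.1 hs with h | h
      · exact hσ0 s (not_le.1 h).le
      · exact hσ2 s (not_le.1 h).le
    simp [V, this]
  have hVout : ∀ s z, (r ≤ |z.re| ∨ r ≤ |z.im|) → V s z = 1 := fun s z hz => by
    simp [V, hout z hz]
  let V₀ : ℝ × ℂ → ℂ := fun q => V q.1 q.2 - 1
  have hV₀ : ContDiff ℝ ∞ V₀ := hV.sub contDiff_const
  have hsupp : HasCompactSupport V₀ := by
    refine HasCompactSupport.intro ((isCompact_Icc (a := (0 : ℝ)) (b := 2)).prod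
      (StripFlow.isCompact_square r)) fun q hq => ?_
    rcases not_and_or.1 hq with h | h
    · simp [V₀, hVs _ h]
    · have : r ≤ |q.2.re| ∨ r ≤ |q.2.im| := by
        by_contra hcon
        rw [not_or, not_le, not_le] at hcon
        exact h ⟨⟨(abs_lt.1 hcon.1).1.le, (abs_lt.1 hcon.1).2.le⟩,
          ⟨(abs_lt.1 hcon.2).1.le, (abs_lt.1 hcon.2).2.le⟩⟩
      simp [V₀, hVout _ _ this]
  obtain ⟨K, hK⟩ := ContDiff.lipschitzWith_of_hasCompactSupport hsupp hV₀ (by simp)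
  obtain ⟨M, hM⟩ := hsupp.exists_bound_of_continuous hV₀.continuous
  have hVM : ∀ s z, ‖V s z‖ ≤ |M| + 1 := fun s z => by
    have h1 : V s z = V₀ (s, z) + 1 := by simp [V₀]
    rw [h1]
    exact (norm_add_le _ _).trans (by simpa using (hM (s, z)).trans (le_abs_self M))
  -- The parameter is treated as a coordinate at rest, so smooth dependence on it is part of the
  -- smoothness of the flow of `W`.
  let W : ℝ × ℂ → ℝ × ℂ := fun q => (0, V q.1 q.2)
  have hW : ContDiff ℝ ∞ W := contDiff_const.prodMk hV
  have hWK : LipschitzWith K W := by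
    refine LipschitzWith.of_dist_le_mul fun p q => ?_
    have h1 := hK.dist_le_mul p q
    have h2 : dist (W p) (W q) = dist (V₀ p) (V₀ q) := by
      simp [W, V₀, Prod.dist_eq]
    rwa [h2]
  have hVK : ∀ s, LipschitzWith K (V s) := fun s => by
    refine LipschitzWith.of_dist_le_mul fun z w => ?_
    have h1 := hK.dist_le_mul (s, z) (s, w)
    simpa [V₀, Prod.dist_eq] using h1
  obtain ⟨F, hF0, hFd, hFa, hFs⟩ := exists_smooth_flow W hW (M := ⟨|M| + 1, by positivity⟩) hWK
    (fun q => by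
      change ‖((0 : ℝ), V q.1 q.2)‖ ≤ |M| + 1
      rw [Prod.norm_def, norm_zero]
      exact max_le (by positivity) (hVM _ _))
  have hF1 : ∀ t q, (F t q).1 = q.1 := by
    intro t q
    have h1 : ∀ t, HasDerivAt (fun t => (F t q).1) 0 t := fun t =>
      (hFd t q).fst
    have := is_const_of_deriv_eq_zero (fun t => (h1 t).differentiableAt)
      (fun t => (h1 t).deriv) t 0
    rw [this, hF0]
  have hFpair : ∀ t s z, F t (s, z) = (s, (F t (s, z)).2) := fun t s z =>
    Prod.ext (hF1 t (s, z)) rfl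
  have hder : ∀ s t z, HasDerivAt (fun t => (F t (s, z)).2) (V s (F t (s, z)).2) t := by
    intro s t z
    have := (hFd t (s, z)).snd
    simp only [W, hF1] at this
    exact this
  refine ⟨{ V := V, F := fun s t z => (F t (s, z)).2, r := r, M := |M| + 1, r_pos := hr
            V_cont := hV.continuous, V_out := hVout
            V_zero := fun z => by simp [V, hσ0 0 le_rfl]
            V_ne := fun s z => Complex.exp_ne_zero _
            V_le := hVM
            smooth := contDiff_snd.comp (hFs.comp (by fun_prop :
              ContDiff ℝ ∞ fun q : ℝ × ℝ × ℂ => (q.2.1, (q.1, q.2.2))))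
            zero := fun s z => by simp [hF0]
            hasDerivAt := hder
            add := fun s t t' z => by rw [hFa, hFpair t' s z]
            unif := ?_ }, rfl, hVs, fun z => by simp [V, hσ1], K, hVK 1⟩
  intro s w t ht h
  have := ODE_solution_unique_of_mem_Icc_right (v := fun _ => V s) (s := fun _ => univ) (K := K)
    (f := fun t => (F t (s, w)).2) (g := fun u : ℝ => w + u) (a := 0) (b := t)
    (fun _ _ => (hVK s).lipschitzOnWith)
    (fun u _ => (hder s u w).continuousAt.continuousWithinAt)
    (fun u _ => (hder s u w).hasDerivWithinAt) (fun _ _ => mem_univ _)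
    (by fun_prop) (fun u hu => by
      rw [h u (Ico_subset_Icc_self hu)]
      exact ((Complex.ofRealCLM.hasDerivAt (x := u)).const_add w).hasDerivWithinAt)
    (fun _ _ => mem_univ _) (by simp [hF0])
  exact this (right_mem_Icc.2 ht)

/-! ### Isotopies to the identity in the plane and in the disk. -/

/-- A diffeomorphism of the plane with compact support is isotopic to the identity. -/
theorem exists_compact_isotopy {ψ χ : ℂ → ℂ} (hψ : ContDiff ℝ ∞ ψ) (hχ : ContDiff ℝ ∞ χ)
    (hψχ : ∀ z, ψ (χ z) = z) (hχψ : ∀ z, χ (ψ z) = z) {ρ : ℝ} (hρ : 0 < ρ)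
    (hid : ∀ z, ρ ≤ ‖z‖ → ψ z = z) :
    ∃ (R : ℝ) (H G : ℝ × ℂ → ℂ), 0 < R ∧ ContDiff ℝ ∞ H ∧ ContDiff ℝ ∞ G ∧
      (∀ s z, H (s, G (s, z)) = z) ∧ (∀ s z, G (s, H (s, z)) = z) ∧
      (∀ s z, R ≤ ‖z‖ → H (s, z) = z) ∧ (∀ z, H (0, z) = z) ∧ ∀ z, H (1, z) = ψ z := by
  have hχid : ∀ z, ρ ≤ ‖z‖ → χ z = z := fun z hz => by
    conv_lhs => rw [← hid z hz]
    exact hχψ z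
  -- This is the push-forward `ψ_* ∂ₓ`: it has no zeros, and it equals `∂ₓ` far away.
  let v : ℂ → ℂ := fun z => fderiv ℝ ψ (χ z) 1
  have hv : ContDiff ℝ ∞ v :=
    ((hψ.fderiv_right (m := ∞) (by simp)).comp hχ).clm_apply contDiff_const
  have hd : ∀ z, HasFDerivAt ψ (fderiv ℝ ψ z) z := fun z =>
    (hψ.differentiable (by simp) z).hasFDerivAt
  have hne : ∀ z, v z ≠ 0 := by
    intro z h0
    have h1 := ((hχ.differentiable (by simp) (ψ (χ z))).hasFDerivAt.comp (χ z) (hd (χ z)))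
    have h2 : χ ∘ ψ = id := funext hχψ
    rw [h2] at h1
    have h3 := congrArg (fun L : ℂ →L[ℝ] ℂ => L 1) (h1.unique (hasFDerivAt_id _))
    simp only [ContinuousLinearMap.comp_apply] at h3
    rw [show fderiv ℝ ψ (χ z) 1 = 0 from h0] at h3
    simp at h3
  have hout : ∀ z : ℂ, (ρ + 1 ≤ |z.re| ∨ ρ + 1 ≤ |z.im|) → v z = 1 := by
    intro z hz
    have hz2 : ρ < ‖z‖ := by
      rcases hz with h | h
      · linarith [Complex.abs_re_le_norm z]
      · linarith [Complex.abs_im_le_norm z]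
    have h1 : ψ =ᶠ[𝓝 z] id := by
      filter_upwards [continuous_norm.continuousAt.eventually (lt_mem_nhds hz2)] with y hy
      exact hid y (le_of_lt hy)
    simp only [v]
    rw [hχid z hz2.le, h1.fderiv_eq]
    simp
  obtain ⟨g, hg, hexp, hgout⟩ := exists_smooth_log hv hne hout
  obtain ⟨fl, hr, hV, hV1, K, hK⟩ := exists_stripFlow hg (by linarith : 0 < ρ + 1 + 1) hgout
  obtain ⟨R, H, G, hR, hH, hG, hHG, hGH, hHR, hHw⟩ := fl.exists_isotopy hV
  -- The flow of `ψ_* ∂ₓ` is the translation conjugated by `ψ`. Consequently the straightening map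
  -- at parameter `1`, being the identity on the left, is `ψ` itself and needs no correction on the
  -- right.
  have hF : ∀ t z, fl.F 1 t z = ψ (χ z + t) := by
    intro t z
    have h1 : ∀ t : ℝ, HasDerivAt (fun t : ℝ => ψ (χ z + t)) (fl.V 1 (ψ (χ z + t))) t := by
      intro t
      rw [hV1, hexp]
      simp only [v, hχψ]
      exact (hd _).comp_hasDerivAt t ((Complex.ofRealCLM.hasDerivAt (x := t)).const_add (χ z))
    have := integralCurve_unique hK (fun t => fl.hasDerivAt 1 t z) h1 (t₀ := 0)
      (by simp [fl.zero, hψχ])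
    exact congrFun this t
  have hw1 : ∀ z, fl.wave 1 z = ψ z := by
    intro z
    rw [StripFlow.wave, hF, hχid, sub_add_cancel]
    refine le_trans ?_ (Complex.abs_re_le_norm _)
    refine le_trans ?_ (neg_le_abs _)
    simp [hr]; linarith
  have hw0 : ∀ z, fl.wave 0 z = z := fl.wave_id fl.V_zero
  refine ⟨R, H, G, hR, hH, hG, hHG, hGH, hHR, fun z => ?_, fun z => ?_⟩
  · rw [hHw 0 (fun z _ => hw0 z), hw0]
  · rw [hHw 1 (fun z hz => ?_), hw1]
    rw [hw1, hid z]
    refine le_trans ?_ (Complex.abs_re_le_norm _)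
    refine le_trans ?_ (le_abs_self _)
    rw [hr] at hz; linarith

/-- A diffeomorphism of the disk which is the identity near the boundary is isotopic to
the identity relative to a neighbourhood of the boundary. -/
theorem exists_disk_isotopy {ψ χ : ℂ → ℂ} (hψ : ContDiff ℝ ∞ ψ) (hχ : ContDiff ℝ ∞ χ)
    (hψχ : ∀ z, ψ (χ z) = z) (hχψ : ∀ z, χ (ψ z) = z) {r : ℝ} (hr : r < 1)
    (hid : ∀ z, r ≤ ‖z‖ → ψ z = z) :
    ∃ (ρ : ℝ) (H G : ℝ × ℂ → ℂ), 0 < ρ ∧ ρ < 1 ∧ r ≤ ρ ∧ ContDiff ℝ ∞ H ∧ ContDiff ℝ ∞ G ∧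
      (∀ s z, H (s, G (s, z)) = z) ∧ (∀ s z, G (s, H (s, z)) = z) ∧
      (∀ s z, ρ ≤ ‖z‖ → H (s, z) = z) ∧ (∀ s ≤ 1 / 3, ∀ z, H (s, z) = z) ∧
      ∀ s ≥ 2 / 3, ∀ z, H (s, z) = ψ z := by
  -- Conjugation by a diffeomorphism of the plane onto the open disk turns "identity near the
  -- circle" into "compactly supported"; the isotopy found in the plane then extends by the identity
  -- outside the disk.
  let U : OpenPartialHomeomorph ℂ ℂ := OpenPartialHomeomorph.univUnitBall
  have hUs : ContDiff ℝ ∞ U := OpenPartialHomeomorph.contDiff_univUnitBall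
  have hUi : ContDiffOn ℝ ∞ U.symm (ball 0 1) := OpenPartialHomeomorph.contDiffOn_univUnitBall_symm
  have hUm : ∀ w, U w ∈ ball (0 : ℂ) 1 := fun w => U.map_source (mem_univ w)
  have hUl : ∀ w, U.symm (U w) = w := fun w => U.left_inv (mem_univ w)
  have hUr : ∀ z ∈ ball (0 : ℂ) 1, U (U.symm z) = z := fun z hz => U.right_inv hz
  have hsmall : ∀ R : ℝ, 0 < R → ∃ ρ, 0 < ρ ∧ ρ < 1 ∧ ∀ z ∈ ball (0 : ℂ) 1, ρ < ‖z‖ →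
      R < ‖U.symm z‖ := by
    intro R hR
    obtain ⟨w, -, hw⟩ := (isCompact_closedBall (0 : ℂ) R).exists_isMaxOn
      ⟨0, by simp [hR.le]⟩ (hUs.continuous.norm.continuousOn)
    refine ⟨max ‖U w‖ (1 / 2), by positivity, max_lt ?_ (by norm_num), fun z hz hlt => ?_⟩
    · simpa using hUm w
    · by_contra hcon
      have h1 := hw (show U.symm z ∈ closedBall (0 : ℂ) R by simpa using not_lt.1 hcon)
      simp only [mem_ofPred_eq, hUr z hz] at h1
      linarith [le_max_left ‖U w‖ (1 / 2)]
  have hball : ∀ {ψ χ : ℂ → ℂ}, (∀ z, χ (ψ z) = z) → (∀ z, r ≤ ‖z‖ → ψ z = z) →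
      ∀ z ∈ ball (0 : ℂ) 1, ψ z ∈ ball (0 : ℂ) 1 := by
    intro ψ χ h1 h2 z hz
    by_contra hcon
    rw [mem_ball_zero_iff, not_lt] at hcon
    have h3 := h2 (ψ z) (hr.le.trans hcon)
    have h4 : ψ z = z := by rw [← h1 (ψ z), h3, h1]
    rw [h4] at hcon
    rw [mem_ball_zero_iff] at hz
    linarith
  have hχid : ∀ z, r ≤ ‖z‖ → χ z = z := fun z hz => by
    conv_lhs => rw [← hid z hz]
    exact hχψ z
  have hψb := hball hχψ hid
  have hχb := hball hψχ hχid
  have hconj : ∀ {ψ : ℂ → ℂ}, ContDiff ℝ ∞ ψ → (∀ z ∈ ball (0 : ℂ) 1, ψ z ∈ ball (0 : ℂ) 1) →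
      ContDiff ℝ ∞ fun w => U.symm (ψ (U w)) := by
    intro ψ h1 h2
    refine contDiff_iff_contDiffAt.2 fun w => ?_
    have h3 : ContDiffAt ℝ ∞ U.symm (ψ (U w)) :=
      hUi.contDiffAt (isOpen_ball.mem_nhds (h2 _ (hUm w)))
    exact ContDiffAt.comp w (g := U.symm) h3 (h1.comp hUs).contDiffAt
  obtain ⟨w₀, -, hw₀⟩ : ∃ R : ℝ, True ∧ ∀ w, R ≤ ‖w‖ → r ≤ ‖U w‖ := by
    obtain ⟨C, hC⟩ := (isCompact_closedBall (0 : ℂ) r).exists_bound_of_continuousOn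
      (hUi.continuousOn.mono (closedBall_subset_ball hr))
    refine ⟨C + 1, trivial, fun w hw => ?_⟩
    by_contra hcon
    have := hC (U w) (by simpa using (not_le.1 hcon).le)
    rw [hUl] at this
    linarith
  obtain ⟨R, H', G', hR, hH', hG', hHG', hGH', hHR', hH0, hH1⟩ := exists_compact_isotopy
    (ψ := fun w => U.symm (ψ (U w))) (χ := fun w => U.symm (χ (U w)))
    (hconj hψ hψb) (hconj hχ hχb)
    (fun w => by rw [hUr _ (hχb _ (hUm w)), hψχ, hUl])
    (fun w => by rw [hUr _ (hψb _ (hUm w)), hχψ, hUl])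
    (ρ := max w₀ 1) (by positivity)
    (fun w hw => by
      rw [hid _ (hw₀ w ((le_max_left _ _).trans hw)), hUl])
  have hGR' : ∀ s z, R ≤ ‖z‖ → G' (s, z) = z := fun s z hz => by
    conv_lhs => rw [← hHR' s z hz]
    exact hGH' s z
  obtain ⟨ρ₀, hρ0, hρ1, hρ⟩ := hsmall R hR
  set ρ := (max ρ₀ r + 1) / 2 with hρdef
  have hm1 : max ρ₀ r < 1 := max_lt hρ1 hr
  have hρρ : ρ₀ < ρ := by linarith [le_max_left ρ₀ r]
  -- The reparametrization makes the isotopy constant near both ends, so that copies of it over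
  -- successive unit intervals can be glued smoothly.
  let θ : ℝ → ℝ := fun s => Real.smoothTransition (3 * s - 1)
  have hθ : ContDiff ℝ ∞ θ :=
    Real.smoothTransition.contDiff.comp (by fun_prop : ContDiff ℝ ∞ fun s : ℝ => 3 * s - 1)
  let T : (ℝ × ℂ → ℂ) → ℝ × ℂ → ℂ := fun H q =>
    if ‖q.2‖ < 1 then U (H (θ q.1, U.symm q.2)) else q.2
  have hTin : ∀ (H : ℝ × ℂ → ℂ) s z, z ∈ ball (0 : ℂ) 1 → T H (s, z) = U (H (θ s, U.symm z)) :=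
    fun H s z hz => if_pos (by simpa using hz)
  have hTout : ∀ H : ℝ × ℂ → ℂ, (∀ s z, R ≤ ‖z‖ → H (s, z) = z) → ∀ s z, ρ₀ < ‖z‖ →
      T H (s, z) = z := by
    intro H hH s z hz
    by_cases h : ‖z‖ < 1
    · have hz1 : z ∈ ball (0 : ℂ) 1 := by simpa using h
      rw [hTin H s z hz1, hH _ _ (hρ z hz1 hz).le, hUr z hz1]
    · exact if_neg h
  have hTs : ∀ H : ℝ × ℂ → ℂ, ContDiff ℝ ∞ H → (∀ s z, R ≤ ‖z‖ → H (s, z) = z) →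
      ContDiff ℝ ∞ (T H) := by
    intro H h1 h2
    refine contDiff_iff_contDiffAt.2 fun ⟨s, z⟩ => ?_
    by_cases h : ‖z‖ < 1
    · have h3 : ContDiffAt ℝ ∞ (fun q : ℝ × ℂ => (θ q.1, U.symm q.2)) (s, z) :=
        (hθ.comp contDiff_fst).contDiffAt.prodMk
          (ContDiffAt.comp (s, z) (g := U.symm)
            (hUi.contDiffAt (isOpen_ball.mem_nhds (by simpa using h))) contDiffAt_snd)
      have h4 : ContDiffAt ℝ ∞ (fun q : ℝ × ℂ => U (H (θ q.1, U.symm q.2))) (s, z) :=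
        (hUs.comp h1).contDiffAt.comp (s, z) h3
      refine h4.congr_of_eventuallyEq ?_
      have : ∀ᶠ q : ℝ × ℂ in 𝓝 (s, z), ‖q.2‖ < 1 :=
        (continuous_snd.norm.continuousAt).eventually (gt_mem_nhds (by simpa using h))
      filter_upwards [this] with q hq
      exact if_pos hq
    · have : ∀ᶠ q : ℝ × ℂ in 𝓝 (s, z), ρ₀ < ‖q.2‖ :=
        (continuous_snd.norm.continuousAt).eventually
          (lt_mem_nhds (by simp only; linarith [not_lt.1 h]))
      refine contDiffAt_snd.congr_of_eventuallyEq ?_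
      filter_upwards [this] with q hq
      exact hTout H h2 q.1 q.2 hq
  have hTT : ∀ H G : ℝ × ℂ → ℂ, (∀ s z, H (s, G (s, z)) = z) → ∀ s z,
      T H (s, T G (s, z)) = z := by
    intro H G h1 s z
    by_cases h : z ∈ ball (0 : ℂ) 1
    · rw [hTin G s z h, hTin H s _ (hUm _), hUl, h1, hUr z h]
    · have h2 : ¬ ‖z‖ < 1 := by simpa using h
      have h3 : ∀ K : ℝ × ℂ → ℂ, T K (s, z) = z := fun K => if_neg h2
      rw [h3 G, h3 H]
  refine ⟨ρ, T H', T G', by linarith, by linarith, by linarith [le_max_right ρ₀ r],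
    hTs H' hH' hHR', hTs G' hG' hGR', hTT H' G' hHG', hTT G' H' hGH',
    fun s z hz => hTout H' hHR' s z (hρρ.trans_le hz), fun s hs z => ?_, fun s hs z => ?_⟩
  · by_cases h : z ∈ ball (0 : ℂ) 1
    · rw [hTin H' s z h]
      have : θ s = 0 := Real.smoothTransition.zero_of_nonpos (by linarith)
      rw [this, hH0, hUr z h]
    · exact if_neg (by simpa using h)
  · by_cases h : z ∈ ball (0 : ℂ) 1
    · rw [hTin H' s z h]
      have : θ s = 1 := Real.smoothTransition.one_of_one_le (by linarith)
      rw [this, hH1]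
      rw [hUr z h, hUr _ (hψb z h)]
    · have h2 : 1 ≤ ‖z‖ := by simpa using h
      rw [hid z (hr.le.trans h2)]
      exact if_neg (not_lt.2 h2)

/-! ### Extending the disk map to the plane -/

namespace DiskMap

theorem circ_add (a b : ℝ) : circ (a + b) = circ a * circ b := by
  rw [circ, circ, circ, ← Complex.exp_add]; congr 1; push_cast; ring

theorem circ_zero : circ 0 = 1 := by simp [circ]

theorem circ_neg_mul (a : ℝ) : circ (-a) * circ a = 1 := by
  rw [← circ_add, neg_add_cancel, circ_zero]

theorem circ_mul_neg (a : ℝ) : circ a * circ (-a) = 1 := by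
  rw [← circ_add, add_neg_cancel, circ_zero]

theorem norm_circ (a : ℝ) : ‖circ a‖ = 1 := by
  have : (2 * π * a * Complex.I : ℂ) = ((2 * π * a : ℝ) : ℂ) * Complex.I := by push_cast; ring
  rw [circ, this, Complex.norm_exp_ofReal_mul_I]

theorem circ_ne_zero (a : ℝ) : circ a ≠ 0 := Complex.exp_ne_zero _

theorem circ_int (n : ℤ) : circ n = 1 := by
  rw [circ, Complex.exp_eq_one_iff]
  exact ⟨n, by push_cast; ring⟩

theorem circ_eq_one_iff (a : ℝ) : circ a = 1 ↔ ∃ n : ℤ, a = n := by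
  refine ⟨fun h => ?_, fun ⟨n, hn⟩ => hn ▸ circ_int n⟩
  obtain ⟨n, hn⟩ := Complex.exp_eq_one_iff.1 h
  refine ⟨n, ?_⟩
  have h2 : (2 * π * Complex.I : ℂ) ≠ 0 := by
    simp [Real.pi_ne_zero, Complex.I_ne_zero]
  have : ((a : ℂ) - n) * (2 * π * Complex.I) = 0 := by linear_combination hn
  rcases mul_eq_zero.1 this with h | h
  · have := sub_eq_zero.1 h
    exact_mod_cast this
  · exact absurd h h2

theorem hasDerivAt_circ (a : ℝ) : HasDerivAt circ (2 * π * Complex.I * circ a) a := by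
  have h1 : HasDerivAt (fun s : ℝ => (2 * π * s * Complex.I : ℂ)) (2 * π * Complex.I) a := by
    have := ((Complex.ofRealCLM.hasDerivAt (x := a)).const_mul (2 * π : ℂ)).mul_const Complex.I
    simpa using this
  refine h1.cexp.congr_deriv ?_
  rw [circ]; ring

theorem contDiff_circ : ContDiff ℝ ∞ circ := by
  have : ContDiff ℝ ∞ fun s : ℝ => (2 * π * s * Complex.I : ℂ) :=
    (contDiff_const.mul Complex.ofRealCLM.contDiff).mul contDiff_const
  exact this.cexp

/-- The form `β`, as a linear map. -/
noncomputable def betaL : ℂ →L[ℝ] ℂ →L[ℝ] ℝ :=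
  (2 * π)⁻¹ • (Complex.reCLM.smulRight Complex.imCLM - Complex.imCLM.smulRight Complex.reCLM)

theorem betaL_apply (z v : ℂ) : betaL z v = beta z v := by
  simp [betaL, beta]

theorem beta_mul (c z v : ℂ) : beta (c * z) (c * v) = ‖c‖ ^ 2 * beta z v := by
  rw [← Complex.normSq_eq_norm_sq, Complex.normSq_apply]
  simp only [beta, Complex.mul_re, Complex.mul_im]
  ring

theorem beta_circ_mul (a : ℝ) (z v : ℂ) : beta (circ a * z) (circ a * v) = beta z v := by
  rw [beta_mul, norm_circ]; ring

/-- The extension of a disk map by a rotation. -/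
noncomputable def extendRot (φ : ℂ → ℂ) (θ : ℝ) (z : ℂ) : ℂ :=
  open Classical in if z ∈ disk then φ z else circ θ * z

theorem extendRot_of_mem {φ : ℂ → ℂ} {θ : ℝ} {z : ℂ} (hz : z ∈ disk) : extendRot φ θ z = φ z :=
  if_pos hz

theorem extendRot_of_lt {φ : ℂ → ℂ} {θ δ : ℝ} (h : ∀ z ∈ disk, 1 - δ < ‖z‖ → φ z = circ θ * z)
    {z : ℂ} (hz : 1 - δ < ‖z‖) : extendRot φ θ z = circ θ * z := by
  by_cases h1 : z ∈ disk
  · rw [extendRot_of_mem h1, h z h1 hz]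
  · exact if_neg h1

theorem contDiff_extendRot {φ : ℂ → ℂ} {θ δ : ℝ} (hδ : 0 < δ) (hφ : ContDiffOn ℝ ∞ φ disk)
    (h : ∀ z ∈ disk, 1 - δ < ‖z‖ → φ z = circ θ * z) : ContDiff ℝ ∞ (extendRot φ θ) := by
  refine contDiff_iff_contDiffAt.2 fun z => ?_
  by_cases hz : ‖z‖ < 1
  · have hb : ball (0 : ℂ) 1 ∈ 𝓝 z := isOpen_ball.mem_nhds (by simpa using hz)
    refine (hφ.contDiffAt (mem_of_superset hb ball_subset_closedBall)).congr_of_eventuallyEq ?_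
    filter_upwards [hb] with y hy
    exact extendRot_of_mem (ball_subset_closedBall hy)
  · have : ContDiff ℝ ∞ fun z : ℂ => circ θ * z := contDiff_const.mul contDiff_id
    refine this.contDiffAt.congr_of_eventuallyEq ?_
    filter_upwards [continuous_norm.continuousAt.eventually
      (lt_mem_nhds (by linarith : 1 - δ < ‖z‖))] with y hy
    exact extendRot_of_lt h hy

theorem extendRot_leftInv {φ χ : ℂ → ℂ} {θ : ℝ} (hφ : MapsTo φ disk disk)
    (h : LeftInvOn χ φ disk) (z : ℂ) : extendRot χ (-θ) (extendRot φ θ z) = z := by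
  by_cases hz : z ∈ disk
  · rw [extendRot_of_mem hz, extendRot_of_mem (hφ hz), h hz]
  · have h1 : extendRot φ θ z = circ θ * z := if_neg hz
    have h2 : circ θ * z ∉ disk := by
      simpa [norm_circ] using hz
    rw [h1, extendRot, if_neg h2, ← mul_assoc, circ_neg_mul, one_mul]

/-- The extension of the action function by a constant. -/
theorem exists_extend_action {φ : ℂ → ℂ} {θ₀ δ : ℝ} {f : ℂ → ℝ} (hδ : 0 < δ)
    (hφ : ContDiffOn ℝ ∞ φ disk)
    (hrot : ∀ z ∈ disk, 1 - δ < ‖z‖ → φ z = circ θ₀ * z) (hf : IsActionFunction φ θ₀ f) :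
    ∃ g : ℂ → ℝ, ContDiff ℝ ∞ g ∧ EqOn g f disk ∧ (∀ z, 1 - δ < ‖z‖ → 0 < ‖z‖ → g z = θ₀) ∧
      ∀ z v, fderiv ℝ g z v
        = beta (extendRot φ θ₀ z) (fderiv ℝ (extendRot φ θ₀) z v) - beta z v := by
  set F := extendRot φ θ₀ with hF
  have hFs : ContDiff ℝ ∞ F := contDiff_extendRot hδ hφ hrot
  let L : ℂ → ℂ →L[ℝ] ℝ := fun z => (betaL (F z)).comp (fderiv ℝ F z) - betaL z
  have hL : ContDiff ℝ ∞ L :=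
    ((betaL.contDiff.comp hFs).clm_comp (hFs.fderiv_right (m := ∞) (by simp))).sub betaL.contDiff
  have hFd : ∀ z, ‖z‖ < 1 → fderivWithin ℝ φ disk z = fderiv ℝ F z := by
    intro z hz
    have hb : ball (0 : ℂ) 1 ∈ 𝓝 z := isOpen_ball.mem_nhds (by simpa using hz)
    have h1 : F =ᶠ[𝓝 z] φ := by
      filter_upwards [hb] with y hy
      exact extendRot_of_mem (ball_subset_closedBall hy)
    rw [h1.fderiv_eq, fderivWithin_of_mem_nhds (mem_of_superset hb ball_subset_closedBall)]
  have hin : ∀ z, ‖z‖ < 1 → HasFDerivAt f (L z) z := by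
    intro z hz
    have hb : disk ∈ 𝓝 z :=
      mem_of_superset (isOpen_ball.mem_nhds (by simpa using hz)) ball_subset_closedBall
    have hzd : z ∈ disk := mem_of_mem_nhds hb
    have h1 : DifferentiableAt ℝ f z := (hf.differentiableOn z hzd).differentiableAt hb
    refine h1.hasFDerivAt.congr_fderiv (ContinuousLinearMap.ext fun v => ?_)
    have h2 := hf.fderiv_eq z hzd v
    rw [fderivWithin_of_mem_nhds hb, hFd z hz] at h2
    rw [h2]
    simp only [L, sub_apply, ContinuousLinearMap.comp_apply, betaL_apply]
    rw [hF, extendRot_of_mem hzd]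
  -- The rotation preserves `β`, so `df = 0` on the collar.
  have hL0 : ∀ z, 1 - δ < ‖z‖ → L z = 0 := by
    intro z hz
    have h1 : F =ᶠ[𝓝 z] fun z => circ θ₀ * z := by
      filter_upwards [continuous_norm.continuousAt.eventually (lt_mem_nhds hz)] with y hy
      exact extendRot_of_lt hrot hy
    refine ContinuousLinearMap.ext fun v => ?_
    have h2 : HasFDerivAt (fun z : ℂ => circ θ₀ * z)
        (circ θ₀ • ContinuousLinearMap.id ℝ ℂ) z := (hasFDerivAt_id z).const_mul (circ θ₀)
    simp only [L, sub_apply, ContinuousLinearMap.comp_apply, betaL_apply]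
    rw [h1.fderiv_eq, h2.fderiv, h1.eq_of_nhds]
    simp [beta_circ_mul]
  -- Along the ray from `z` outward to the circle `f` has zero derivative, and its boundary value is
  -- `θ₀`.
  have hcollar : ∀ z, z ∈ disk → 1 - δ < ‖z‖ → 0 < ‖z‖ → f z = θ₀ := by
    intro z hz hz1 hz0
    have hz2 : ‖z‖ ≤ 1 := by simpa using hz
    have hd : ∀ t ∈ Ico (1 : ℝ) ‖z‖⁻¹, HasDerivAt (fun t : ℝ => f (t • z)) 0 t := by
      intro t ht
      have hn : ‖t • z‖ < 1 := by
        rw [norm_smul, Real.norm_of_nonneg (by linarith [ht.1])]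
        calc t * ‖z‖ < ‖z‖⁻¹ * ‖z‖ := mul_lt_mul_of_pos_right ht.2 hz0
          _ = 1 := inv_mul_cancel₀ hz0.ne'
      have hn2 : 1 - δ < ‖t • z‖ := by
        rw [norm_smul, Real.norm_of_nonneg (by linarith [ht.1])]
        nlinarith [ht.1]
      have h1 := hin _ hn
      rw [hL0 _ hn2] at h1
      have h2 : HasDerivAt (fun t : ℝ => t • z) z t := by
        simpa using (hasDerivAt_id t).smul_const z
      exact h1.comp_hasDerivAt t h2
    have hcont : ContinuousOn (fun t : ℝ => f (t • z)) (Icc 1 ‖z‖⁻¹) := by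
      refine hf.differentiableOn.continuousOn.comp (by fun_prop) fun t ht => ?_
      simp only [disk, mem_closedBall, dist_zero_right, norm_smul]
      rw [Real.norm_of_nonneg (by linarith [ht.1])]
      calc t * ‖z‖ ≤ ‖z‖⁻¹ * ‖z‖ := mul_le_mul_of_nonneg_right ht.2 hz0.le
        _ = 1 := inv_mul_cancel₀ hz0.ne'
    have h3 := constant_of_has_deriv_right_zero hcont
      (fun t ht => (hd t ht).hasDerivWithinAt) ‖z‖⁻¹ ⟨(one_le_inv₀ hz0).2 hz2, le_rfl⟩
    simp only [one_smul] at h3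
    rw [← h3]
    exact hf.boundary _ (by rw [norm_smul, norm_inv, norm_norm, inv_mul_cancel₀ hz0.ne'])
  classical
  let g : ℂ → ℝ := fun z => if z ∈ disk then f z else θ₀
  have hgin : ∀ z ∈ disk, g z = f z := fun z hz => if_pos hz
  have hgout : ∀ z, 1 - δ < ‖z‖ → 0 < ‖z‖ → g z = θ₀ := by
    intro z hz hz0
    by_cases h : z ∈ disk
    · rw [hgin z h, hcollar z h hz hz0]
    · exact if_neg h
  have hg : ∀ z, HasFDerivAt g (L z) z := by
    intro z
    by_cases hz : ‖z‖ < 1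
    · refine (hin z hz).congr_of_eventuallyEq ?_
      filter_upwards [isOpen_ball.mem_nhds (by simpa using hz : z ∈ ball (0 : ℂ) 1)] with y hy
      exact hgin y (ball_subset_closedBall hy)
    · rw [not_lt] at hz
      rw [hL0 z (by linarith)]
      refine (hasFDerivAt_const θ₀ z).congr_of_eventuallyEq ?_
      filter_upwards [continuous_norm.continuousAt.eventually
        (lt_mem_nhds (by linarith : 1 - δ < ‖z‖)), continuous_norm.continuousAt.eventually
        (lt_mem_nhds (by linarith : 0 < ‖z‖))] with y hy hy0
      exact hgout y hy hy0
  refine ⟨g, ?_, hgin, hgout, fun z v => ?_⟩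
  · refine contDiff_infty_iff_fderiv.2 ⟨fun z => (hg z).differentiableAt, ?_⟩
    have : fderiv ℝ g = L := funext fun z => (hg z).fderiv
    rw [this]; exact hL
  · rw [(hg z).fderiv]
    simp only [L, sub_apply, ContinuousLinearMap.comp_apply, betaL_apply]

end DiskMap

/-! ### Smooth steps of slope close to one -/

/-- The step is the primitive of a normalized bump. The bump has height `1` on an interval of length
`2 a = 1 / (1 + η)`, so its integral is at least `2 a` and normalizing raises it to at most `1 + η`.
-/
theorem exists_smooth_step {η : ℝ} (hη : 0 < η) :
    ∃ (X : ℝ → ℝ) (ε : ℝ), ContDiff ℝ ∞ X ∧ 0 < ε ∧ (∀ t ≤ ε, X t = 0) ∧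
      (∀ t ≥ 1 - ε, X t = 1) ∧ ∀ t, 0 ≤ deriv X t ∧ deriv X t ≤ 1 + η := by
  set a : ℝ := 1 / (2 * (1 + η)) with ha
  have ha0 : 0 < a := by positivity
  have ha1 : a < 1 / 2 := by
    rw [ha, div_lt_div_iff₀ (by positivity) (by norm_num)]; linarith
  let b : ContDiffBump (1 / 2 : ℝ) := ⟨a, (a + 1 / 2) / 2, ha0, by linarith⟩
  let k : ℝ → ℝ := b.normed volume
  have hk : ContDiff ℝ ∞ k := b.contDiff_normed
  have hsupp : Function.support k = ball (1 / 2 : ℝ) ((a + 1 / 2) / 2) := b.support_normed_eq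
  set ε := 1 / 2 - (a + 1 / 2) / 2 with hε
  have hk0 : ∀ t, t ≤ ε → k t = 0 := by
    intro t ht
    by_contra h
    have : t ∈ Function.support k := h
    rw [hsupp, mem_ball, Real.dist_eq, abs_lt] at this
    linarith [this.1]
  have hk1 : ∀ t, 1 - ε ≤ t → k t = 0 := by
    intro t ht
    by_contra h
    have : t ∈ Function.support k := h
    rw [hsupp, mem_ball, Real.dist_eq, abs_lt] at this
    linarith [this.2]
  let X : ℝ → ℝ := fun t => ∫ u in (0 : ℝ)..t, k u
  have hX : ∀ t, HasDerivAt X (k t) t := fun t =>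
    (hk.continuous.integral_hasStrictDerivAt 0 t).hasDerivAt
  have hdX : deriv X = k := funext fun t => (hX t).deriv
  have hε0 : 0 < ε := by rw [hε]; linarith
  refine ⟨X, ε, ?_, hε0, ?_, ?_, ?_⟩
  · refine contDiff_infty_iff_deriv.2 ⟨fun t => (hX t).differentiableAt, ?_⟩
    rw [hdX]; exact hk
  · intro t ht
    have : ∀ u ∈ uIcc 0 t, k u = 0 := fun u hu =>
      hk0 u (hu.2.trans (max_le hε0.le ht))
    simp only [X]
    rw [intervalIntegral.integral_congr this]; simp
  · intro t ht
    simp only [X]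
    rw [intervalIntegral.integral_eq_integral_of_support_subset]
    · exact b.integral_normed
    · intro u hu
      constructor
      · by_contra h
        exact hu (hk0 u (by linarith))
      · by_contra h
        exact hu (hk1 u (by linarith))
  · intro t
    rw [hdX]
    refine ⟨b.nonneg_normed t, ?_⟩
    have h1 : 2 * a ≤ ∫ x, b x := by
      have := b.measure_closedBall_le_integral (μ := volume)
      refine le_trans (le_of_eq ?_) this
      simp [b, Measure.real, Real.volume_closedBall, ha0.le]
    have h2 : k t = b t / ∫ x, b x := b.normed_def t
    rw [h2, div_le_iff₀ (by linarith)]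
    have h3 : (1 + η) * (2 * a) = 1 := by rw [ha]; field_simp
    have h4 : (1 + η) * (2 * a) ≤ (1 + η) * ∫ x, b x :=
      mul_le_mul_of_nonneg_left h1 (by positivity)
    linarith [b.le_one (x := t)]

/-! ### Gluing along the integers -/

/-- Consecutive pieces agree near the integer between them, so near any `τ₀`, integer or not, the
glued map is a single piece. -/
theorem floor_glue {E E' : Type*} {Z : ℤ → ℝ × E → E'} {ε : ℝ} (hε : 0 < ε)
    (h : ∀ (n : ℤ) (τ : ℝ) e, |τ - n| < ε → Z n (τ, e) = Z (n - 1) (τ, e)) (τ₀ : ℝ) :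
    ∃ n : ℤ, ∀ᶠ τ in 𝓝 τ₀, ∀ e, Z ⌊τ⌋ (τ, e) = Z n (τ, e) := by
  refine ⟨⌊τ₀⌋, ?_⟩
  rcases (Int.floor_le τ₀).eq_or_lt with h1 | h1
  · have h2 : ∀ᶠ τ in 𝓝 τ₀, |τ - τ₀| < min ε 1 := by
      have := Metric.ball_mem_nhds τ₀ (lt_min hε one_pos)
      filter_upwards [this] with τ hτ
      rwa [mem_ball, Real.dist_eq] at hτ
    filter_upwards [h2] with τ hτ e
    have h3 := abs_lt.1 (hτ.trans_le (min_le_right _ _))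
    rcases le_or_gt τ₀ τ with h4 | h4
    · have : ⌊τ⌋ = ⌊τ₀⌋ := Int.floor_eq_iff.2 ⟨by linarith, by linarith⟩
      rw [this]
    · have : ⌊τ⌋ = ⌊τ₀⌋ - 1 := Int.floor_eq_iff.2 ⟨by push_cast; linarith, by push_cast; linarith⟩
      rw [this]
      exact (h ⌊τ₀⌋ τ e (by rw [h1]; exact hτ.trans_le (min_le_left _ _))).symm
  · filter_upwards [Ioo_mem_nhds h1 (Int.lt_floor_add_one τ₀)] with τ hτ e
    have : ⌊τ⌋ = ⌊τ₀⌋ := Int.floor_eq_iff.2 ⟨hτ.1.le, hτ.2⟩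
    rw [this]

theorem contDiff_floor_glue {E E' : Type*} [NormedAddCommGroup E] [NormedSpace ℝ E]
    [NormedAddCommGroup E'] [NormedSpace ℝ E'] {Z : ℤ → ℝ × E → E'} {ε : ℝ} (hε : 0 < ε)
    (h : ∀ (n : ℤ) (τ : ℝ) e, |τ - n| < ε → Z n (τ, e) = Z (n - 1) (τ, e))
    (hZ : ∀ n, ContDiff ℝ ∞ (Z n)) : ContDiff ℝ ∞ fun q : ℝ × E => Z ⌊q.1⌋ q := by
  refine contDiff_iff_contDiffAt.2 fun ⟨τ₀, e₀⟩ => ?_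
  obtain ⟨n, hn⟩ := floor_glue hε h τ₀
  refine (hZ n).contDiffAt.congr_of_eventuallyEq ?_
  have : ∀ᶠ q : ℝ × E in 𝓝 (τ₀, e₀), ∀ e, Z ⌊q.1⌋ (q.1, e) = Z n (q.1, e) :=
    (continuous_fst.tendsto (τ₀, e₀)).eventually hn
  filter_upwards [this] with q hq
  exact hq q.2

/-! ### The suspension of a disk map -/

open DiskMap in
/-- Coordinates `(τ, x) = (τ, Φ (τ, z))` on the mapping torus of an area preserving map `φ`, in
which the return map becomes the identity, with the time function `S`. -/
structure Suspension where
  θ₀ : ℝ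
  ρ : ℝ
  φ : ℂ → ℂ
  φi : ℂ → ℂ
  f : ℂ → ℝ
  Φ : ℝ × ℂ → ℂ
  Ψ : ℝ × ℂ → ℂ
  S : ℝ × ℂ → ℝ
  θ₀_pos : 0 < θ₀
  ρ_pos : 0 < ρ
  ρ_lt : ρ < 1
  φ_smooth : ContDiff ℝ ∞ φ
  f_smooth : ContDiff ℝ ∞ f
  Φ_smooth : ContDiff ℝ ∞ Φ
  Ψ_smooth : ContDiff ℝ ∞ Ψ
  S_smooth : ContDiff ℝ ∞ S
  φφi : ∀ z, φ (φi z) = z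
  φiφ : ∀ z, φi (φ z) = z
  ΦΨ : ∀ τ z, Φ (τ, Ψ (τ, z)) = z
  ΨΦ : ∀ τ z, Ψ (τ, Φ (τ, z)) = z
  Φ_shift : ∀ τ z, Φ (τ + 1, z) = Φ (τ, φ z)
  S_shift : ∀ τ z, S (τ + 1, z) = S (τ, φ z) + f z
  φ_out : ∀ z, ρ ≤ ‖z‖ → φ z = circ θ₀ * z
  f_out : ∀ z, ρ ≤ ‖z‖ → f z = θ₀
  Φ_out : ∀ τ z, ρ ≤ ‖z‖ → Φ (τ, z) = circ (θ₀ * τ) * z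
  S_out : ∀ τ z, ρ ≤ ‖z‖ → S (τ, z) = θ₀ * τ
  Φ_zero : ∀ z, Φ (0, z) = z
  S_zero : ∀ z, S (0, z) = 0
  S_pos : ∀ τ z, 0 < deriv (fun τ => S (τ, z)) τ
  fderiv_f : ∀ z v, fderiv ℝ f z v = beta (φ z) (fderiv ℝ φ z v) - beta z v

namespace DiskMap

/-- An additional real coordinate combines `f` and `φ` into one deck transformation `γ` of `ℝ × ℂ`.
A single family `XX` of diffeomorphisms with `XX (τ + 1, e) = XX (τ, γ e)` then provides both `-S`
and `Φ`, as its two components at `e = (0, z)`. It is written down for `0 ≤ τ ≤ 1` and continued by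
powers of `γ`. -/
theorem exists_suspension {θ₀ : ℝ} {φ : ℂ → ℂ} {f : ℂ → ℝ} (hφ : IsDiskDiffeo φ)
    (hrot : IsRotationNearBoundary φ θ₀) (hf : IsActionFunction φ θ₀ f)
    (hpos : ∀ z ∈ disk, 0 < f z) :
    ∃ D : Suspension, D.θ₀ = θ₀ ∧ EqOn D.φ φ disk ∧ EqOn D.f f disk := by
  have hθ : 0 < θ₀ := by
    rw [← hf.boundary 1 (by simp)]; exact hpos 1 (by simp [disk])
  obtain ⟨δ₀, hδ₀, hrot₀⟩ := hrot
  set δ := min δ₀ 1 with hδdef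
  have hδ : 0 < δ := lt_min hδ₀ one_pos
  have hδ1 : δ ≤ 1 := min_le_right _ _
  have hrot : ∀ z ∈ disk, 1 - δ < ‖z‖ → φ z = circ θ₀ * z := fun z hz h =>
    hrot₀ z hz (by linarith [min_le_left δ₀ 1])
  obtain ⟨χ, hχm, hχs, hinv⟩ := hφ.exists_inverse
  have hrotχ : ∀ z ∈ disk, 1 - δ < ‖z‖ → χ z = circ (-θ₀) * z := by
    intro z hz h
    have hn : ‖circ (-θ₀) * z‖ = ‖z‖ := by rw [norm_mul, norm_circ, one_mul]
    have hd : circ (-θ₀) * z ∈ disk := by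
      simp only [disk, mem_closedBall, dist_zero_right] at hz ⊢
      rwa [hn]
    have h1 := hinv.1 hd
    rwa [hrot _ hd (by rwa [hn]), ← mul_assoc, circ_mul_neg, one_mul] at h1
  set F := extendRot φ θ₀ with hF
  set Fi := extendRot χ (-θ₀) with hFi
  have hFs : ContDiff ℝ ∞ F := contDiff_extendRot hδ hφ.smooth hrot
  have hFis : ContDiff ℝ ∞ Fi := contDiff_extendRot hδ hχs hrotχ
  have hFiF : ∀ z, Fi (F z) = z := extendRot_leftInv hφ.mapsTo hinv.1
  have hFFi : ∀ z, F (Fi z) = z := fun z => by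
    have := extendRot_leftInv (θ := -θ₀) hχm hinv.2 z
    rwa [neg_neg] at this
  obtain ⟨g, hgs, hgf, hgout, hdg⟩ := exists_extend_action hδ hφ.smooth hrot hf
  set r := 1 - δ / 2 with hr
  have hr1 : r < 1 := by linarith
  have hr0 : 0 < r := by linarith
  have hFout : ∀ z, r ≤ ‖z‖ → F z = circ θ₀ * z := fun z hz =>
    extendRot_of_lt hrot (by linarith)
  have hgout' : ∀ z, r ≤ ‖z‖ → g z = θ₀ := fun z hz => hgout z (by linarith) (by linarith)
  -- a lower bound for the action
  obtain ⟨m, hm, hgm⟩ : ∃ m > 0, ∀ z, m ≤ g z := by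
    obtain ⟨w, hw, hmin⟩ := (isCompact_closedBall (0 : ℂ) 1).exists_isMinOn ⟨0, by simp⟩
      hgs.continuous.continuousOn
    refine ⟨min (g w) θ₀, lt_min (by rw [hgf hw]; exact hpos w hw) hθ, fun z => ?_⟩
    by_cases hz : z ∈ disk
    · exact (min_le_left _ _).trans (hmin hz)
    · rw [hgout' z (by
        simp only [disk, mem_closedBall, dist_zero_right, not_le] at hz; linarith)]
      exact min_le_right _ _
  -- With slope at most `1 + m / θ₀`, the derivative `θ₀ + (g - θ₀) X'` of the time function stays
  -- positive: where `g < θ₀` it is at least `g - m + g m / θ₀ ≥ g m / θ₀`.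
  obtain ⟨X, ε, hXs, hε, hX0, hX1, hXd⟩ := exists_smooth_step (η := m / θ₀) (by positivity)
  obtain ⟨ρ, H, G, hρ0, hρ1, hrρ, hH, hG, hHG, hGH, hHout, hH0, hH1⟩ := exists_disk_isotopy
    (ψ := fun z => circ (-θ₀) * F z) (χ := fun z => Fi (circ θ₀ * z))
    (contDiff_const.mul hFs) (hFis.comp (contDiff_const.mul contDiff_id))
    (fun z => by rw [hFFi, ← mul_assoc, circ_neg_mul, one_mul])
    (fun z => by rw [← mul_assoc, circ_mul_neg, one_mul, hFiF]) hr1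
    (fun z hz => by rw [hFout z hz, ← mul_assoc, circ_neg_mul, one_mul])
  -- the deck transformation
  let γ : Equiv.Perm (ℝ × ℂ) :=
    { toFun := fun e => (e.1 - g e.2, F e.2)
      invFun := fun e => (e.1 + g (Fi e.2), Fi e.2)
      left_inv := fun e => by simp [hFiF]
      right_inv := fun e => by simp [hFFi] }
  have hγ : ∀ e, γ e = (e.1 - g e.2, F e.2) := fun e => rfl
  have hγi : ∀ e, γ⁻¹ e = (e.1 + g (Fi e.2), Fi e.2) := fun e => rfl
  have hγs : ContDiff ℝ ∞ γ :=
    (contDiff_fst.sub (hgs.comp contDiff_snd)).prodMk (hFs.comp contDiff_snd)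
  have hγis : ContDiff ℝ ∞ (γ⁻¹ : Equiv.Perm (ℝ × ℂ)) :=
    (contDiff_fst.add (hgs.comp (hFis.comp contDiff_snd))).prodMk (hFis.comp contDiff_snd)
  have hγz : ∀ n : ℤ, ContDiff ℝ ∞ (γ ^ n : Equiv.Perm (ℝ × ℂ)) := by
    intro n
    induction n using Int.induction_on with
    | zero => exact contDiff_id
    | succ n ih => rw [zpow_add_one]; exact ih.comp hγs
    | pred n ih => rw [zpow_sub_one]; exact ih.comp hγis
  -- translations in time commute with everything
  have hγt : ∀ (n : ℤ) (a : ℝ) e, (γ ^ n) (e + (a, 0)) = (γ ^ n) e + (a, 0) := by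
    intro n a
    induction n using Int.induction_on with
    | zero => intro e; rfl
    | succ n ih =>
      intro e
      rw [zpow_add_one, Equiv.Perm.mul_apply, Equiv.Perm.mul_apply, ← ih]
      congr 1
      rw [hγ, hγ]; ext1 <;> simp; ring
    | pred n ih =>
      intro e
      rw [zpow_sub_one, Equiv.Perm.mul_apply, Equiv.Perm.mul_apply, ← ih]
      congr 1
      rw [hγi, hγi]; ext1 <;> simp; ring
  have hFiout : ∀ z, ρ ≤ ‖z‖ → Fi z = circ (-θ₀) * z := fun z hz =>
    extendRot_of_lt hrotχ (by linarith)
  have hγout : ∀ (n : ℤ) (e : ℝ × ℂ), ρ ≤ ‖e.2‖ →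
      (γ ^ n) e = (e.1 - n * θ₀, circ (n * θ₀) * e.2) := by
    intro n
    induction n using Int.induction_on with
    | zero => intro e _; simp [circ_zero]
    | succ n ih =>
      intro e he
      rw [zpow_add_one, Equiv.Perm.mul_apply, hγ, ih _ (by
        simp only; rw [hFout _ (hrρ.trans he), norm_mul, norm_circ, one_mul]; exact he)]
      simp only
      rw [hFout _ (hrρ.trans he), hgout' _ (hrρ.trans he), ← mul_assoc, ← circ_add]
      ext1
      · push_cast; ring
      · simp only; congr 2; push_cast; ring
    | pred n ih =>
      intro e he
      rw [zpow_sub_one, Equiv.Perm.mul_apply, hγi, ih _ (by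
        simp only; rw [hFiout _ he, norm_mul, norm_circ, one_mul]; exact he)]
      simp only
      rw [hFiout _ he, hgout' _ (by rw [norm_mul, norm_circ, one_mul]; exact hrρ.trans he),
        ← mul_assoc, ← circ_add]
      ext1
      · push_cast; ring
      · simp only; congr 2; push_cast; ring
  -- the coordinates over the unit interval
  let X₀ : ℝ × (ℝ × ℂ) → ℝ × ℂ := fun q =>
    (q.2.1 - θ₀ * q.1 - (g q.2.2 - θ₀) * X q.1, circ (θ₀ * q.1) * H (q.1, q.2.2))
  let Y₀ : ℝ × (ℝ × ℂ) → ℝ × ℂ := fun q =>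
    (q.2.1 + θ₀ * q.1 + (g (G (q.1, circ (-(θ₀ * q.1)) * q.2.2)) - θ₀) * X q.1,
      G (q.1, circ (-(θ₀ * q.1)) * q.2.2))
  have hX₀s : ContDiff ℝ ∞ X₀ := by
    have h1 : ContDiff ℝ ∞ fun q : ℝ × (ℝ × ℂ) => X q.1 := hXs.comp contDiff_fst
    have h2 : ContDiff ℝ ∞ fun q : ℝ × (ℝ × ℂ) => g q.2.2 := hgs.comp (by fun_prop)
    have h3 : ContDiff ℝ ∞ fun q : ℝ × (ℝ × ℂ) => circ (θ₀ * q.1) :=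
      contDiff_circ.comp (by fun_prop)
    have h4 : ContDiff ℝ ∞ fun q : ℝ × (ℝ × ℂ) => H (q.1, q.2.2) := hH.comp (by fun_prop)
    exact (((contDiff_fst.comp contDiff_snd).sub (contDiff_const.mul contDiff_fst)).sub
      ((h2.sub contDiff_const).mul h1)).prodMk (h3.mul h4)
  have hY₀s : ContDiff ℝ ∞ Y₀ := by
    have h1 : ContDiff ℝ ∞ fun q : ℝ × (ℝ × ℂ) => X q.1 := hXs.comp contDiff_fst
    have h3 : ContDiff ℝ ∞ fun q : ℝ × (ℝ × ℂ) => circ (-(θ₀ * q.1)) :=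
      contDiff_circ.comp (by fun_prop)
    have h4 : ContDiff ℝ ∞ fun q : ℝ × (ℝ × ℂ) => G (q.1, circ (-(θ₀ * q.1)) * q.2.2) :=
      hG.comp (contDiff_fst.prodMk (h3.mul (by fun_prop)))
    exact (((contDiff_fst.comp contDiff_snd).add (contDiff_const.mul contDiff_fst)).add
      (((hgs.comp h4).sub contDiff_const).mul h1)).prodMk h4
  have hYX₀ : ∀ τ e, Y₀ (τ, X₀ (τ, e)) = e := by
    intro τ e
    simp only [Y₀, X₀]
    rw [← mul_assoc, circ_neg_mul, one_mul, hGH]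
    ext1
    · simp only; ring
    · rfl
  have hXY₀ : ∀ τ e, X₀ (τ, Y₀ (τ, e)) = e := by
    intro τ e
    simp only [Y₀, X₀]
    rw [hHG, ← mul_assoc, circ_mul_neg, one_mul]
    ext1
    · simp only; ring
    · rfl
  set ε' := min ε (1 / 3) with hε'
  have hε'0 : 0 < ε' := lt_min hε (by norm_num)
  have hX₀γ : ∀ τ e, |τ| < ε' → X₀ (τ + 1, e) = X₀ (τ, γ e) := by
    intro τ e hτ
    have h1 := abs_lt.1 (hτ.trans_le (min_le_left _ _))
    have h2 := abs_lt.1 (hτ.trans_le (min_le_right _ _))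
    simp only [X₀, hγ]
    rw [hX1 _ (by linarith), hX0 _ (by linarith), hH1 _ (by linarith), hH0 _ (by linarith)]
    ext1
    · simp only; ring
    · simp only
      rw [← mul_assoc, ← circ_add]
      congr 2; ring
  have hY₀γ : ∀ τ e, |τ| < ε' → γ (Y₀ (τ + 1, e)) = Y₀ (τ, e) := by
    intro τ e hτ
    have := hX₀γ τ (Y₀ (τ + 1, e)) hτ
    rw [hXY₀] at this
    conv_rhs => rw [this, hYX₀]
  -- The piece over `[n, n + 1]` is the unit piece precomposed with `γ ^ n`; adjacent pieces agree
  -- near `n` because `X₀ (τ + 1, ·) = X₀ (τ, γ ·)` for small `τ`.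
  let Z : ℤ → ℝ × (ℝ × ℂ) → ℝ × ℂ := fun n q => X₀ (q.1 - n, (γ ^ n) q.2)
  let Zi : ℤ → ℝ × (ℝ × ℂ) → ℝ × ℂ := fun n q => (γ ^ (-n)) (Y₀ (q.1 - n, q.2))
  have hZ : ∀ n, ContDiff ℝ ∞ (Z n) := fun n =>
    hX₀s.comp ((contDiff_fst.sub contDiff_const).prodMk ((hγz n).comp contDiff_snd))
  have hZi : ∀ n, ContDiff ℝ ∞ (Zi n) := fun n =>
    (hγz (-n)).comp (hY₀s.comp ((contDiff_fst.sub contDiff_const).prodMk contDiff_snd))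
  have hZo : ∀ (n : ℤ) (τ : ℝ) e, |τ - n| < ε' → Z n (τ, e) = Z (n - 1) (τ, e) := by
    intro n τ e hτ
    simp only [Z]
    have h1 : τ - ((n - 1 : ℤ) : ℝ) = (τ - n) + 1 := by push_cast; ring
    rw [h1, hX₀γ _ _ hτ, ← Equiv.Perm.mul_apply, ← zpow_one_add]
    congr 4; ring
  have hZio : ∀ (n : ℤ) (τ : ℝ) e, |τ - n| < ε' → Zi n (τ, e) = Zi (n - 1) (τ, e) := by
    intro n τ e hτ
    simp only [Zi]
    have h1 : τ - ((n - 1 : ℤ) : ℝ) = (τ - n) + 1 := by push_cast; ring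
    rw [h1, ← hY₀γ _ _ hτ, ← Equiv.Perm.mul_apply, ← zpow_add_one]
    congr 2; ring
  let XX : ℝ × (ℝ × ℂ) → ℝ × ℂ := fun q => Z ⌊q.1⌋ q
  let YY : ℝ × (ℝ × ℂ) → ℝ × ℂ := fun q => Zi ⌊q.1⌋ q
  have hXX : ContDiff ℝ ∞ XX := contDiff_floor_glue hε'0 hZo hZ
  have hYY : ContDiff ℝ ∞ YY := contDiff_floor_glue hε'0 hZio hZi
  have hXY : ∀ τ e, XX (τ, YY (τ, e)) = e := by
    intro τ e
    simp only [XX, YY, Z, Zi]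
    rw [← Equiv.Perm.mul_apply, ← zpow_add, add_neg_cancel, zpow_zero, Equiv.Perm.one_apply, hXY₀]
  have hYX : ∀ τ e, YY (τ, XX (τ, e)) = e := by
    intro τ e
    simp only [XX, YY, Z, Zi]
    rw [hYX₀, ← Equiv.Perm.mul_apply, ← zpow_add, neg_add_cancel, zpow_zero, Equiv.Perm.one_apply]
  have hshift : ∀ τ e, XX (τ + 1, e) = XX (τ, γ e) := by
    intro τ e
    simp only [XX, Z]
    rw [Int.floor_add_one, zpow_add_one, Equiv.Perm.mul_apply]
    congr 2; push_cast; ring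
  -- Everything commutes with translations of the additional coordinate, so the family is determined
  -- by its values at `(0, z)`, and its second component is by itself invertible.
  have htr : ∀ τ e (a : ℝ), XX (τ, e + (a, 0)) = XX (τ, e) + (a, 0) := by
    intro τ e a
    simp only [XX, Z, hγt, X₀]
    ext1
    · simp; ring
    · simp
  have htrY : ∀ τ e (a : ℝ), YY (τ, e + (a, 0)) = YY (τ, e) + (a, 0) := by
    intro τ e a
    have := htr τ (YY (τ, e)) a
    rw [hXY] at this
    rw [← this, hYX]
  have hXXγ : ∀ τ z, XX (τ, γ (0, z)) = XX (τ, (0, F z)) + (-g z, 0) := by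
    intro τ z
    rw [← htr, hγ]; simp
  have hz0 : ContDiff ℝ ∞ fun q : ℝ × ℂ => (q.1, ((0 : ℝ), q.2)) := by fun_prop
  refine ⟨{ θ₀ := θ₀, ρ := ρ, φ := F, φi := Fi, f := g
            Φ := fun q => (XX (q.1, (0, q.2))).2
            Ψ := fun q => (YY (q.1, (0, q.2))).2
            S := fun q => -(XX (q.1, (0, q.2))).1
            θ₀_pos := hθ, ρ_pos := hρ0, ρ_lt := hρ1, φ_smooth := hFs, f_smooth := hgs
            Φ_smooth := contDiff_snd.comp (hXX.comp hz0)
            Ψ_smooth := contDiff_snd.comp (hYY.comp hz0)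
            S_smooth := (contDiff_fst.comp (hXX.comp hz0)).neg
            φφi := hFFi, φiφ := hFiF
            ΦΨ := ?_, ΨΦ := ?_
            Φ_shift := fun τ z => by simp only; rw [hshift, hXXγ]; simp
            S_shift := fun τ z => by simp only; rw [hshift, hXXγ]; simp; ring
            φ_out := fun z hz => hFout z (hrρ.trans hz)
            f_out := fun z hz => hgout' z (hrρ.trans hz)
            Φ_out := ?_, S_out := ?_, Φ_zero := ?_, S_zero := ?_, S_pos := ?_
            fderiv_f := hdg }, rfl, fun z hz => extendRot_of_mem hz, hgf⟩
  · intro τ z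
    simp only
    have h1 := htr τ (0, (YY (τ, (0, z))).2) (YY (τ, (0, z))).1
    have h2 : ((0 : ℝ), (YY (τ, (0, z))).2) + ((YY (τ, (0, z))).1, (0 : ℂ)) = YY (τ, (0, z)) := by
      ext1 <;> simp
    rw [h2, hXY] at h1
    have := congrArg Prod.snd h1
    simpa using this.symm
  · intro τ z
    simp only
    have h1 := htrY τ (0, (XX (τ, (0, z))).2) (XX (τ, (0, z))).1
    have h2 : ((0 : ℝ), (XX (τ, (0, z))).2) + ((XX (τ, (0, z))).1, (0 : ℂ)) = XX (τ, (0, z)) := by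
      ext1 <;> simp
    rw [h2, hYX] at h1
    have := congrArg Prod.snd h1
    simpa using this.symm
  · intro τ z hz
    simp only [XX, Z, X₀]
    rw [hγout _ _ hz]
    simp only
    rw [hHout _ _ (by rw [norm_mul, norm_circ, one_mul]; exact hz), ← mul_assoc, ← circ_add]
    congr 2; ring
  · intro τ z hz
    simp only [XX, Z, X₀]
    rw [hγout _ _ hz]
    simp only
    rw [hgout' _ (by rw [norm_mul, norm_circ, one_mul]; exact hrρ.trans hz)]
    ring
  · intro z
    simp [XX, Z, X₀, circ_zero, hH0]
  · intro z
    simp [XX, Z, X₀, hX0 0 hε.le]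
  · intro τ z
    obtain ⟨n, hn⟩ := floor_glue hε'0 hZo τ
    set z' := ((γ ^ n) (0, z)).2 with hz'
    have h1 : (fun τ => -(XX (τ, (0, z))).1) =ᶠ[𝓝 τ] fun τ =>
        -(((γ ^ n) (0, z)).1 - θ₀ * (τ - n) - (g z' - θ₀) * X (τ - n)) := by
      filter_upwards [hn] with t ht
      have := ht (0, z)
      simp only [XX]
      rw [this]
    have h2 : HasDerivAt (fun τ : ℝ => X (τ - n)) (deriv X (τ - n)) τ := by
      have := (hXs.differentiable (by simp) (τ - n)).hasDerivAt
      exact this.comp_sub_const τ n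
    have h3 : HasDerivAt (fun τ : ℝ =>
        -(((γ ^ n) (0, z)).1 - θ₀ * (τ - n) - (g z' - θ₀) * X (τ - n)))
        (-(0 - θ₀ * 1 - (g z' - θ₀) * deriv X (τ - n))) τ :=
      (((hasDerivAt_const τ _).sub (((hasDerivAt_id τ).sub_const _).const_mul θ₀)).sub
        (h2.const_mul _)).neg
    -- Either `g ≥ θ₀` and both terms are nonnegative, or the bound on the slope of `X` and `m ≤ g`
    -- apply.
    have h4 : 0 < θ₀ + (g z' - θ₀) * deriv X (τ - n) := by
      obtain ⟨h5, h6⟩ := hXd (τ - n)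
      have h7 := hgm z'
      rcases le_or_gt θ₀ (g z') with h | h
      · have : 0 ≤ (g z' - θ₀) * deriv X (τ - n) := mul_nonneg (by linarith) h5
        linarith
      · have h8 : (θ₀ - g z') * deriv X (τ - n) ≤ (θ₀ - g z') * (1 + m / θ₀) :=
          mul_le_mul_of_nonneg_left h6 (by linarith)
        have h9 : (θ₀ - g z') * (1 + m / θ₀) = θ₀ - g z' + m - g z' * (m / θ₀) := by
          field_simp
          ring
        have h10 : 0 < g z' * (m / θ₀) := by
          have : 0 < g z' := hm.trans_le h7
          positivity
        nlinarith
    rw [h1.deriv_eq, h3.deriv]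
    linarith

end DiskMap

namespace ContactSphere

open DiskMap (circ areaForm beta betaL betaL_apply)

/-! ### Complex coordinates on `ℝ⁴` -/

/-- The first complex coordinate on `ℝ⁴`. -/
noncomputable def c1 : E4 →L[ℝ] ℂ :=
  (EuclideanSpace.proj (0 : Fin 4) : E4 →L[ℝ] ℝ).smulRight 1 +
    (EuclideanSpace.proj (1 : Fin 4) : E4 →L[ℝ] ℝ).smulRight Complex.I

/-- The second complex coordinate on `ℝ⁴`. -/
noncomputable def c2 : E4 →L[ℝ] ℂ :=
  (EuclideanSpace.proj (2 : Fin 4) : E4 →L[ℝ] ℝ).smulRight 1 +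
    (EuclideanSpace.proj (3 : Fin 4) : E4 →L[ℝ] ℝ).smulRight Complex.I

@[simp] theorem c1_re (p : E4) : (c1 p).re = p 0 := by simp [c1]
@[simp] theorem c1_im (p : E4) : (c1 p).im = p 1 := by simp [c1]
@[simp] theorem c2_re (p : E4) : (c2 p).re = p 2 := by simp [c2]
@[simp] theorem c2_im (p : E4) : (c2 p).im = p 3 := by simp [c2]

/-- The point of `ℝ⁴` with given complex coordinates. -/
noncomputable def ofC : ℂ × ℂ →L[ℝ] E4 :=
  LinearMap.toContinuousLinearMap
    { toFun := fun w => !₂[w.1.re, w.1.im, w.2.re, w.2.im]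
      map_add' := fun x y => by ext i; fin_cases i <;> simp
      map_smul' := fun c x => by ext i; fin_cases i <;> simp }

theorem ofC_apply (w : ℂ × ℂ) : ofC w = !₂[w.1.re, w.1.im, w.2.re, w.2.im] := rfl

@[simp] theorem ofC_zero (w : ℂ × ℂ) : ofC w 0 = w.1.re := by simp [ofC_apply]
@[simp] theorem ofC_one (w : ℂ × ℂ) : ofC w 1 = w.1.im := by simp [ofC_apply]
@[simp] theorem ofC_two (w : ℂ × ℂ) : ofC w 2 = w.2.re := by simp [ofC_apply]
@[simp] theorem ofC_three (w : ℂ × ℂ) : ofC w 3 = w.2.im := by simp [ofC_apply]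

@[simp] theorem c1_ofC (w : ℂ × ℂ) : c1 (ofC w) = w.1 := by
  apply Complex.ext <;> simp

@[simp] theorem c2_ofC (w : ℂ × ℂ) : c2 (ofC w) = w.2 := by
  apply Complex.ext <;> simp

theorem ofC_c (p : E4) : ofC (c1 p, c2 p) = p := by
  ext i; fin_cases i <;> simp

theorem E4.ext_c {p q : E4} (h1 : c1 p = c1 q) (h2 : c2 p = c2 q) : p = q := by
  rw [← ofC_c p, ← ofC_c q, h1, h2]

theorem inner_c (p v : E4) : inner ℝ p v =
    (c1 p).re * (c1 v).re + (c1 p).im * (c1 v).im + (c2 p).re * (c2 v).re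
      + (c2 p).im * (c2 v).im := by
  simp [PiLp.inner_apply, Fin.sum_univ_four]; ring

theorem norm_sq_c (p : E4) : ‖p‖ ^ 2 = ‖c1 p‖ ^ 2 + ‖c2 p‖ ^ 2 := by
  rw [← real_inner_self_eq_norm_sq, inner_c, ← Complex.normSq_eq_norm_sq,
    ← Complex.normSq_eq_norm_sq, Complex.normSq_apply, Complex.normSq_apply]
  ring

theorem mem_S3_iff {p : E4} : p ∈ S3 ↔ ‖c1 p‖ ^ 2 + ‖c2 p‖ ^ 2 = 1 := by
  rw [← norm_sq_c, mem_sphere_zero_iff_norm, pow_eq_one_iff_of_nonneg (norm_nonneg p) two_ne_zero]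

theorem det4_eq (p u v w : E4) : det4 p u v w =
    p 0 * (u 1 * (v 2 * w 3 - v 3 * w 2) - u 2 * (v 1 * w 3 - v 3 * w 1)
      + u 3 * (v 1 * w 2 - v 2 * w 1))
    - p 1 * (u 0 * (v 2 * w 3 - v 3 * w 2) - u 2 * (v 0 * w 3 - v 3 * w 0)
      + u 3 * (v 0 * w 2 - v 2 * w 0))
    + p 2 * (u 0 * (v 1 * w 3 - v 3 * w 1) - u 1 * (v 0 * w 3 - v 3 * w 0)
      + u 3 * (v 0 * w 1 - v 1 * w 0))
    - p 3 * (u 0 * (v 1 * w 2 - v 2 * w 1) - u 1 * (v 0 * w 2 - v 2 * w 0)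
      + u 2 * (v 0 * w 1 - v 1 * w 0)) := by
  simp [det4, Matrix.det_succ_row_zero, Fin.sum_univ_succ, Fin.succAbove]
  ring

/-! ### One-forms given by linear functionals -/

/-- The exterior derivative of a field of linear functionals. -/
noncomputable def dL {E : Type*} [NormedAddCommGroup E] [NormedSpace ℝ E] (l : E → E →L[ℝ] ℝ)
    (p u v : E) : ℝ := fderiv ℝ l p u v - fderiv ℝ l p v u

theorem dL_congr {E : Type*} [NormedAddCommGroup E] [NormedSpace ℝ E] {l l' : E → E →L[ℝ] ℝ}
    {p : E} (h : l =ᶠ[𝓝 p] l') (u v : E) : dL l p u v = dL l' p u v := by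
  simp only [dL, h.fderiv_eq]

/-- The exterior derivative commutes with pullback. -/
theorem dL_pullback {E F : Type*} [NormedAddCommGroup E] [NormedSpace ℝ E]
    [NormedAddCommGroup F] [NormedSpace ℝ F] {l : F → F →L[ℝ] ℝ} {g : E → F} {q : E}
    (hl : DifferentiableAt ℝ l (g q)) (hg : ContDiffAt ℝ ∞ g q) (u v : E) :
    dL (fun q => (l (g q)).comp (fderiv ℝ g q)) q u v
      = dL l (g q) (fderiv ℝ g q u) (fderiv ℝ g q v) := by
  have h1 : HasFDerivAt g (fderiv ℝ g q) q := (hg.differentiableAt (by simp)).hasFDerivAt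
  have h2 : HasFDerivAt (fderiv ℝ g) (fderiv ℝ (fderiv ℝ g) q) q :=
    ((hg.fderiv_right (m := 1) (by norm_cast)).differentiableAt (by simp)).hasFDerivAt
  have h3 := (hl.hasFDerivAt.comp q h1).clm_comp h2
  have h4 : IsSymmSndFDerivAt ℝ g q :=
    hg.isSymmSndFDerivAt (by rw [minSmoothness_of_isRCLikeNormedField]; norm_cast)
  simp only [dL]
  rw [show (fun q => (l (g q)).comp (fderiv ℝ g q)) = fun q => ((l ∘ g) q).comp (fderiv ℝ g q)
    from rfl, h3.fderiv]
  simp only [Function.comp_apply, add_apply, ContinuousLinearMap.comp_apply,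
    ContinuousLinearMap.compL_apply, ContinuousLinearMap.flip_apply]
  rw [h4 u v]
  ring

theorem dL_fderiv {E : Type*} [NormedAddCommGroup E] [NormedSpace ℝ E] {g : E → ℝ} {q : E}
    (hg : ContDiffAt ℝ ∞ g q) (u v : E) : dL (fderiv ℝ g) q u v = 0 := by
  have h4 : IsSymmSndFDerivAt ℝ g q :=
    hg.isSymmSndFDerivAt (by rw [minSmoothness_of_isRCLikeNormedField]; norm_cast)
  simp [dL, h4 u v]

theorem dL_add {E : Type*} [NormedAddCommGroup E] [NormedSpace ℝ E] {l l' : E → E →L[ℝ] ℝ}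
    {p : E} (h : DifferentiableAt ℝ l p) (h' : DifferentiableAt ℝ l' p) (u v : E) :
    dL (fun q => l q + l' q) p u v = dL l p u v + dL l' p u v := by
  simp only [dL]
  rw [show (fun q => l q + l' q) = l + l' from rfl, fderiv_add h h']
  simp only [add_apply]
  ring

theorem dL_beta {E : Type*} [NormedAddCommGroup E] [NormedSpace ℝ E] (c : E →L[ℝ] ℂ)
    (p u v : E) : dL (fun p => (betaL (c p)).comp c) p u v = areaForm (c u) (c v) := by
  have h : HasFDerivAt (fun p => (betaL (c p)).comp c)
      (((ContinuousLinearMap.compL ℝ E ℂ ℝ).flip c).comp (betaL.comp c)) p :=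
    ((((ContinuousLinearMap.compL ℝ E ℂ ℝ).flip c).comp (betaL.comp c))).hasFDerivAt
  simp only [dL]
  rw [h.fderiv]
  simp only [ContinuousLinearMap.comp_apply, ContinuousLinearMap.flip_apply,
    ContinuousLinearMap.compL_apply, betaL_apply, beta, areaForm]
  field_simp
  ring

/-- The one-form given by a field of linear functionals. -/
noncomputable def toForm (l : E4 → E4 →L[ℝ] ℝ) : OneForm := fun p =>
  ContinuousAlternatingMap.ofSubsingletonLIE (ι := Fin 1) 0 (l p)

theorem contDiffAt_toForm {l : E4 → E4 →L[ℝ] ℝ} {p : E4} (h : ContDiffAt ℝ ∞ l p) :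
    ContDiffAt ℝ ∞ (toForm l) p :=
  (ContinuousAlternatingMap.ofSubsingletonLIE (𝕜 := ℝ) (E := E4) (F := ℝ) (ι := Fin 1)
    0).contDiff.contDiffAt.comp p h

theorem dForm_toForm {l : E4 → E4 →L[ℝ] ℝ} {p : E4} (h : ContDiffAt ℝ ∞ l p) (u v : E4) :
    dForm (toForm l) p u v = dL l p u v := by
  have h1 : DifferentiableAt ℝ l p := h.differentiableAt (by simp)
  have h2 : ∀ w : E4, fderiv ℝ (fun q => toForm l q ![w]) p
      = (ContinuousLinearMap.apply ℝ ℝ w).comp (fderiv ℝ l p) := fun w =>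
    ((ContinuousLinearMap.apply ℝ ℝ w).hasFDerivAt.comp p h1.hasFDerivAt).fderiv
  rw [dForm, extDeriv_apply ((contDiffAt_toForm h).differentiableAt (by simp))]
  have e1 : (0 : Fin 2).removeNth ![u, v] = ![v] := by
    ext i; fin_cases i; rfl
  have e2 : (1 : Fin 2).removeNth ![u, v] = ![u] := by
    ext i; fin_cases i; rfl
  rw [Fin.sum_univ_two, e1, e2, h2, h2]
  simp [dL]
  ring

/-! ### Contact forms on the sphere -/

theorem frame_expand {p v : E4} (hp : p ∈ S3) (hv : Tangent p v) :
    v = (inner ℝ (frameI p) v) • frameI p + (inner ℝ (frameJ p) v) • frameJ p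
      + (inner ℝ (frameK p) v) • frameK p := by
  rw [mem_S3_iff, ← Complex.normSq_eq_norm_sq, ← Complex.normSq_eq_norm_sq,
    Complex.normSq_apply, Complex.normSq_apply] at hp
  simp only [c1_re, c1_im, c2_re, c2_im] at hp
  rw [Tangent, inner_c] at hv
  simp only [c1_re, c1_im, c2_re, c2_im] at hv
  ext i
  fin_cases i <;> simp [inner_c, frameI, frameJ, frameK]
  · linear_combination (-v 0) * hp + p 0 * hv
  · linear_combination (-v 1) * hp + p 1 * hv
  · linear_combination (-v 2) * hp + p 2 * hv
  · linear_combination (-v 3) * hp + p 3 * hv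

theorem update_pair (x y v : E4) : Function.update ![y, v] 0 x = ![x, v] := by
  ext i; fin_cases i <;> simp

theorem update_single (x y : E4) : Function.update ![y] 0 x = ![x] := by
  ext i; fin_cases i; simp

theorem dForm_add_left (lam : OneForm) (p u u' v : E4) :
    dForm lam p (u + u') v = dForm lam p u v + dForm lam p u' v := by
  have := (extDeriv lam p).map_update_add ![0, v] 0 u u'
  rw [update_pair, update_pair, update_pair] at this
  exact this

theorem dForm_smul_left (lam : OneForm) (p : E4) (c : ℝ) (u v : E4) :
    dForm lam p (c • u) v = c * dForm lam p u v := by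
  have := (extDeriv lam p).map_update_smul ![0, v] 0 c u
  rw [update_pair, update_pair] at this
  exact this

theorem dForm_swap (lam : OneForm) (p u v : E4) : dForm lam p v u = - dForm lam p u v := by
  have := (extDeriv lam p).toAlternatingMap.map_swap ![u, v] (i := 0) (j := 1) (by decide)
  simp only [ContinuousAlternatingMap.coe_toAlternatingMap] at this
  rw [dForm, dForm, ← this]
  congr 1
  ext i; fin_cases i <;> rfl

theorem dForm_self (lam : OneForm) (p u : E4) : dForm lam p u u = 0 := by
  linarith [dForm_swap lam p u u]

theorem dForm_add_right (lam : OneForm) (p u v v' : E4) :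
    dForm lam p u (v + v') = dForm lam p u v + dForm lam p u v' := by
  rw [dForm_swap, dForm_add_left, dForm_swap lam p u v, dForm_swap lam p u v']; ring

theorem dForm_smul_right (lam : OneForm) (p : E4) (c : ℝ) (u v : E4) :
    dForm lam p u (c • v) = c * dForm lam p u v := by
  rw [dForm_swap, dForm_smul_left, dForm_swap lam p u v]; ring

theorem form_add (lam : OneForm) (p u v : E4) : lam p ![u + v] = lam p ![u] + lam p ![v] := by
  have := (lam p).map_update_add ![0] 0 u v
  rw [update_single, update_single, update_single] at this
  exact this

theorem form_smul (lam : OneForm) (p : E4) (c : ℝ) (u : E4) :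
    lam p ![c • u] = c * lam p ![u] := by
  have := (lam p).map_update_smul ![0] 0 c u
  rw [update_single, update_single] at this
  exact this

theorem det4_frame_comb {p : E4} (hp : p ∈ S3) (a b c a' b' c' a'' b'' c'' : ℝ) :
    det4 p (a • frameI p + b • frameJ p + c • frameK p)
      (a' • frameI p + b' • frameJ p + c' • frameK p)
      (a'' • frameI p + b'' • frameJ p + c'' • frameK p)
    = a * (b' * c'' - c' * b'') - b * (a' * c'' - c' * a'') + c * (a' * b'' - b' * a'') := by
  have h := det4_frame p hp
  rw [det4_eq] at h ⊢
  simp [frameI, frameJ, frameK] at h ⊢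
  linear_combination (a * (b' * c'' - c' * b'') - b * (a' * c'' - c' * a'')
    + c * (a' * b'' - b' * a'')) * h

/-- `λ ∧ dλ` is the contact density times the volume form of the sphere. -/
theorem wedgeD_eq (lam : OneForm) {p : E4} (hp : p ∈ S3) {u v w : E4} (hu : Tangent p u)
    (hv : Tangent p v) (hw : Tangent p w) :
    wedgeD lam p u v w = contactDensity lam p * det4 p u v w := by
  rw [frame_expand hp hu, frame_expand hp hv, frame_expand hp hw]
  generalize (inner ℝ (frameI p) u) = a, (inner ℝ (frameJ p) u) = b, (inner ℝ (frameK p) u) = c,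
    (inner ℝ (frameI p) v) = a', (inner ℝ (frameJ p) v) = b', (inner ℝ (frameK p) v) = c',
    (inner ℝ (frameI p) w) = a'', (inner ℝ (frameJ p) w) = b'', (inner ℝ (frameK p) w) = c''
  rw [det4_frame_comb hp]
  simp only [contactDensity, wedgeD, form_add, form_smul, dForm_add_left, dForm_add_right,
    dForm_smul_left, dForm_smul_right, dForm_self, dForm_swap lam p (frameI p) (frameJ p),
    dForm_swap lam p (frameI p) (frameK p), dForm_swap lam p (frameJ p) (frameK p)]
  ring

theorem Tangent.add {p u v : E4} (hu : Tangent p u) (hv : Tangent p v) : Tangent p (u + v) := by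
  rw [Tangent, inner_add_right, hu, hv, add_zero]

theorem Tangent.smul {p u : E4} (c : ℝ) (hu : Tangent p u) : Tangent p (c • u) := by
  rw [Tangent, inner_smul_right, hu, mul_zero]

/-- The difference of two Reeb vectors is annihilated by `λ` and by `dλ`, hence inserts to zero in
the volume form `λ ∧ dλ`. Testing against pairs of frame vectors kills its three coordinates. -/
theorem IsReebVector.unique {lam : OneForm} {p v v' : E4} (hp : p ∈ S3)
    (hd : contactDensity lam p ≠ 0) (h : IsReebVector lam p v) (h' : IsReebVector lam p v') :
    v = v' := by
  set d := v + (-1 : ℝ) • v' with hdef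
  have ht : Tangent p d := h.tangent.add (h'.tangent.smul _)
  have hl : lam p ![d] = 0 := by
    rw [hdef, form_add, form_smul, h.lam_eq, h'.lam_eq]; ring
  have hw : ∀ w, Tangent p w → dForm lam p d w = 0 := fun w hw => by
    rw [hdef, dForm_add_left, dForm_smul_left, h.dlam_eq w hw, h'.dlam_eq w hw]; ring
  have key : ∀ u w, Tangent p u → Tangent p w → det4 p d u w = 0 := fun u w hu hw' => by
    have h1 := wedgeD_eq lam hp ht hu hw'
    rw [wedgeD, hl, hw _ hu, hw _ hw'] at h1
    have h2 : contactDensity lam p * det4 p d u w = 0 := by rw [← h1]; ring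
    exact (mul_eq_zero.1 h2).resolve_left hd
  obtain ⟨tI, tJ, tK⟩ := tangent_frame p
  have e := frame_expand hp ht
  have k1 := key _ _ tJ tK
  have k2 := key _ _ tI tK
  have k3 := key _ _ tI tJ
  rw [e] at k1 k2 k3
  have f1 := det4_frame_comb hp (inner ℝ (frameI p) d) (inner ℝ (frameJ p) d)
    (inner ℝ (frameK p) d) 0 1 0 0 0 1
  have f2 := det4_frame_comb hp (inner ℝ (frameI p) d) (inner ℝ (frameJ p) d)
    (inner ℝ (frameK p) d) 1 0 0 0 0 1
  have f3 := det4_frame_comb hp (inner ℝ (frameI p) d) (inner ℝ (frameJ p) d)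
    (inner ℝ (frameK p) d) 1 0 0 0 1 0
  simp only [zero_smul, one_smul, add_zero, zero_add] at f1 f2 f3
  rw [k1] at f1
  rw [k2] at f2
  rw [k3] at f3
  rw [show inner ℝ (frameI p) d = 0 by linarith, show inner ℝ (frameJ p) d = 0 by linarith,
    show inner ℝ (frameK p) d = 0 by linarith] at e
  simp only [zero_smul, add_zero] at e
  rw [hdef] at e
  simpa [← sub_eq_add_neg, sub_eq_zero] using e

end ContactSphere

/-! ### Angles of complex numbers. -/

namespace DiskMap

theorem circ_arg (w : ℂ) : (‖w‖ : ℂ) * circ (Complex.arg w / (2 * π)) = w := by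
  have h : (2 * π * ((Complex.arg w / (2 * π) : ℝ) : ℂ) * Complex.I : ℂ)
      = Complex.arg w * Complex.I := by
    push_cast
    field_simp
  rw [circ, h, Complex.norm_mul_exp_arg_mul_I]

theorem circ_eq_circ_iff {a b : ℝ} : circ a = circ b ↔ ∃ n : ℤ, a = b + n := by
  constructor
  · intro h
    have h1 : circ (a - b) = 1 := by
      rw [sub_eq_add_neg, circ_add, h, circ_mul_neg]
    obtain ⟨n, hn⟩ := (circ_eq_one_iff _).1 h1
    exact ⟨n, by linarith⟩
  · rintro ⟨n, rfl⟩
    rw [circ_add, circ_int, mul_one]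

/-- The angle of a nonzero complex number has a smooth local branch. -/
theorem exists_smooth_arg {w₀ : ℂ} (h₀ : w₀ ≠ 0) : ∃ b : ℂ → ℝ, ContDiffAt ℝ ∞ b w₀ ∧
    ∀ w : ℂ, (‖w‖ : ℂ) * circ (b w) = w := by
  refine ⟨fun w => Complex.arg w₀ / (2 * π) + (Complex.log (w / w₀)).im / (2 * π), ?_, ?_⟩
  · have h1 : ContDiffAt ℝ ∞ (fun w : ℂ => Complex.log (w / w₀)) w₀ := by
      have h2 : ContDiffAt ℝ ∞ Complex.log (w₀ / w₀) := by
        rw [div_self h₀]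
        exact (Complex.contDiffAt_log (by simp)).restrict_scalars ℝ
      exact ContDiffAt.comp (f := fun w : ℂ => w / w₀) w₀ h2 (contDiffAt_id.div_const _)
    exact contDiffAt_const.add
      ((Complex.imCLM.contDiff.contDiffAt.comp w₀ h1).div_const _)
  · intro w
    have h1 := circ_arg w₀
    have h2 := circ_arg (w / w₀)
    simp only [Complex.log_im, circ_add]
    have h3 : (‖w₀‖ : ℂ) ≠ 0 := by simpa using h₀
    have h4 : (‖w‖ : ℂ) = ‖w₀‖ * ‖w / w₀‖ := by
      rw [norm_div]; push_cast; field_simp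
    calc _ = ((‖w₀‖ : ℂ) * circ (Complex.arg w₀ / (2 * π))) *
          (‖w / w₀‖ * circ (Complex.arg (w / w₀) / (2 * π))) := by rw [h4]; ring
      _ = w := by rw [h1, h2]; field_simp

end DiskMap

namespace ContactSphere

open DiskMap

/-! ### The standard open book -/

/-- The pages of the standard open book of `S³`. -/
noncomputable def bookMap (q : ℝ × ℂ) : E4 :=
  ofC (q.2, (Real.sqrt (1 - ‖q.2‖ ^ 2) : ℂ) * circ q.1)

@[simp] theorem c1_bookMap (q : ℝ × ℂ) : c1 (bookMap q) = q.2 := by simp [bookMap]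

@[simp] theorem c2_bookMap (q : ℝ × ℂ) :
    c2 (bookMap q) = (Real.sqrt (1 - ‖q.2‖ ^ 2) : ℂ) * circ q.1 := by simp [bookMap]

theorem one_sub_sq_pos {x : ℂ} (hx : ‖x‖ < 1) : 0 < 1 - ‖x‖ ^ 2 := by
  have := norm_nonneg x
  nlinarith

theorem norm_c2_bookMap (q : ℝ × ℂ) : ‖c2 (bookMap q)‖ = Real.sqrt (1 - ‖q.2‖ ^ 2) := by
  rw [c2_bookMap, norm_mul, norm_circ, mul_one, Complex.norm_real, Real.norm_of_nonneg]
  exact Real.sqrt_nonneg _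

theorem bookMap_mem {q : ℝ × ℂ} (hq : ‖q.2‖ ≤ 1) : bookMap q ∈ S3 := by
  have : 0 ≤ 1 - ‖q.2‖ ^ 2 := by have := norm_nonneg q.2; nlinarith
  rw [mem_S3_iff, norm_c2_bookMap, Real.sq_sqrt this, c1_bookMap]
  ring

theorem bookMap_eq {τ : ℝ} {p : E4} (hp : p ∈ S3) (h : (‖c2 p‖ : ℂ) * circ τ = c2 p) :
    bookMap (τ, c1 p) = p := by
  apply E4.ext_c (by simp)
  rw [mem_S3_iff] at hp
  rw [c2_bookMap]
  simp only
  rw [show 1 - ‖c1 p‖ ^ 2 = ‖c2 p‖ ^ 2 by linarith, Real.sqrt_sq (norm_nonneg _), h]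

theorem contDiffAt_bookMap {q : ℝ × ℂ} (hq : ‖q.2‖ < 1) : ContDiffAt ℝ ∞ bookMap q := by
  have h1 : ContDiffAt ℝ ∞ (fun q : ℝ × ℂ => Real.sqrt (1 - ‖q.2‖ ^ 2)) q := by
    have h0 : ContDiffAt ℝ ∞ (fun q : ℝ × ℂ => 1 - ‖q.2‖ ^ 2) q :=
      contDiffAt_const.sub ((contDiff_snd.norm_sq ℝ).contDiffAt)
    exact h0.sqrt (one_sub_sq_pos hq).ne'
  have h2 : ContDiffAt ℝ ∞ (fun q : ℝ × ℂ => (Real.sqrt (1 - ‖q.2‖ ^ 2) : ℂ)) q :=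
    Complex.ofRealCLM.contDiff.contDiffAt.comp q h1
  exact ofC.contDiff.contDiffAt.comp q (contDiffAt_snd.prodMk
    (h2.mul (contDiff_circ.contDiffAt.comp q contDiffAt_fst)))

theorem hasFDerivAt_bookMap {q : ℝ × ℂ} (hq : ‖q.2‖ < 1) :
    HasFDerivAt bookMap (fderiv ℝ bookMap q) q :=
  ((contDiffAt_bookMap hq).differentiableAt (by simp)).hasFDerivAt

theorem c1_fderiv_bookMap {q : ℝ × ℂ} (hq : ‖q.2‖ < 1) (h : ℝ × ℂ) :
    c1 (fderiv ℝ bookMap q h) = h.2 := by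
  have h1 := c1.hasFDerivAt.comp q (hasFDerivAt_bookMap hq)
  have h2 : HasFDerivAt (c1 ∘ bookMap) (ContinuousLinearMap.snd ℝ ℝ ℂ) q := by
    rw [show c1 ∘ bookMap = Prod.snd by ext1 q; simp]
    exact hasFDerivAt_snd
  exact congrArg (fun l : ℝ × ℂ →L[ℝ] ℂ => l h) (h1.unique h2)

theorem c2_fderiv_bookMap {q : ℝ × ℂ} (hq : ‖q.2‖ < 1) (h : ℝ × ℂ) :
    c2 (fderiv ℝ bookMap q h) = (((-(q.2.re * h.2.re + q.2.im * h.2.im)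
      / Real.sqrt (1 - ‖q.2‖ ^ 2) : ℝ) : ℂ)
      + ((2 * π * Real.sqrt (1 - ‖q.2‖ ^ 2) * h.1 : ℝ) : ℂ) * Complex.I) * circ q.1 := by
  have hs := one_sub_sq_pos hq
  have h1 := ((c2.hasFDerivAt.comp q (hasFDerivAt_bookMap hq)).comp_hasDerivAt_of_eq (0 : ℝ)
    (((hasDerivAt_id (0 : ℝ)).smul_const h).const_add q) (by simp))
  have hr : HasDerivAt (fun t : ℝ => (q + t • h).2.re) h.2.re 0 := by
    simpa using ((hasDerivAt_id (0 : ℝ)).mul_const h.2.re).const_add q.2.re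
  have hi : HasDerivAt (fun t : ℝ => (q + t • h).2.im) h.2.im 0 := by
    simpa using ((hasDerivAt_id (0 : ℝ)).mul_const h.2.im).const_add q.2.im
  have hf : HasDerivAt (fun t : ℝ => (q + t • h).1) h.1 0 := by
    simpa using ((hasDerivAt_id (0 : ℝ)).mul_const h.1).const_add q.1
  have hn : ∀ z : ℂ, ‖z‖ ^ 2 = z.re ^ 2 + z.im ^ 2 := fun z => by
    rw [← Complex.normSq_eq_norm_sq, Complex.normSq_apply]; ring
  have h2 : HasDerivAt (fun t : ℝ => Real.sqrt (1 - ‖(q + t • h).2‖ ^ 2))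
      (-(q.2.re * h.2.re + q.2.im * h.2.im) / Real.sqrt (1 - ‖q.2‖ ^ 2)) 0 := by
    have h3 : HasDerivAt (fun t : ℝ => 1 - ‖(q + t • h).2‖ ^ 2)
        (-(2 * (q.2.re * h.2.re + q.2.im * h.2.im))) 0 := by
      rw [show (fun t : ℝ => 1 - ‖(q + t • h).2‖ ^ 2)
        = fun t => 1 - ((q + t • h).2.re ^ 2 + (q + t • h).2.im ^ 2) by simp only [hn]]
      refine (((hr.pow 2).add (hi.pow 2)).const_sub 1).congr_deriv ?_
      simp only [zero_smul, add_zero, Nat.cast_ofNat]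
      ring
    refine (h3.sqrt (by simpa using hs.ne')).congr_deriv ?_
    simp only [zero_smul, add_zero]
    field_simp
  have h5 : HasDerivAt (fun t : ℝ => circ (q + t • h).1)
      (h.1 • (2 * π * Complex.I * circ q.1)) 0 := by
    have := (hasDerivAt_circ q.1).scomp_of_eq (0 : ℝ) hf (by simp)
    exact this
  have h4 := (h2.ofReal_comp).mul h5
  have e : (fun t : ℝ => c2 (bookMap (q + t • h)))
      = fun t : ℝ => ((Real.sqrt (1 - ‖(q + t • h).2‖ ^ 2) : ℝ) : ℂ) * circ (q + t • h).1 := by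
    ext1 t; simp
  have h6 : HasDerivAt (fun t : ℝ => c2 (bookMap (q + t • h)))
      (c2 (fderiv ℝ bookMap q h)) 0 := by
    rw [ContinuousLinearMap.comp_apply, one_smul] at h1
    exact h1
  rw [e] at h6
  rw [h6.unique h4]
  simp
  ring

theorem tangent_fderiv_bookMap {q : ℝ × ℂ} (hq : ‖q.2‖ < 1) (h : ℝ × ℂ) :
    Tangent (bookMap q) (fderiv ℝ bookMap q h) := by
  have h1 : ∀ᶠ q' in 𝓝 q, inner ℝ (bookMap q') (bookMap q') = (1 : ℝ) := by
    filter_upwards [(isOpen_lt (continuous_norm.comp continuous_snd) continuous_const).mem_nhds hq]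
      with q' hq'
    have := bookMap_mem (le_of_lt hq')
    rw [real_inner_self_eq_norm_sq, mem_sphere_zero_iff_norm.1 this, one_pow]
  have h2 := (hasFDerivAt_bookMap hq).inner ℝ (hasFDerivAt_bookMap hq)
  have h3 := (hasFDerivAt_const (𝕜 := ℝ) (1 : ℝ) q).congr_of_eventuallyEq h1
  have h4 := congrArg (fun l : ℝ × ℂ →L[ℝ] ℝ => l h) (h2.unique h3)
  simp only [fderivInnerCLM_apply, ContinuousLinearMap.comp_apply, ContinuousLinearMap.prod_apply,
    zero_apply] at h4
  rw [real_inner_comm] at h4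
  rw [Tangent]
  rw [real_inner_comm]
  linarith

/-- The angle and page coordinates of a vector of `ℝ⁴`. -/
noncomputable def bookCoord (p : E4) : E4 →L[ℝ] ℝ × ℂ :=
  ((1 - ‖c1 p‖ ^ 2)⁻¹ • (betaL (c2 p)).comp c2).prod c1

theorem beta_mul_circ (a : ℝ) (z v : ℂ) : beta (z * circ a) (v * circ a) = beta z v := by
  rw [mul_comm z, mul_comm v, beta_circ_mul]

theorem beta_c2_fderiv_bookMap {q : ℝ × ℂ} (hq : ‖q.2‖ < 1) (h : ℝ × ℂ) :
    beta (c2 (bookMap q)) (c2 (fderiv ℝ bookMap q h)) = (1 - ‖q.2‖ ^ 2) * h.1 := by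
  have hs := one_sub_sq_pos hq
  rw [c2_fderiv_bookMap hq, c2_bookMap, beta_mul_circ]
  conv_rhs => rw [← Real.mul_self_sqrt hs.le]
  simp only [beta, Complex.ofReal_re, Complex.ofReal_im, Complex.add_im, Complex.add_re,
    Complex.mul_re, Complex.mul_im, Complex.I_re, Complex.I_im]
  field_simp
  ring

/-- Under `bookMap` the form `β ∘ c2` pulls back to `(1 - ‖x‖²) dτ`, so dividing by `1 - ‖c1‖²`
recovers `dτ`. The purpose of `bookCoord` is that it is an ambient formula, smooth wherever `‖c1‖ <
1`, and can enter the definition of a form on `ℝ⁴`. -/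
theorem bookCoord_fderiv {q : ℝ × ℂ} (hq : ‖q.2‖ < 1) (h : ℝ × ℂ) :
    bookCoord (bookMap q) (fderiv ℝ bookMap q h) = h := by
  have hs := one_sub_sq_pos hq
  ext1
  · simp only [bookCoord, ContinuousLinearMap.prod_apply, ContinuousLinearMap.comp_apply,
      smul_apply, betaL_apply, beta_c2_fderiv_bookMap hq, c1_bookMap,
      smul_eq_mul]
    field_simp
  · simp [bookCoord, c1_fderiv_bookMap hq]

theorem fderiv_bookCoord {q : ℝ × ℂ} (hq : ‖q.2‖ < 1) {v : E4} (hv : Tangent (bookMap q) v) :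
    fderiv ℝ bookMap q (bookCoord (bookMap q) v) = v := by
  have hs := one_sub_sq_pos hq
  set r := Real.sqrt (1 - ‖q.2‖ ^ 2) with hr
  have hr0 : 0 < r := Real.sqrt_pos.2 hs
  have hrr : r * r = 1 - ‖q.2‖ ^ 2 := Real.mul_self_sqrt hs.le
  have hc : ‖circ q.1‖ ^ 2 = 1 := by rw [norm_circ, one_pow]
  rw [← Complex.normSq_eq_norm_sq, Complex.normSq_apply] at hc
  rw [Tangent, inner_c, c1_bookMap, c2_bookMap] at hv
  apply E4.ext_c
  · rw [c1_fderiv_bookMap hq]; simp [bookCoord]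
  · rw [c2_fderiv_bookMap hq]
    have e1 : (bookCoord (bookMap q) v).2 = c1 v := by simp [bookCoord]
    have e2 : (bookCoord (bookMap q) v).1 = (r * r)⁻¹ * beta (r * circ q.1) (c2 v) := by
      rw [hrr]; simp [bookCoord, betaL_apply, hr]
    rw [e1, e2, ← hr]
    simp only [beta, Complex.mul_re, Complex.mul_im, Complex.ofReal_re, Complex.ofReal_im] at hv ⊢
    generalize circ q.1 = c at *
    generalize c2 v = w at *
    have e3 : q.2.re * (c1 v).re + q.2.im * (c1 v).im = - (r * (c.re * w.re + c.im * w.im)) := by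
      rw [← hr] at hv
      linarith
    rw [e3]
    apply Complex.ext
    · simp
      field_simp
      linear_combination (w.re) * hc
    · simp
      field_simp
      linear_combination (w.im) * hc

/-- In these coordinates the volume of the sphere is `2 π dτ dx dy`. The component `z` of the first
vector has no effect, being a combination of the last two vectors. -/
theorem det4_bookMap {q : ℝ × ℂ} (hq : ‖q.2‖ < 1) (z : ℂ) :
    det4 (bookMap q) (fderiv ℝ bookMap q (1, z)) (fderiv ℝ bookMap q (0, 1))
      (fderiv ℝ bookMap q (0, Complex.I)) = 2 * π := by
  have hs := one_sub_sq_pos hq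
  set r := Real.sqrt (1 - ‖q.2‖ ^ 2) with hr
  have hr0 : 0 < r := Real.sqrt_pos.2 hs
  have hrr : r ^ 2 = 1 - ‖q.2‖ ^ 2 := Real.sq_sqrt hs.le
  rw [← Complex.normSq_eq_norm_sq, Complex.normSq_apply] at hrr
  have hc : ‖circ q.1‖ ^ 2 = 1 := by rw [norm_circ, one_pow]
  rw [← Complex.normSq_eq_norm_sq, Complex.normSq_apply] at hc
  rw [det4_eq]
  simp only [← c1_re, ← c1_im, ← c2_re, ← c2_im, c1_fderiv_bookMap hq, c2_fderiv_bookMap hq,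
    c1_bookMap, c2_bookMap]
  rw [← hr]
  generalize circ q.1 = c at *
  generalize q.2 = x at *
  simp
  field_simp
  linear_combination 2 * π * r ^ 2 * ((r ^ 2 + x.re ^ 2 + x.im ^ 2) * hc + hrr)

end ContactSphere

namespace Suspension

open DiskMap ContactSphere

/-! ### The contact form on the mapping torus -/

theorem Ψ_out (D : Suspension) {τ : ℝ} {x : ℂ} (hx : D.ρ ≤ ‖x‖) :
    D.Ψ (τ, x) = circ (-(D.θ₀ * τ)) * x := by
  have h := D.ΨΦ τ (circ (-(D.θ₀ * τ)) * x)
  rwa [D.Φ_out _ _ (by rwa [norm_mul, norm_circ, one_mul]), ← mul_assoc, circ_mul_neg,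
    one_mul] at h

theorem norm_Φ_lt (D : Suspension) {τ : ℝ} {z : ℂ} (hz : ‖z‖ < 1) : ‖D.Φ (τ, z)‖ < 1 := by
  by_contra! h
  have h1 := D.ΨΦ τ z
  rw [D.Ψ_out (D.ρ_lt.le.trans h)] at h1
  rw [← h1, norm_mul, norm_circ, one_mul] at hz
  linarith

theorem norm_Ψ_lt (D : Suspension) {τ : ℝ} {x : ℂ} (hx : ‖x‖ < 1) : ‖D.Ψ (τ, x)‖ < 1 := by
  by_contra! h
  have h1 := D.ΦΨ τ x
  rw [D.Φ_out _ _ (D.ρ_lt.le.trans h)] at h1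
  rw [← h1, norm_mul, norm_circ, one_mul] at hx
  linarith

theorem Ψ_shift (D : Suspension) (τ : ℝ) (x : ℂ) :
    D.Ψ (τ - 1, x) = D.φ (D.Ψ (τ, x)) := by
  have h := D.Φ_shift (τ - 1) (D.Ψ (τ, x))
  rw [sub_add_cancel, D.ΦΨ] at h
  conv_lhs => rw [h, D.ΨΦ]

/-- The isotopy, as a self-map of `ℝ × ℂ`. -/
def twist (D : Suspension) (q : ℝ × ℂ) : ℝ × ℂ := (q.1, D.Φ q)

/-- The inverse of `twist`. -/
def untwist (D : Suspension) (q : ℝ × ℂ) : ℝ × ℂ := (q.1, D.Ψ q)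

theorem contDiff_twist (D : Suspension) : ContDiff ℝ ∞ D.twist :=
  contDiff_fst.prodMk D.Φ_smooth

theorem contDiff_untwist (D : Suspension) : ContDiff ℝ ∞ D.untwist :=
  contDiff_fst.prodMk D.Ψ_smooth

theorem untwist_twist (D : Suspension) (q : ℝ × ℂ) : D.untwist (D.twist q) = q := by
  simp [twist, untwist, D.ΨΦ]

theorem twist_untwist (D : Suspension) (q : ℝ × ℂ) : D.twist (D.untwist q) = q := by
  simp [twist, untwist, D.ΦΨ]

theorem fderiv_untwist_twist (D : Suspension) (q : ℝ × ℂ) :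
    (fderiv ℝ D.untwist (D.twist q)).comp (fderiv ℝ D.twist q)
      = ContinuousLinearMap.id ℝ (ℝ × ℂ) := by
  have h1 : HasFDerivAt D.twist (fderiv ℝ D.twist q) q :=
    (D.contDiff_twist.differentiable (by simp) q).hasFDerivAt
  have h2 : HasFDerivAt D.untwist (fderiv ℝ D.untwist (D.twist q)) (D.twist q) :=
    (D.contDiff_untwist.differentiable (by simp) _).hasFDerivAt
  have h3 := h2.comp q h1
  rw [show D.untwist ∘ D.twist = id from funext D.untwist_twist] at h3
  exact h3.unique (hasFDerivAt_id q)

theorem fderiv_twist_untwist (D : Suspension) (q : ℝ × ℂ) :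
    (fderiv ℝ D.twist q).comp (fderiv ℝ D.untwist (D.twist q))
      = ContinuousLinearMap.id ℝ (ℝ × ℂ) := by
  have h1 : HasFDerivAt D.twist (fderiv ℝ D.twist (D.untwist (D.twist q)))
      (D.untwist (D.twist q)) :=
    (D.contDiff_twist.differentiable (by simp) _).hasFDerivAt
  have h2 : HasFDerivAt D.untwist (fderiv ℝ D.untwist (D.twist q)) (D.twist q) :=
    (D.contDiff_untwist.differentiable (by simp) _).hasFDerivAt
  have h3 := h1.comp (D.twist q) h2
  rw [show D.twist ∘ D.untwist = id from funext D.twist_untwist, D.untwist_twist] at h3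
  exact h3.unique (hasFDerivAt_id _)

/-- The one-form `dS + β` on `ℝ × ℂ`. -/
noncomputable def mu (D : Suspension) (q : ℝ × ℂ) : ℝ × ℂ →L[ℝ] ℝ :=
  fderiv ℝ D.S q + (betaL q.2).comp (ContinuousLinearMap.snd ℝ ℝ ℂ)

theorem contDiff_mu (D : Suspension) : ContDiff ℝ ∞ D.mu :=
  (D.S_smooth.fderiv_right (by simp)).add
    ((betaL.contDiff.comp contDiff_snd).clm_comp contDiff_const)

theorem mu_apply (D : Suspension) (q h : ℝ × ℂ) :
    D.mu q h = fderiv ℝ D.S q h + beta q.2 h.2 := by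
  simp [mu, betaL_apply]

theorem dL_mu (D : Suspension) (q u v : ℝ × ℂ) : dL D.mu q u v = areaForm u.2 v.2 := by
  have h1 : DifferentiableAt ℝ (fderiv ℝ D.S) q :=
    (D.S_smooth.fderiv_right (m := 1) (by norm_cast)).differentiable (by simp) q
  have h2 : DifferentiableAt ℝ (fun q : ℝ × ℂ =>
      (betaL (ContinuousLinearMap.snd ℝ ℝ ℂ q)).comp (ContinuousLinearMap.snd ℝ ℝ ℂ)) q :=
    ((betaL.contDiff.comp (ContinuousLinearMap.snd ℝ ℝ ℂ).contDiff).clm_comp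
      contDiff_const (n := 1)).differentiable (by simp) q
  have h3 := dL_add h1 h2 u v
  rw [dL_fderiv D.S_smooth.contDiffAt, dL_beta, zero_add] at h3
  exact h3

theorem fderiv_S_fst (D : Suspension) (q : ℝ × ℂ) :
    0 < fderiv ℝ D.S q (1, 0) := by
  have h1 := (D.S_smooth.differentiable (by simp) q).hasFDerivAt
  have h2 : HasDerivAt (fun τ : ℝ => (τ, q.2)) ((1 : ℝ), (0 : ℂ)) q.1 :=
    (hasDerivAt_id q.1).prodMk (hasDerivAt_const q.1 q.2)
  have h3 : HasDerivAt (fun τ => D.S (τ, q.2)) (fderiv ℝ D.S q (1, 0)) q.1 :=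
    h1.comp_hasDerivAt q.1 h2
  rw [← h3.deriv]
  exact D.S_pos q.1 q.2

/-- The pushforward of `mu` by `twist`. -/
noncomputable def nu (D : Suspension) (q : ℝ × ℂ) : ℝ × ℂ →L[ℝ] ℝ :=
  (D.mu (D.untwist q)).comp (fderiv ℝ D.untwist q)

theorem contDiff_nu (D : Suspension) : ContDiff ℝ ∞ D.nu :=
  (D.contDiff_mu.comp D.contDiff_untwist).clm_comp (D.contDiff_untwist.fderiv_right (by simp))

theorem nu_twist (D : Suspension) (q : ℝ × ℂ) :
    (D.nu (D.twist q)).comp (fderiv ℝ D.twist q) = D.mu q := by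
  rw [nu, ContinuousLinearMap.comp_assoc, D.fderiv_untwist_twist, D.untwist_twist,
    ContinuousLinearMap.comp_id]

/-- Invariance of `mu` under `k (τ, z) = (τ - 1, φ z)` is the cancellation of `-df`, from `S ∘ k = S
- f`, against the `df` in `φ^*β = β + df`. The map `untwist` conjugates the translation by `-1` to
`k`, so `nu` descends to `ℝ/ℤ × D²`. -/
theorem nu_sub_one (D : Suspension) (τ : ℝ) (x : ℂ) : D.nu (τ - 1, x) = D.nu (τ, x) := by
  let k : ℝ × ℂ → ℝ × ℂ := fun q => (q.1 - 1, D.φ q.2)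
  let T : ℝ × ℂ → ℝ × ℂ := fun q => (q.1 - 1, q.2)
  have hφ : ∀ z, HasFDerivAt D.φ (fderiv ℝ D.φ z) z := fun z =>
    (D.φ_smooth.differentiable (by simp) z).hasFDerivAt
  have hf : ∀ z, HasFDerivAt D.f (fderiv ℝ D.f z) z := fun z =>
    (D.f_smooth.differentiable (by simp) z).hasFDerivAt
  have hS : ∀ q, HasFDerivAt D.S (fderiv ℝ D.S q) q := fun q =>
    (D.S_smooth.differentiable (by simp) q).hasFDerivAt
  have hk : ∀ q, HasFDerivAt k ((ContinuousLinearMap.fst ℝ ℝ ℂ).prod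
      ((fderiv ℝ D.φ q.2).comp (ContinuousLinearMap.snd ℝ ℝ ℂ))) q := fun q =>
    (hasFDerivAt_fst.sub_const 1).prodMk ((hφ q.2).comp q hasFDerivAt_snd)
  have hT : ∀ q, HasFDerivAt T (ContinuousLinearMap.id ℝ (ℝ × ℂ)) q := fun q => by
    have e : T = fun q => id q - ((1 : ℝ), (0 : ℂ)) := by
      ext1 q; simp [T, Prod.ext_iff]
    rw [e]
    exact (hasFDerivAt_id q).sub_const _
  have hU : ∀ q, HasFDerivAt D.untwist (fderiv ℝ D.untwist q) q := fun q =>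
    (D.contDiff_untwist.differentiable (by simp) q).hasFDerivAt
  have hmu : ∀ q, (D.mu (k q)).comp ((ContinuousLinearMap.fst ℝ ℝ ℂ).prod
      ((fderiv ℝ D.φ q.2).comp (ContinuousLinearMap.snd ℝ ℝ ℂ))) = D.mu q := by
    intro q
    have h1 := (hS (k q)).comp q (hk q)
    have h2 : HasFDerivAt (D.S ∘ k) (fderiv ℝ D.S q
        - (fderiv ℝ D.f q.2).comp (ContinuousLinearMap.snd ℝ ℝ ℂ)) q := by
      have e : D.S ∘ k = fun q => D.S q - D.f q.2 := by
        ext1 q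
        have := D.S_shift (q.1 - 1) q.2
        rw [sub_add_cancel] at this
        simp only [Function.comp_apply, k]
        linarith
      rw [e]
      exact (hS q).sub ((hf q.2).comp q hasFDerivAt_snd)
    have h3 := h1.unique h2
    refine ContinuousLinearMap.ext fun h => ?_
    have h4 := congrArg (fun l : ℝ × ℂ →L[ℝ] ℝ => l h) h3
    simp only [ContinuousLinearMap.comp_apply, sub_apply,
      ContinuousLinearMap.coe_snd', D.fderiv_f] at h4
    simp only [ContinuousLinearMap.comp_apply, mu_apply]
    rw [h4]
    simp [k]
    ring
  have hkU : D.untwist ∘ T = k ∘ D.untwist := by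
    ext1 q
    simp only [Function.comp_apply, untwist, T, k]
    rw [D.Ψ_shift]
  have h1 := (hU (T (τ, x))).comp (τ, x) (hT (τ, x))
  have h2 := (hk (D.untwist (τ, x))).comp (τ, x) (hU (τ, x))
  rw [hkU] at h1
  have h3 := h1.unique h2
  rw [ContinuousLinearMap.comp_id] at h3
  have h4 : D.untwist (T (τ, x)) = k (D.untwist (τ, x)) := congrFun hkU _
  calc D.nu (τ - 1, x) = (D.mu (D.untwist (T (τ, x)))).comp (fderiv ℝ D.untwist (T (τ, x))) := rfl
    _ = _ := by
      rw [h3, h4, ← ContinuousLinearMap.comp_assoc, hmu]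
      rfl

/-- Here `untwist` rotates the page by `-θ₀ τ` turns and `S = θ₀ τ`. Pulling `β` back through this
rotation produces the extra term `-θ₀ ‖x‖² dτ`. -/
theorem nu_out (D : Suspension) {τ : ℝ} {x : ℂ} (hx : D.ρ < ‖x‖) (h : ℝ × ℂ) :
    D.nu (τ, x) h = D.θ₀ * (1 - ‖x‖ ^ 2) * h.1 + beta x h.2 := by
  set c := circ (-(D.θ₀ * τ)) with hc
  have hopen : ∀ᶠ q : ℝ × ℂ in 𝓝 (τ, x), D.ρ < ‖q.2‖ :=
    (isOpen_lt continuous_const (continuous_norm.comp continuous_snd)).mem_nhds hx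
  have h1 : HasFDerivAt D.untwist (fderiv ℝ D.untwist (τ, x)) (τ, x) :=
    (D.contDiff_untwist.differentiable (by simp) _).hasFDerivAt
  have h2 := h1.comp_hasDerivAt_of_eq (0 : ℝ)
    (((hasDerivAt_id (0 : ℝ)).smul_const h).const_add (τ, x)) (by simp)
  have h3 : HasDerivAt (fun t : ℝ => D.untwist ((τ, x) + t • h))
      (h.1, (-(2 * π * D.θ₀ * h.1) * Complex.I * c) * x + c * h.2) 0 := by
    have e1 : HasDerivAt (fun t : ℝ => ((τ, x) + t • h).1) h.1 0 := by
      simpa using ((hasDerivAt_id (0 : ℝ)).mul_const h.1).const_add τ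
    have e2 : HasDerivAt (fun t : ℝ => ((τ, x) + t • h).2) h.2 0 := by
      have := ((hasDerivAt_id (0 : ℝ)).smul_const h.2).const_add x
      rw [one_smul] at this
      exact this
    have e3 : HasDerivAt (fun t : ℝ => circ (-(D.θ₀ * ((τ, x) + t • h).1)))
        ((-(D.θ₀ * h.1)) • (2 * π * Complex.I * c)) 0 := by
      have := (hasDerivAt_circ (-(D.θ₀ * τ))).scomp_of_eq (0 : ℝ)
        ((e1.const_mul D.θ₀).neg) (by simp)
      exact this
    have e4 : HasDerivAt (fun t : ℝ => (((τ, x) + t • h).1,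
        circ (-(D.θ₀ * ((τ, x) + t • h).1)) * ((τ, x) + t • h).2))
        (h.1, (-(2 * π * D.θ₀ * h.1) * Complex.I * c) * x + c * h.2) 0 := by
      refine (e1.prodMk (e3.mul e2)).congr_deriv ?_
      ext1
      · rfl
      · simp only [hc, Complex.real_smul, zero_smul, add_zero]
        push_cast
        ring
    refine e4.congr_of_eventuallyEq ?_
    have hcont : Tendsto (fun t : ℝ => (τ, x) + t • h) (𝓝 0) (𝓝 (τ, x)) := by
      have : Continuous (fun t : ℝ => (τ, x) + t • h) := by fun_prop
      simpa using this.tendsto 0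
    filter_upwards [hcont.eventually hopen] with t ht
    simp only [untwist]
    rw [← D.Ψ_out ht.le]
  have h4 : fderiv ℝ D.untwist (τ, x) h
      = (h.1, (-(2 * π * D.θ₀ * h.1) * Complex.I * c) * x + c * h.2) := by
    rw [one_smul] at h2
    exact h2.unique h3
  have h5 : fderiv ℝ D.S (D.untwist (τ, x))
      = D.θ₀ • ContinuousLinearMap.fst ℝ ℝ ℂ := by
    have e1 : D.ρ < ‖(D.untwist (τ, x)).2‖ := by
      simp only [untwist]
      rwa [D.Ψ_out hx.le, norm_mul, norm_circ, one_mul]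
    have e2 : HasFDerivAt (fun q : ℝ × ℂ => D.θ₀ * q.1) (D.θ₀ • ContinuousLinearMap.fst ℝ ℝ ℂ)
        (D.untwist (τ, x)) := hasFDerivAt_fst.const_mul D.θ₀
    refine (e2.congr_of_eventuallyEq ?_).fderiv
    filter_upwards [(isOpen_lt continuous_const (continuous_norm.comp continuous_snd)).mem_nhds e1]
      with q hq
    exact D.S_out q.1 q.2 (le_of_lt hq)
  rw [nu, ContinuousLinearMap.comp_apply, mu_apply, h4, h5]
  simp only [untwist, smul_apply, ContinuousLinearMap.coe_fst',
    smul_eq_mul]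
  rw [D.Ψ_out hx.le, ← hc, show -(2 * π * D.θ₀ * h.1) * Complex.I * c * x + c * h.2
    = c * (-(2 * π * D.θ₀ * h.1) * Complex.I * x + h.2) by ring, hc, beta_circ_mul,
    ← Complex.normSq_eq_norm_sq, Complex.normSq_apply]
  simp [beta]
  field_simp
  ring

/-- The difference of `nu` and its standard form near the boundary. -/
noncomputable def kap (D : Suspension) (q : ℝ × ℂ) : ℝ × ℂ →L[ℝ] ℝ :=
  D.nu q - ((D.θ₀ * (1 - ‖q.2‖ ^ 2)) • ContinuousLinearMap.fst ℝ ℝ ℂ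
    + (betaL q.2).comp (ContinuousLinearMap.snd ℝ ℝ ℂ))

theorem contDiff_kap (D : Suspension) : ContDiff ℝ ∞ D.kap := by
  refine D.contDiff_nu.sub (ContDiff.add ?_ ?_)
  · exact (contDiff_const.mul (contDiff_const.sub (contDiff_snd.norm_sq ℝ))).smul contDiff_const
  · exact (betaL.contDiff.comp contDiff_snd).clm_comp contDiff_const

theorem kap_out (D : Suspension) {τ : ℝ} {x : ℂ} (hx : D.ρ < ‖x‖) : D.kap (τ, x) = 0 := by
  refine ContinuousLinearMap.ext fun h => ?_
  simp [kap, D.nu_out hx, betaL_apply]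

theorem kap_sub_one (D : Suspension) (τ : ℝ) (x : ℂ) : D.kap (τ - 1, x) = D.kap (τ, x) := by
  simp only [kap, D.nu_sub_one]

/-- Periodicity in `τ` makes the choice of a branch of the angle irrelevant; in particular the jump
of `Complex.arg` does no harm. -/
theorem kap_congr (D : Suspension) {τ τ' : ℝ} (h : circ τ = circ τ') (x : ℂ) :
    D.kap (τ, x) = D.kap (τ', x) := by
  have hp : Function.Periodic (fun τ => D.kap (τ, x)) 1 := fun τ => by
    have := D.kap_sub_one (τ + 1) x
    rw [add_sub_cancel_right] at this
    exact this.symm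
  obtain ⟨n, rfl⟩ := circ_eq_circ_iff.1 h
  have := hp.int_mul n τ'
  simpa using this

/-! ### The contact form as an ambient form on `ℝ⁴`. -/

theorem c2_ne_zero {p : E4} (hp : p ∈ S3) (h : ‖c1 p‖ < 1) : c2 p ≠ 0 := by
  intro h0
  have h1 := one_sub_sq_pos h
  rw [mem_S3_iff, h0, norm_zero] at hp
  linarith

/-- The contact form on the sphere, as a field of linear functionals on `ℝ⁴`. -/
noncomputable def lamL (D : Suspension) (p : E4) : E4 →L[ℝ] ℝ :=
  D.θ₀ • (betaL (c2 p)).comp c2 + (betaL (c1 p)).comp c1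
    + (D.kap (Complex.arg (c2 p) / (2 * π), c1 p)).comp (bookCoord p)

theorem lamL_apply (D : Suspension) (p v : E4) : D.lamL p v = D.θ₀ * beta (c2 p) (c2 v)
    + beta (c1 p) (c1 v) + D.kap (Complex.arg (c2 p) / (2 * π), c1 p) (bookCoord p v) := by
  simp [lamL, betaL_apply]

theorem lamL_out (D : Suspension) {p : E4} (hp : D.ρ < ‖c1 p‖) :
    D.lamL p = D.θ₀ • (betaL (c2 p)).comp c2 + (betaL (c1 p)).comp c1 := by
  rw [lamL, D.kap_out hp, ContinuousLinearMap.zero_comp, add_zero]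

theorem contDiff_lamL_out (D : Suspension) : ContDiff ℝ ∞ fun p : E4 =>
    D.θ₀ • (betaL (c2 p)).comp c2 + (betaL (c1 p)).comp c1 :=
  ContDiff.add (f := fun p : E4 => D.θ₀ • (betaL (c2 p)).comp c2)
    (ContDiff.const_smul D.θ₀ ((betaL.contDiff.comp c2.contDiff).clm_comp contDiff_const))
    ((betaL.contDiff.comp c1.contDiff).clm_comp contDiff_const)

/-- Near the binding the `kap` term vanishes and the rest is polynomial. Elsewhere `Complex.arg` can
be replaced by a smooth local branch of the angle, by `kap_congr`. -/
theorem contDiffAt_lamL (D : Suspension) {p : E4} (hp : p ∈ S3) :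
    ContDiffAt ℝ ∞ D.lamL p := by
  rcases lt_or_ge D.ρ ‖c1 p‖ with h | h
  · refine D.contDiff_lamL_out.contDiffAt.congr_of_eventuallyEq ?_
    filter_upwards [(isOpen_lt continuous_const (c1.continuous.norm)).mem_nhds h] with q hq
    exact D.lamL_out hq
  · have h1 : 0 < 1 - ‖c1 p‖ ^ 2 := one_sub_sq_pos (h.trans_lt D.ρ_lt)
    have h2 : c2 p ≠ 0 := c2_ne_zero hp (h.trans_lt D.ρ_lt)
    obtain ⟨b, hb, hbw⟩ := exists_smooth_arg h2
    have h3 : ∀ q : E4, D.lamL q = D.θ₀ • (betaL (c2 q)).comp c2 + (betaL (c1 q)).comp c1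
        + (D.kap (if c2 q = 0 then 0 else b (c2 q), c1 q)).comp (bookCoord q) := by
      intro q
      rw [lamL]
      congr 2
      split_ifs with h0
      · simp [h0]
      · refine D.kap_congr ?_ _
        have e1 := circ_arg (c2 q)
        have e2 := hbw (c2 q)
        exact mul_left_cancel₀ (by simpa using h0) (e1.trans e2.symm)
    have h4 : ContDiffAt ℝ ∞ (fun q : E4 => bookCoord q) p := by
      have e1 : ContDiffAt ℝ ∞ (fun q : E4 => (1 - ‖c1 q‖ ^ 2)⁻¹ • (betaL (c2 q)).comp c2) p :=
        ContDiffAt.smul (ContDiffAt.inv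
          (contDiffAt_const.sub ((c1.contDiff.norm_sq ℝ).contDiffAt)) h1.ne')
          ((betaL.contDiff.comp c2.contDiff).clm_comp contDiff_const).contDiffAt
      exact (ContinuousLinearMap.prodₗᵢ ℝ (E := E4) (F := ℝ) (G := ℂ)).contDiff.contDiffAt.comp p
        (e1.prodMk contDiffAt_const)
    have h5 : ContDiffAt ℝ ∞ (fun q : E4 => D.kap (b (c2 q), c1 q)) p :=
      D.contDiff_kap.contDiffAt.comp p
        ((hb.comp p c2.contDiff.contDiffAt).prodMk c1.contDiff.contDiffAt)
    refine (D.contDiff_lamL_out.contDiffAt.add (h5.clm_comp h4)).congr_of_eventuallyEq ?_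
    filter_upwards [(isOpen_ne.preimage c2.continuous).mem_nhds h2] with q hq
    rw [h3, if_neg hq]

/-- The first two summands of `lamL` pull back to `θ₀ (1 - ‖x‖²) dτ + β`, and `kap` is by definition
what is missing from `nu`. -/
theorem lamL_bookMap (D : Suspension) {q : ℝ × ℂ} (hq : ‖q.2‖ < 1) :
    (D.lamL (bookMap q)).comp (fderiv ℝ bookMap q) = D.nu q := by
  have hs := one_sub_sq_pos hq
  have h1 : D.kap (Complex.arg (c2 (bookMap q)) / (2 * π), c1 (bookMap q)) = D.kap q := by
    rw [c1_bookMap]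
    refine D.kap_congr ?_ _
    have e1 := circ_arg (c2 (bookMap q))
    rw [norm_c2_bookMap] at e1
    rw [c2_bookMap] at e1 ⊢
    exact mul_left_cancel₀ (by simpa using (Real.sqrt_pos.2 hs).ne') e1
  refine ContinuousLinearMap.ext fun h => ?_
  rw [ContinuousLinearMap.comp_apply, lamL_apply, bookCoord_fderiv hq, h1,
    beta_c2_fderiv_bookMap hq, c1_fderiv_bookMap hq, c1_bookMap]
  simp [kap, betaL_apply]
  ring

/-! ### The mapping torus inside the sphere, and positivity of the form. -/

/-- The parametrization of the complement of the binding by the mapping torus. -/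
noncomputable def param (D : Suspension) (q : ℝ × ℂ) : E4 := bookMap (D.twist q)

theorem c1_param (D : Suspension) (q : ℝ × ℂ) : c1 (D.param q) = D.Φ q := by simp [param, twist]

theorem c2_param (D : Suspension) (q : ℝ × ℂ) :
    c2 (D.param q) = (Real.sqrt (1 - ‖D.Φ q‖ ^ 2) : ℂ) * circ q.1 := by simp [param, twist]

theorem twist_lt (D : Suspension) {q : ℝ × ℂ} (hq : ‖q.2‖ < 1) : ‖(D.twist q).2‖ < 1 :=
  D.norm_Φ_lt (τ := q.1) hq

theorem param_mem (D : Suspension) {q : ℝ × ℂ} (hq : ‖q.2‖ < 1) : D.param q ∈ S3 :=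
  bookMap_mem (D.twist_lt hq).le

theorem contDiffAt_param (D : Suspension) {q : ℝ × ℂ} (hq : ‖q.2‖ < 1) :
    ContDiffAt ℝ ∞ D.param q :=
  (contDiffAt_bookMap (D.twist_lt hq)).comp q D.contDiff_twist.contDiffAt

theorem hasFDerivAt_param (D : Suspension) {q : ℝ × ℂ} (hq : ‖q.2‖ < 1) :
    HasFDerivAt D.param (fderiv ℝ D.param q) q :=
  ((D.contDiffAt_param hq).differentiableAt (by simp)).hasFDerivAt

theorem fderiv_param (D : Suspension) {q : ℝ × ℂ} (hq : ‖q.2‖ < 1) :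
    fderiv ℝ D.param q = (fderiv ℝ bookMap (D.twist q)).comp (fderiv ℝ D.twist q) :=
  ((hasFDerivAt_bookMap (D.twist_lt hq)).comp q
    (D.contDiff_twist.differentiable (by simp) q).hasFDerivAt).fderiv

theorem tangent_param (D : Suspension) {q : ℝ × ℂ} (hq : ‖q.2‖ < 1) (h : ℝ × ℂ) :
    Tangent (D.param q) (fderiv ℝ D.param q h) := by
  rw [D.fderiv_param hq]
  exact tangent_fderiv_bookMap (D.twist_lt hq) _

theorem exists_fderiv_param (D : Suspension) {q : ℝ × ℂ} (hq : ‖q.2‖ < 1) {v : E4}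
    (hv : Tangent (D.param q) v) : ∃ h, fderiv ℝ D.param q h = v := by
  refine ⟨fderiv ℝ D.untwist (D.twist q) (bookCoord (D.param q) v), ?_⟩
  rw [D.fderiv_param hq, ContinuousLinearMap.comp_apply]
  have h1 := congrArg (fun l : ℝ × ℂ →L[ℝ] ℝ × ℂ => l (bookCoord (D.param q) v))
    (D.fderiv_twist_untwist q)
  simp only [ContinuousLinearMap.comp_apply, ContinuousLinearMap.id_apply] at h1
  rw [h1]
  exact fderiv_bookCoord (D.twist_lt hq) hv

theorem lamL_param (D : Suspension) {q : ℝ × ℂ} (hq : ‖q.2‖ < 1) (h : ℝ × ℂ) :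
    D.lamL (D.param q) (fderiv ℝ D.param q h) = D.mu q h := by
  rw [D.fderiv_param hq, ← D.nu_twist, ← D.lamL_bookMap (D.twist_lt hq)]
  rfl

theorem dL_lamL_param (D : Suspension) {q : ℝ × ℂ} (hq : ‖q.2‖ < 1) (u v : ℝ × ℂ) :
    dL D.lamL (D.param q) (fderiv ℝ D.param q u) (fderiv ℝ D.param q v)
      = areaForm u.2 v.2 := by
  rw [← dL_pullback ((D.contDiffAt_lamL (D.param_mem hq)).differentiableAt (by simp))
    (D.contDiffAt_param hq), ← D.dL_mu q]
  refine dL_congr ?_ u v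
  filter_upwards [(isOpen_lt (continuous_norm.comp continuous_snd) continuous_const).mem_nhds hq]
    with q' hq'
  refine ContinuousLinearMap.ext fun h => ?_
  exact D.lamL_param hq' h

/-- The contact form on the sphere. -/
noncomputable def lam (D : Suspension) : OneForm := toForm D.lamL

theorem lam_apply (D : Suspension) (p v : E4) : D.lam p ![v] = D.lamL p v := rfl

theorem dForm_lam (D : Suspension) {p : E4} (hp : p ∈ S3) (u v : E4) :
    dForm D.lam p u v = dL D.lamL p u v := dForm_toForm (D.contDiffAt_lamL hp) u v

theorem areaForm_zero_left (v : ℂ) : areaForm 0 v = 0 := by simp [areaForm]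

/-- The pullback of `λ ∧ dλ` is `(dS + β) ∧ ω`. On the coordinate frame only `∂_τ S · ω(1, i)`
survives, because `ω` does not involve `dτ`, and `ω(1, i) = π⁻¹`. -/
theorem density_param (D : Suspension) {q : ℝ × ℂ} (hq : ‖q.2‖ < 1) :
    contactDensity D.lam (D.param q) * det4 (D.param q) (fderiv ℝ D.param q (1, 0))
      (fderiv ℝ D.param q (0, 1)) (fderiv ℝ D.param q (0, Complex.I))
      = fderiv ℝ D.S q (1, 0) * π⁻¹ := by
  rw [← wedgeD_eq D.lam (D.param_mem hq) (D.tangent_param hq _) (D.tangent_param hq _)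
    (D.tangent_param hq _)]
  simp only [wedgeD, D.dForm_lam (D.param_mem hq), D.dL_lamL_param hq, lam_apply,
    D.lamL_param hq, areaForm_zero_left, mu_apply]
  simp [areaForm, beta]

theorem continuousOn_det4 {X : Type*} [TopologicalSpace X] {s : Set X} {F₀ F₁ F₂ F₃ : X → E4}
    (h₀ : ContinuousOn F₀ s) (h₁ : ContinuousOn F₁ s) (h₂ : ContinuousOn F₂ s)
    (h₃ : ContinuousOn F₃ s) : ContinuousOn (fun x => det4 (F₀ x) (F₁ x) (F₂ x) (F₃ x)) s := by
  simp only [det4_eq]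
  fun_prop

/-- By `density_param` the determinant never vanishes, as `∂_τ S > 0`. The open solid cylinder is
connected, and at the origin `twist` is the identity along the page, so `det4_bookMap` gives the
value `2 π` there. -/
theorem det4_param_pos (D : Suspension) {q : ℝ × ℂ} (hq : ‖q.2‖ < 1) :
    0 < det4 (D.param q) (fderiv ℝ D.param q (1, 0))
      (fderiv ℝ D.param q (0, 1)) (fderiv ℝ D.param q (0, Complex.I)) := by
  set g : ℝ × ℂ → ℝ := fun q => det4 (D.param q) (fderiv ℝ D.param q (1, 0))
      (fderiv ℝ D.param q (0, 1)) (fderiv ℝ D.param q (0, Complex.I)) with hg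
  have hU : IsOpen {q : ℝ × ℂ | ‖q.2‖ < 1} :=
    isOpen_lt (continuous_norm.comp continuous_snd) continuous_const
  have hconn : IsPreconnected {q : ℝ × ℂ | ‖q.2‖ < 1} := by
    have e : {q : ℝ × ℂ | ‖q.2‖ < 1} = univ ×ˢ ball (0 : ℂ) 1 := by
      ext q; simp
    rw [e]
    exact isPreconnected_univ.prod (convex_ball (0 : ℂ) 1).isPreconnected
  have hc0 : ContinuousOn D.param {q : ℝ × ℂ | ‖q.2‖ < 1} := fun q hq =>
    (D.contDiffAt_param hq).continuousAt.continuousWithinAt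
  have hc1 : ∀ h, ContinuousOn (fun q => fderiv ℝ D.param q h) {q : ℝ × ℂ | ‖q.2‖ < 1} :=
    fun h q hq => ContinuousAt.continuousWithinAt
      (((D.contDiffAt_param hq).fderiv_right (m := 1) (by norm_cast)).continuousAt.clm_apply
        continuousAt_const)
  have hcont : ContinuousOn g {q : ℝ × ℂ | ‖q.2‖ < 1} := by
    exact continuousOn_det4 hc0 (hc1 _) (hc1 _) (hc1 _)
  have hne : ∀ q ∈ {q : ℝ × ℂ | ‖q.2‖ < 1}, g q ≠ 0 := by
    intro q hq h0
    have h1 := D.density_param hq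
    simp only [hg] at h0
    rw [h0, mul_zero] at h1
    have := mul_pos (D.fderiv_S_fst q) (inv_pos.2 Real.pi_pos)
    linarith
  have h00 : ‖((0 : ℝ), (0 : ℂ)).2‖ < 1 := by simp
  have hpos0 : 0 < g (0, 0) := by
    have e : ∀ v : ℂ, fderiv ℝ D.twist (0, 0) (0, v) = (0, v) := by
      intro v
      have h1 : HasFDerivAt D.twist (fderiv ℝ D.twist (0, 0)) (0, 0) :=
        (D.contDiff_twist.differentiable (by simp) _).hasFDerivAt
      have h2 : HasFDerivAt (fun z : ℂ => ((0 : ℝ), z)) (ContinuousLinearMap.inr ℝ ℝ ℂ) (0 : ℂ) :=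
        (ContinuousLinearMap.inr ℝ ℝ ℂ).hasFDerivAt
      have h3 := h1.comp (0 : ℂ) h2
      have h4 : D.twist ∘ (fun z : ℂ => ((0 : ℝ), z)) = fun z : ℂ => ((0 : ℝ), z) := by
        ext1 z; simp [twist, D.Φ_zero]
      rw [h4] at h3
      have := congrArg (fun l : ℂ →L[ℝ] ℝ × ℂ => l v) (h3.unique h2)
      simpa using this
    have e0 : (fderiv ℝ D.twist (0, 0) (1, 0)).1 = 1 := by
      have h1 : HasFDerivAt D.twist (fderiv ℝ D.twist (0, 0)) (0, 0) :=
        (D.contDiff_twist.differentiable (by simp) _).hasFDerivAt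
      have h2 := (hasFDerivAt_fst (𝕜 := ℝ) (p := D.twist (0, 0))).comp _ h1
      have h3 : HasFDerivAt (Prod.fst ∘ D.twist) (ContinuousLinearMap.fst ℝ ℝ ℂ) (0, 0) :=
        hasFDerivAt_fst
      have := congrArg (fun l : ℝ × ℂ →L[ℝ] ℝ => l (1, 0)) (h2.unique h3)
      simpa using this
    simp only [hg, D.fderiv_param h00, ContinuousLinearMap.comp_apply, e, param]
    rw [show fderiv ℝ D.twist (0, 0) (1, 0) = (1, (fderiv ℝ D.twist (0, 0) (1, 0)).2) from
      Prod.ext e0 rfl, det4_bookMap (D.twist_lt h00)]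
    positivity
  by_contra! hneg
  obtain ⟨q', hq', h0⟩ := hconn.intermediate_value hq h00 hcont ⟨hneg, hpos0.le⟩
  exact hne q' hq' h0

theorem density_param_pos (D : Suspension) {q : ℝ × ℂ} (hq : ‖q.2‖ < 1) :
    0 < contactDensity D.lam (D.param q) := by
  have h1 := D.density_param hq
  have h2 := mul_pos (D.fderiv_S_fst q) (inv_pos.2 Real.pi_pos)
  rw [← h1] at h2
  exact pos_of_mul_pos_left h2 (D.det4_param_pos hq).le

theorem exists_param_eq (D : Suspension) {p : E4} (hp : p ∈ S3) (h : c2 p ≠ 0) :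
    ∃ q : ℝ × ℂ, q.1 ∈ Ico (0 : ℝ) 1 ∧ ‖q.2‖ < 1 ∧ D.param q = p := by
  set t := Int.fract (Complex.arg (c2 p) / (2 * π)) with ht
  have hlt : ‖c1 p‖ < 1 := by
    rw [mem_S3_iff] at hp
    have h1 : 0 < ‖c2 p‖ := norm_pos_iff.2 h
    have h2 := norm_nonneg (c1 p)
    nlinarith
  have hc : circ t = circ (Complex.arg (c2 p) / (2 * π)) := by
    refine circ_eq_circ_iff.2 ⟨-⌊Complex.arg (c2 p) / (2 * π)⌋, ?_⟩
    rw [ht, Int.fract]; push_cast; ring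
  refine ⟨D.untwist (t, c1 p), ⟨Int.fract_nonneg _, Int.fract_lt_one _⟩, D.norm_Ψ_lt hlt, ?_⟩
  rw [param, D.twist_untwist]
  exact bookMap_eq hp (by rw [hc, circ_arg])

theorem dL_lamL_out (D : Suspension) {p : E4} (hp : D.ρ < ‖c1 p‖) (u v : E4) :
    dL D.lamL p u v = D.θ₀ * areaForm (c2 u) (c2 v) + areaForm (c1 u) (c1 v) := by
  have h : D.lamL =ᶠ[𝓝 p] fun p => (betaL (c1 p)).comp c1 + D.θ₀ • (betaL (c2 p)).comp c2 := by
    filter_upwards [(isOpen_lt continuous_const (c1.continuous.norm)).mem_nhds hp] with q hq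
    rw [D.lamL_out hq, add_comm]
  have hd : ∀ c : E4 →L[ℝ] ℂ, DifferentiableAt ℝ (fun p => (betaL (c p)).comp c) p := fun c =>
    ((betaL.contDiff.comp c.contDiff).clm_comp contDiff_const (n := 1)).differentiable (by simp) p
  have hs : dL (fun p => D.θ₀ • (betaL (c2 p)).comp c2) p u v
      = D.θ₀ * dL (fun p => (betaL (c2 p)).comp c2) p u v := by
    simp only [dL]
    rw [show (fun p => D.θ₀ • (betaL (c2 p)).comp c2) = D.θ₀ • fun p => (betaL (c2 p)).comp c2
      from rfl, fderiv_const_smul (hd c2)]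
    simp
    ring
  rw [dL_congr h]
  refine (dL_add (hd c1) ((hd c2).const_smul D.θ₀) u v).trans ?_
  refine (congrArg₂ (· + ·) (dL_beta c1 p u v) (hs.trans (by rw [dL_beta]))).trans ?_
  ring

/-- A polynomial computation, homogenized with `‖p‖ = 1`. Multiplied by the volume `2 π²` of the
round sphere the constant gives `θ₀`, the Calabi invariant of a rotation whose action function is
`θ₀`. -/
theorem density_out (D : Suspension) {p : E4} (hp : p ∈ S3) (h : D.ρ < ‖c1 p‖) :
    contactDensity D.lam p = D.θ₀ / (2 * π ^ 2) := by
  have h1 := hp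
  rw [mem_S3_iff, ← Complex.normSq_eq_norm_sq, ← Complex.normSq_eq_norm_sq,
    Complex.normSq_apply, Complex.normSq_apply] at h1
  simp only [c1_re, c1_im, c2_re, c2_im] at h1
  simp only [contactDensity, wedgeD, D.dForm_lam hp, D.dL_lamL_out h, lam_apply, D.lamL_out h,
    add_apply, smul_apply, ContinuousLinearMap.comp_apply, betaL_apply, beta, areaForm,
    c1_re, c1_im, c2_re, c2_im, smul_eq_mul]
  simp [frameI, frameJ, frameK]
  field_simp
  linear_combination D.θ₀ * ((p 0 * p 0 + p 1 * p 1 + (p 2 * p 2 + p 3 * p 3)) + 1) * h1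

theorem isContactForm (D : Suspension) : IsContactForm D.lam where
  smooth p hp := contDiffAt_toForm (D.contDiffAt_lamL hp)
  pos p hp := by
    rcases lt_or_ge D.ρ ‖c1 p‖ with h | h
    · rw [D.density_out hp h]
      have := D.θ₀_pos
      positivity
    · have h2 : c2 p ≠ 0 := c2_ne_zero hp (h.trans_lt D.ρ_lt)
      obtain ⟨q, -, hq, rfl⟩ := D.exists_param_eq hp h2
      exact D.density_param_pos hq

end Suspension

namespace Suspension

open DiskMap ContactSphere

/-! ### The Reeb vector field and its flow -/

/-- The direction `∂_τ` lies in the kernel of `dλ = ω`, and `λ(∂_τ) = ∂_τ S`. -/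
theorem isReebVector_param (D : Suspension) {q : ℝ × ℂ} (hq : ‖q.2‖ < 1) :
    IsReebVector D.lam (D.param q) (fderiv ℝ D.param q ((fderiv ℝ D.S q (1, 0))⁻¹, 0)) where
  tangent := D.tangent_param hq _
  lam_eq := by
    have h := D.fderiv_S_fst q
    rw [lam_apply, D.lamL_param hq, mu_apply,
      show (((fderiv ℝ D.S q (1, 0))⁻¹, 0) : ℝ × ℂ) = (fderiv ℝ D.S q (1, 0))⁻¹ • (1, 0) by simp,
      map_smul, smul_eq_mul, inv_mul_cancel₀ h.ne']
    simp [beta]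
  dlam_eq w hw := by
    obtain ⟨k, rfl⟩ := D.exists_fderiv_param hq hw
    rw [D.dForm_lam (D.param_mem hq), D.dL_lamL_param hq, areaForm_zero_left]

theorem fderiv_param_of_isReebVector (D : Suspension) {q h : ℝ × ℂ} (hq : ‖q.2‖ < 1)
    (hh : IsReebVector D.lam (D.param q) (fderiv ℝ D.param q h)) :
    h.2 = 0 ∧ fderiv ℝ D.S q (1, 0) * h.1 = 1 := by
  have h1 : ∀ v : ℂ, areaForm h.2 v = 0 := fun v => by
    have := hh.dlam_eq _ (D.tangent_param hq (0, v))
    rwa [D.dForm_lam (D.param_mem hq), D.dL_lamL_param hq] at this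
  have h2 : h.2 = 0 := by
    have e1 := h1 1
    have e2 := h1 Complex.I
    simp only [areaForm, mul_eq_zero, inv_eq_zero, Real.pi_ne_zero, false_or] at e1 e2
    apply Complex.ext <;> simp at e1 e2 ⊢ <;> linarith
  refine ⟨h2, ?_⟩
  have h3 := hh.lam_eq
  rw [lam_apply, D.lamL_param hq, mu_apply, h2] at h3
  rw [show h = h.1 • ((1 : ℝ), (0 : ℂ)) by ext1 <;> simp [h2], map_smul, smul_eq_mul] at h3
  simp only [beta, Complex.zero_re, Complex.zero_im, mul_zero, sub_zero, add_zero] at h3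
  linarith

/-- The Reeb vector field near the binding. -/
noncomputable def linReeb (D : Suspension) (p : E4) : E4 :=
  ofC (2 * π * Complex.I * c1 p, 2 * π * D.θ₀⁻¹ * Complex.I * c2 p)

theorem isReebVector_out (D : Suspension) {p : E4} (hp : p ∈ S3) (h : D.ρ < ‖c1 p‖) :
    IsReebVector D.lam p (D.linReeb p) where
  tangent := by
    rw [Tangent, inner_c]
    simp [linReeb]
    ring
  lam_eq := by
    have h1 := hp
    rw [mem_S3_iff, ← Complex.normSq_eq_norm_sq, ← Complex.normSq_eq_norm_sq,
      Complex.normSq_apply, Complex.normSq_apply] at h1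
    have h2 := D.θ₀_pos
    rw [lam_apply, D.lamL_out h]
    simp only [add_apply, smul_apply, ContinuousLinearMap.comp_apply, betaL_apply, beta, linReeb,
      c1_ofC, c2_ofC, smul_eq_mul]
    generalize c1 p = z at *
    generalize c2 p = w at *
    simp
    field_simp
    linear_combination h1
  dlam_eq w hw := by
    have h2 := D.θ₀_pos
    rw [Tangent, inner_c] at hw
    rw [D.dForm_lam hp, D.dL_lamL_out h]
    simp only [linReeb, c1_ofC, c2_ofC, areaForm]
    generalize c1 p = z at *
    generalize c2 p = z' at *
    generalize c1 w = u at *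
    generalize c2 w = u' at *
    simp
    field_simp
    linear_combination (-2 : ℝ) * hw

theorem strictMono_S (D : Suspension) (z : ℂ) : StrictMono fun τ => D.S (τ, z) :=
  strictMono_of_deriv_pos (D.S_pos · z)

theorem f_pos (D : Suspension) (z : ℂ) : 0 < D.f z := by
  have h := D.S_shift 0 z
  rw [D.S_zero, zero_add, zero_add] at h
  rw [← h, ← D.S_zero z]
  exact D.strictMono_S z one_pos

theorem exists_le_f (D : Suspension) : ∃ m > 0, ∀ z, m ≤ D.f z := by
  obtain ⟨x, -, hx⟩ := (isCompact_closedBall (0 : ℂ) 1).exists_isMinOn ⟨0, by simp⟩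
    D.f_smooth.continuous.continuousOn
  refine ⟨min (D.f x) D.θ₀, lt_min (D.f_pos x) D.θ₀_pos, fun z => ?_⟩
  rcases le_or_gt ‖z‖ 1 with h | h
  · exact (min_le_left _ _).trans (hx (by simpa using h))
  · rw [D.f_out z (D.ρ_lt.le.trans h.le)]
    exact min_le_right _ _

/-- Iterating the cocycle relation accumulates `f` along the orbit. Later this identifies return
times with total actions. -/
theorem S_add_nat (D : Suspension) (n : ℕ) (τ : ℝ) (z : ℂ) :
    D.S (τ + n, z) = D.S (τ, D.φ^[n] z) + birkhoffSum D.φ D.f n z := by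
  induction n generalizing z with
  | zero => simp
  | succ n ih =>
    rw [Nat.cast_succ, ← add_assoc, D.S_shift, ih, birkhoffSum_succ', Function.iterate_succ_apply]
    ring

theorem Φ_add_nat (D : Suspension) (n : ℕ) (τ : ℝ) (z : ℂ) :
    D.Φ (τ + n, z) = D.Φ (τ, D.φ^[n] z) := by
  induction n generalizing z with
  | zero => simp
  | succ n ih =>
    rw [Nat.cast_succ, ← add_assoc, D.Φ_shift, ih, Function.iterate_succ_apply]

/-- A positive lower bound `m` of `f` forces `S (n, z) ≥ n m` and `S (-n, z) ≤ -n m`; the second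
comes from following the orbit of the preimage `φi^[n] z` up to `z`. -/
theorem surjective_S (D : Suspension) (z : ℂ) : Function.Surjective fun τ => D.S (τ, z) := by
  obtain ⟨m, hm, hf⟩ := D.exists_le_f
  have hb : ∀ n : ℕ, ∀ z, n * m ≤ birkhoffSum D.φ D.f n z := by
    intro n z
    rw [birkhoffSum, ← nsmul_eq_mul]
    calc n • m = ∑ _i ∈ Finset.range n, m := by simp
      _ ≤ _ := Finset.sum_le_sum fun i _ => hf _
  have hc : Continuous fun τ => D.S (τ, z) := D.S_smooth.continuous.comp (by fun_prop)
  have hinv : ∀ n : ℕ, D.φ^[n] (D.φi^[n] z) = z := fun n =>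
    (Function.RightInverse.iterate (f := D.φ) (g := D.φi) D.φφi n) z
  have hup : ∀ n : ℕ, n * m ≤ D.S (n, z) := fun n => by
    have := D.S_add_nat n 0 z
    rw [zero_add, D.S_zero, zero_add] at this
    rw [this]
    exact hb n z
  have hdown : ∀ n : ℕ, D.S (-n, z) ≤ -(n * m) := fun n => by
    have := D.S_add_nat n (-n) (D.φi^[n] z)
    rw [neg_add_cancel, D.S_zero, hinv] at this
    linarith [hb n (D.φi^[n] z)]
  intro y
  obtain ⟨n, hn⟩ := exists_nat_ge (|y| / m)
  rw [div_le_iff₀ hm] at hn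
  have h1 := abs_le.1 hn
  have h2 : (-n : ℝ) ≤ n := by
    have : (0 : ℝ) ≤ n := n.cast_nonneg
    linarith
  obtain ⟨τ, -, hτ⟩ := intermediate_value_Icc h2 hc.continuousOn
    (show y ∈ Icc _ _ from ⟨(hdown n).trans h1.1, h1.2.trans (hup n)⟩)
  exact ⟨τ, hτ⟩

/-- The time on the mapping torus at which the function `S` takes a given value. -/
noncomputable def time (D : Suspension) (z : ℂ) (s : ℝ) : ℝ := (D.surjective_S z s).choose

theorem S_time (D : Suspension) (z : ℂ) (s : ℝ) : D.S (D.time z s, z) = s :=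
  (D.surjective_S z s).choose_spec

theorem time_S (D : Suspension) (z : ℂ) (τ : ℝ) : D.time z (D.S (τ, z)) = τ :=
  (D.strictMono_S z).injective (D.S_time z _)

theorem time_eq_iff (D : Suspension) {z : ℂ} {s τ : ℝ} : D.time z s = τ ↔ D.S (τ, z) = s :=
  ⟨fun h => h ▸ D.S_time z s, fun h => h ▸ D.time_S z τ⟩

theorem time_zero (D : Suspension) (z : ℂ) : D.time z 0 = 0 := D.time_eq_iff.2 (D.S_zero z)

theorem strictMono_time (D : Suspension) (z : ℂ) : StrictMono (D.time z) := fun a b h => by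
  rw [← (D.strictMono_S z).lt_iff_lt]
  simpa only [D.S_time] using h

theorem hasDerivAt_S (D : Suspension) (τ : ℝ) (z : ℂ) :
    HasDerivAt (fun τ => D.S (τ, z)) (fderiv ℝ D.S (τ, z) (1, 0)) τ := by
  have h1 := (D.S_smooth.differentiable (by simp) (τ, z)).hasFDerivAt
  have h2 : HasDerivAt (fun τ : ℝ => (τ, z)) ((1 : ℝ), (0 : ℂ)) τ :=
    (hasDerivAt_id τ).prodMk (hasDerivAt_const τ z)
  exact h1.comp_hasDerivAt τ h2

theorem contDiff_time (D : Suspension) (z : ℂ) : ContDiff ℝ ∞ (D.time z) := by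
  rw [contDiff_iff_contDiffAt]
  intro s
  have h1 : ContDiff ℝ ∞ fun τ => D.S (τ, z) := D.S_smooth.comp (by fun_prop)
  have h2 := contDiffAt_of_leftInverse (g := D.time z) (n := ∞) (by simp)
    (h1.contDiffAt (x := D.time z s))
    ((D.hasDerivAt_S (D.time z s) z).hasFDerivAt_equiv (D.fderiv_S_fst (D.time z s, z)).ne')
    (Eventually.of_forall fun τ => D.time_S z τ)
  rwa [D.S_time] at h2

theorem hasDerivAt_time (D : Suspension) (z : ℂ) (s : ℝ) :
    HasDerivAt (D.time z) (fderiv ℝ D.S (D.time z s, z) (1, 0))⁻¹ s :=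
  HasDerivAt.of_local_left_inverse (D.contDiff_time z).continuous.continuousAt
    (D.hasDerivAt_S _ z) (D.fderiv_S_fst (D.time z s, z)).ne'
    (Eventually.of_forall (D.S_time z))

theorem time_out (D : Suspension) {z : ℂ} (hz : D.ρ ≤ ‖z‖) (s : ℝ) : D.time z s = s / D.θ₀ := by
  rw [D.time_eq_iff, D.S_out _ _ hz]
  have := D.θ₀_pos
  field_simp

/-- The Reeb trajectory through a point of the zeroth page. -/
noncomputable def traj (D : Suspension) (z : ℂ) (s : ℝ) : E4 := D.param (D.time z s, z)

theorem contDiff_traj (D : Suspension) {z : ℂ} (hz : ‖z‖ < 1) : ContDiff ℝ ∞ (D.traj z) := by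
  rw [contDiff_iff_contDiffAt]
  intro s
  exact (D.contDiffAt_param (q := (D.time z s, z)) hz).comp s
    ((D.contDiff_time z).contDiffAt.prodMk contDiffAt_const)

theorem hasDerivAt_traj (D : Suspension) {z : ℂ} (hz : ‖z‖ < 1) (s : ℝ) :
    HasDerivAt (D.traj z) (fderiv ℝ D.param (D.time z s, z)
      ((fderiv ℝ D.S (D.time z s, z) (1, 0))⁻¹, 0)) s :=
  (D.hasFDerivAt_param (q := (D.time z s, z)) hz).comp_hasDerivAt s
    ((D.hasDerivAt_time z s).prodMk (hasDerivAt_const s z))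

theorem reeb_traj (D : Suspension) {z : ℂ} (hz : ‖z‖ < 1) (s : ℝ) :
    IsReebVector D.lam (D.traj z s) (deriv (D.traj z) s) := by
  rw [(D.hasDerivAt_traj hz s).deriv]
  exact D.isReebVector_param (q := (D.time z s, z)) hz

theorem traj_mem (D : Suspension) {z : ℂ} (hz : ‖z‖ < 1) (s : ℝ) : D.traj z s ∈ S3 :=
  D.param_mem (q := (D.time z s, z)) hz

theorem c2_param_ne_zero (D : Suspension) {q : ℝ × ℂ} (hq : ‖q.2‖ < 1) :
    c2 (D.param q) ≠ 0 := by
  refine c2_ne_zero (D.param_mem hq) ?_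
  rw [D.c1_param]
  exact D.norm_Φ_lt (τ := q.1) hq

theorem traj_out (D : Suspension) {τ : ℝ} {z : ℂ} (hz : D.ρ ≤ ‖z‖) (t : ℝ) :
    D.traj z (D.S (τ, z) + t)
      = ofC (circ t * c1 (D.param (τ, z)), circ (t / D.θ₀) * c2 (D.param (τ, z))) := by
  have hθ := D.θ₀_pos
  have e : (D.S (τ, z) + t) / D.θ₀ = t / D.θ₀ + τ := by
    rw [D.S_out _ _ hz]; field_simp; ring
  have e2 : D.θ₀ * (t / D.θ₀ + τ) = t + D.θ₀ * τ := by field_simp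
  apply E4.ext_c
  · rw [traj, D.time_out hz, e, c1_ofC, c1_param, c1_param, D.Φ_out _ _ hz, D.Φ_out _ _ hz,
      e2, circ_add]
    ring
  · rw [traj, D.time_out hz, e, c2_ofC, c2_param, c2_param, D.Φ_out _ _ hz, D.Φ_out _ _ hz]
    simp only [norm_mul, norm_circ, one_mul, circ_add]
    ring

open Classical in
/-- The Reeb flow. -/
noncomputable def flow (D : Suspension) (t : ℝ) (p : E4) : E4 :=
  -- Off the binding the point is lifted to the mapping torus with `τ ∈ [0, 1)` and follows the
  -- trajectory through the lift; on the binding the flow is the rotation of the first coordinate.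
  if h : p ∈ S3 ∧ c2 p ≠ 0 then
    D.traj (D.exists_param_eq h.1 h.2).choose.2
      (D.S (D.exists_param_eq h.1 h.2).choose + t)
  else ofC (circ t * c1 p, 0)

theorem exists_flow_eq (D : Suspension) {p : E4} (hp : p ∈ S3) (h : c2 p ≠ 0) :
    ∃ q : ℝ × ℂ, ‖q.2‖ < 1 ∧ D.param q = p ∧ ∀ t, D.flow t p = D.traj q.2 (D.S q + t) := by
  have hc := (D.exists_param_eq hp h).choose_spec
  refine ⟨_, hc.2.1, hc.2.2, fun t => ?_⟩
  rw [flow, dif_pos ⟨hp, h⟩]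

/-- This closed formula holds on a full neighbourhood of the binding and makes the flow
differentiable in the space variable there. Elsewhere only differentiability in time is used. -/
theorem flow_out (D : Suspension) {p : E4} (hp : p ∈ S3) (h : D.ρ < ‖c1 p‖) (t : ℝ) :
    D.flow t p = ofC (circ t * c1 p, circ (t / D.θ₀) * c2 p) := by
  by_cases h2 : c2 p = 0
  · rw [flow, dif_neg (by simp [h2]), h2, mul_zero]
  · obtain ⟨q, hq, rfl, hfl⟩ := D.exists_flow_eq hp h2
    have hz : D.ρ ≤ ‖q.2‖ := by
      by_contra! hlt
      rw [D.c1_param] at h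
      have h3 := D.ΨΦ q.1 q.2
      rw [D.Ψ_out (x := D.Φ (q.1, q.2)) h.le] at h3
      rw [← h3, norm_mul, norm_circ, one_mul] at hlt
      exact absurd h hlt.not_gt
    rw [hfl, D.traj_out (τ := q.1) hz]

theorem hasDerivAt_linFlow (D : Suspension) (p : E4) (t : ℝ) :
    HasDerivAt (fun t => ofC (circ t * c1 p, circ (t / D.θ₀) * c2 p))
      (D.linReeb (ofC (circ t * c1 p, circ (t / D.θ₀) * c2 p))) t := by
  have h1 : HasDerivAt (fun t => circ t * c1 p) (2 * π * Complex.I * circ t * c1 p) t :=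
    (hasDerivAt_circ t).mul_const _
  have h2 : HasDerivAt (fun t => circ (t / D.θ₀) * c2 p)
      (((1 / D.θ₀) • (2 * π * Complex.I * circ (t / D.θ₀))) * c2 p) t :=
    ((hasDerivAt_circ (t / D.θ₀)).scomp t ((hasDerivAt_id t).div_const D.θ₀)).mul_const _
  refine ((ofC.hasFDerivAt (x := (circ t * c1 p, circ (t / D.θ₀) * c2 p))).comp_hasDerivAt t
    (h1.prodMk h2)).congr_deriv ?_
  rw [linReeb, c1_ofC, c2_ofC]
  congr 1
  ext1
  · simp only; ring
  · simp only [Complex.real_smul]; push_cast; ring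

theorem linFlow_mem {p : E4} (hp : p ∈ S3) (a b : ℝ) :
    ofC (circ a * c1 p, circ b * c2 p) ∈ S3 := by
  rw [mem_S3_iff] at hp ⊢
  simpa [norm_circ] using hp

theorem isReebFlow (D : Suspension) : IsReebFlow D.lam D.flow where
  mem_sphere t p hp := by
    by_cases h2 : c2 p = 0
    · have := linFlow_mem hp t 0
      rw [flow, dif_neg (by simp [h2])]
      rwa [h2, mul_zero] at this
    · obtain ⟨q, hq, -, hfl⟩ := D.exists_flow_eq hp h2
      rw [hfl]
      exact D.traj_mem hq _
  zero p hp := by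
    by_cases h2 : c2 p = 0
    · rw [flow, dif_neg (by simp [h2]), circ_zero, one_mul]
      conv_rhs => rw [← ofC_c p, h2]
    · obtain ⟨q, hq, hqp, hfl⟩ := D.exists_flow_eq hp h2
      rw [hfl, add_zero, traj, D.time_S q.2 q.1]
      exact hqp
  reeb t p hp := by
    by_cases h2 : c2 p = 0
    · have h1 : ‖c1 p‖ = 1 := by
        rw [mem_S3_iff, h2, norm_zero] at hp
        have := norm_nonneg (c1 p)
        nlinarith
      have hρ : D.ρ < ‖c1 p‖ := by rw [h1]; exact D.ρ_lt
      refine ⟨_, ?_, (D.hasDerivAt_linFlow p t).congr_of_eventuallyEq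
        (Eventually.of_forall fun s => D.flow_out hp hρ s)⟩
      rw [D.flow_out hp hρ]
      refine D.isReebVector_out (linFlow_mem hp _ _) ?_
      rwa [c1_ofC, norm_mul, norm_circ, one_mul]
    · obtain ⟨q, hq, -, hfl⟩ := D.exists_flow_eq hp h2
      refine ⟨deriv (D.traj q.2) (D.S q + t), ?_, ?_⟩
      · rw [hfl]
        exact D.reeb_traj hq _
      · have h3 : HasDerivAt (D.traj q.2) (deriv (D.traj q.2) (D.S q + t)) (D.S q + t) :=
          ((D.contDiff_traj hq).differentiable (by simp) _).hasDerivAt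
        exact (h3.comp_const_add (D.S q) t).congr_of_eventuallyEq
          (Eventually.of_forall fun s => hfl s)

/-! ### The binding -/

/-- The binding as a simple Reeb orbit. -/
noncomputable def bindingOrbit (D : Suspension) : SimpleReebOrbit D.lam where
  period := 1
  curve t := ofC (circ t, 0)
  period_pos := one_pos
  smooth := ofC.contDiff.comp (contDiff_circ.prodMk contDiff_const)
  mem_sphere t := by rw [mem_S3_iff]; simp [norm_circ]
  periodic t := by
    have : circ (t + 1) = circ t := circ_eq_circ_iff.2 ⟨1, by simp⟩
    simp only [this]
  reeb t := by
    have h1 := D.hasDerivAt_linFlow (ofC (1, 0)) t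
    have h2 : (fun t => ofC (circ t * c1 (ofC (1, 0)), circ (t / D.θ₀) * c2 (ofC (1, 0))))
        = fun t => ofC (circ t, 0) := by
      ext1 t; simp
    rw [h2] at h1
    rw [h1.deriv]
    simp only [c1_ofC, c2_ofC, mul_one, mul_zero]
    refine D.isReebVector_out ?_ ?_
    · rw [mem_S3_iff]; simp [norm_circ]
    · simp [norm_circ, D.ρ_lt]
  simple := by
    intro a ha b hb h
    have h1 := congrArg c1 h
    simp only [c1_ofC] at h1
    obtain ⟨n, hn⟩ := circ_eq_circ_iff.1 h1
    have h2 : (-1 : ℝ) < n := by linarith [ha.1, hb.2]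
    have h3 : (n : ℝ) < 1 := by linarith [ha.2, hb.1]
    have h4 : n = 0 := by
      have h2' : (-1 : ℤ) < n := by exact_mod_cast h2
      have h3' : n < 1 := by exact_mod_cast h3
      omega
    rw [hn, h4]; simp

theorem _root_.ContactSphere.SimpleReebOrbit.action_eq {lam : OneForm} (γ : SimpleReebOrbit lam) :
    γ.action = γ.period := by
  rw [SimpleReebOrbit.action]
  simp [fun t => (γ.reeb t).lam_eq]

/-- The norm is stationary in a tangent direction, so the normalization does not contribute. -/
theorem hasDerivAt_normalize {p v : E4} (hp : p ∈ S3) (hv : Tangent p v) :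
    HasDerivAt (fun s : ℝ => ContactSphere.normalize (p + s • v)) v 0 := by
  have h0 : ‖p‖ = 1 := by simpa using hp
  have h1 : HasDerivAt (fun s : ℝ => p + s • v) v 0 := by
    simpa using ((hasDerivAt_id (0 : ℝ)).smul_const v).const_add p
  have h2 : HasDerivAt (fun s : ℝ => ‖p + s • v‖ ^ 2) 0 0 := by
    refine h1.norm_sq.congr_deriv ?_
    simp only [zero_smul, add_zero]
    rw [hv, mul_zero]
  have h3 : HasDerivAt (fun s : ℝ => ‖p + s • v‖⁻¹) 0 0 := by
    have h4 := (h2.sqrt (by simp [h0])).inv (by simp [h0])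
    simp only [Real.sqrt_sq (norm_nonneg _)] at h4
    refine h4.congr_deriv ?_
    simp
  refine (h3.smul h1).congr_deriv ?_
  simp [h0]

/-- Near `p` the flow is the restriction of a linear map of `ℝ⁴`, which is its own derivative. -/
theorem hasTangentMap_flow (D : Suspension) {p v : E4} (hp : p ∈ S3) (h : D.ρ < ‖c1 p‖)
    (hv : Tangent p v) (t : ℝ) :
    HasTangentMap (D.flow t) p v (ofC (circ t * c1 v, circ (t / D.θ₀) * c2 v)) := by
  have h1 := hasDerivAt_normalize hp hv
  have hn0 : ContactSphere.normalize p = p := by simp [ContactSphere.normalize, show ‖p‖ = 1 by simpa using hp]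
  let L : E4 →L[ℝ] E4 := ofC.comp
    (((ContinuousLinearMap.mul ℝ ℂ (circ t)).comp c1).prod
      ((ContinuousLinearMap.mul ℝ ℂ (circ (t / D.θ₀))).comp c2))
  have h2 := L.hasFDerivAt.comp_hasDerivAt (0 : ℝ) h1
  refine HasDerivAt.congr_of_eventuallyEq h2 ?_
  have h3 : ∀ᶠ s in 𝓝 (0 : ℝ), D.ρ < ‖c1 (ContactSphere.normalize (p + s • v))‖ := by
    have hc : ContinuousAt (fun s : ℝ => ‖c1 (ContactSphere.normalize (p + s • v))‖) 0 :=
      (c1.continuous.continuousAt.comp h1.continuousAt).norm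
    refine hc.eventually_const_lt ?_
    simpa [hn0] using h
  have h4 : ∀ᶠ s in 𝓝 (0 : ℝ), p + s • v ≠ 0 := by
    have hc : ContinuousAt (fun s : ℝ => p + s • v) 0 := by fun_prop
    refine hc.eventually_ne ?_
    simp only [zero_smul, add_zero]
    intro h0
    simp [h0] at hp
  filter_upwards [h3, h4] with s hs hs0
  rw [D.flow_out _ hs]
  · rfl
  · rw [mem_sphere_zero_iff_norm, ContactSphere.normalize, norm_smul, norm_inv, norm_norm,
      inv_mul_cancel₀ (norm_ne_zero_iff.2 hs0)]

/-- A symplectic frame of the contact structure along the binding. -/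
noncomputable def bindingFrame (D : Suspension) (w : ℂ) : E4 :=
  -- On the plane normal to the binding `dλ` is `θ₀ / π` times the Euclidean area, so this factor
  -- makes the frame symplectic.
  ofC (0, (Real.sqrt (π / D.θ₀) : ℂ) * w)

theorem tangent_bindingFrame (D : Suspension) (a : ℝ) (w : ℂ) :
    Tangent (ofC (circ a, 0)) (D.bindingFrame w) := by
  rw [Tangent, inner_c]
  simp [bindingFrame]

theorem isSymplecticBasis_binding (D : Suspension) (t : ℝ) :
    IsSymplecticBasis D.lam (D.bindingOrbit.curve t) (D.bindingFrame 1)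
      (D.bindingFrame Complex.I) := by
  have hρ : D.ρ < ‖c1 (ofC (circ t, 0))‖ := by simp [norm_circ, D.ρ_lt]
  have hp : ofC (circ t, 0) ∈ S3 := D.bindingOrbit.mem_sphere t
  have hl : ∀ w, D.lam (ofC (circ t, 0)) ![D.bindingFrame w] = 0 := fun w => by
    rw [lam_apply, D.lamL_out hρ]
    simp [bindingFrame, betaL_apply, beta]
  refine ⟨⟨D.tangent_bindingFrame t 1, hl _⟩, ⟨D.tangent_bindingFrame t _, hl _⟩, ?_⟩
  have hθ := D.θ₀_pos
  change dForm D.lam (ofC (circ t, 0)) _ _ = 1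
  rw [D.dForm_lam hp, D.dL_lamL_out hρ]
  have h1 : Real.sqrt (π / D.θ₀) * Real.sqrt (π / D.θ₀) = π / D.θ₀ :=
    Real.mul_self_sqrt (by positivity)
  simp only [bindingFrame, c1_ofC, c2_ofC, areaForm]
  simp [h1]
  field_simp

theorem isRotationIn_binding (D : Suspension) (t : ℝ) :
    IsRotationIn (D.flow t) (D.bindingOrbit.curve 0) (D.bindingFrame 1) (D.bindingFrame Complex.I)
      (D.bindingFrame 1) (D.bindingFrame Complex.I) (2 * π * (t / D.θ₀)) := by
  intro a b
  have hp : ofC (circ 0, 0) ∈ S3 := D.bindingOrbit.mem_sphere 0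
  have hρ : D.ρ < ‖c1 (ofC (circ 0, 0))‖ := by simp [norm_circ, D.ρ_lt]
  have h := D.hasTangentMap_flow hp hρ (((D.tangent_bindingFrame 0 1).smul a).add
    ((D.tangent_bindingFrame 0 Complex.I).smul b)) t
  have e : ofC (circ t * c1 (a • D.bindingFrame 1 + b • D.bindingFrame Complex.I),
      circ (t / D.θ₀) * c2 (a • D.bindingFrame 1 + b • D.bindingFrame Complex.I))
      = (a * Real.cos (2 * π * (t / D.θ₀)) - b * Real.sin (2 * π * (t / D.θ₀)))
        • D.bindingFrame 1 + (a * Real.sin (2 * π * (t / D.θ₀))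
        + b * Real.cos (2 * π * (t / D.θ₀))) • D.bindingFrame Complex.I := by
    have hc : circ (t / D.θ₀) = Real.cos (2 * π * (t / D.θ₀))
        + Real.sin (2 * π * (t / D.θ₀)) * Complex.I := by
      rw [circ, Complex.ofReal_cos, Complex.ofReal_sin, ← Complex.exp_mul_I]
      push_cast
      rfl
    apply E4.ext_c
    · simp [bindingFrame]
    · rw [c2_ofC, hc]
      simp only [bindingFrame, map_add, map_smul, c2_ofC, Complex.real_smul]
      push_cast
      linear_combination ((b : ℂ) * Complex.sin (2 * π * (t / D.θ₀))
        * Real.sqrt (π / D.θ₀)) * Complex.I_sq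
  rw [e] at h
  exact h

theorem isElliptic_binding (D : Suspension) : D.bindingOrbit.IsElliptic :=
  ⟨D.flow, D.isReebFlow, D.bindingFrame 1, D.bindingFrame Complex.I, _,
    D.isSymplecticBasis_binding 0, D.isRotationIn_binding 1⟩

theorem contDiffOn_page (τ : ℝ) : ContDiffOn ℝ ∞ (fun z => bookMap (τ, z)) (ball 0 1) :=
  fun z hz => ((contDiffAt_bookMap (q := (τ, z)) (by simpa using hz)).comp z
    (contDiffAt_const.prodMk contDiffAt_id)).contDiffWithinAt

theorem continuous_bookMap : Continuous bookMap := by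
  have := contDiff_circ.continuous
  unfold bookMap
  fun_prop

theorem bookMap_circ (τ s : ℝ) : bookMap (τ, circ s) = ofC (circ s, 0) := by
  simp [bookMap, norm_circ]

theorem mapsTo_page (τ : ℝ) : MapsTo (fun z => bookMap (τ, z)) disk S3 := fun z hz =>
  bookMap_mem (by simpa using hz)

/-- The pushoff of the binding by any positive real multiple of the frame is unlinked from it:
it does not meet the page at angle `π`. -/
theorem hasLinkingNumber_pushoff (D : Suspension) {ε : ℝ} (hε : 0 < ε) :
    HasLinkingNumber D.bindingOrbit.period
      (fun t => ContactSphere.normalize (D.bindingOrbit.curve t + ε • D.bindingFrame 1))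
      D.bindingOrbit.period D.bindingOrbit.curve 0 := by
  have hθ := D.θ₀_pos
  set k := Real.sqrt (π / D.θ₀) with hk
  have hk0 : 0 < k := Real.sqrt_pos.2 (by positivity)
  have hne : ∀ t, ofC (circ t, 0) + ε • D.bindingFrame 1 ≠ 0 := fun t h0 => by
    have := congrArg c1 h0
    simp [bindingFrame, circ_ne_zero] at this
  have hre : ∀ t, 0 < (c2 (ContactSphere.normalize
      (D.bindingOrbit.curve t + ε • D.bindingFrame 1))).re := by
    intro t
    change 0 < (c2 (ContactSphere.normalize (ofC (circ t, 0) + ε • D.bindingFrame 1))).re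
    have h1 := norm_pos_iff.2 (hne t)
    have h2 : (c2 (ofC (circ t, 0) + ε • D.bindingFrame 1)).re = ε * k := by
      simp [bindingFrame, ← hk]
    rw [ContactSphere.normalize, map_smul, Complex.smul_re, h2, smul_eq_mul]
    positivity
  refine ⟨fun s t h => ?_, fun z => bookMap (1 / 2, z), mapsTo_page _,
    (continuous_bookMap.comp (by fun_prop)).continuousOn, contDiffOn_page _, fun s => ?_, ∅,
    fun q => ?_, by simp, by simp⟩
  · have h1 := hre s
    simp only [h] at h1
    simp [bindingOrbit] at h1
  · simp only [bookMap_circ]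
    simp [bindingOrbit]
  · simp only [Finset.notMem_empty, false_iff, not_and]
    intro _ _ h
    have h1 := hre q.1
    rw [← h, c2_bookMap] at h1
    have h2 : circ (1 / 2) = -1 := by
      rw [circ, show (2 * π * ((1 / 2 : ℝ) : ℂ) * Complex.I) = π * Complex.I by push_cast; ring,
        Complex.exp_pi_mul_I]
    rw [h2] at h1
    simp at h1
    linarith [Real.sqrt_nonneg (1 - ‖q.2‖ ^ 2)]

theorem hasRotationNumber_binding (D : Suspension) :
    D.bindingOrbit.HasRotationNumber D.θ₀⁻¹ := by
  refine ⟨fun _ => D.bindingFrame 1, fun _ => D.bindingFrame Complex.I, contDiff_const,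
    contDiff_const, fun _ => rfl, fun _ => rfl, D.isSymplecticBasis_binding,
    ⟨2, two_pos, fun ε hε _ => ?_⟩, D.flow, D.isReebFlow, fun t => t / D.θ₀,
    by fun_prop, by simp, fun t _ => D.isRotationIn_binding t, by simp [bindingOrbit]⟩
  -- In `HasRotationNumber` the variable `ε` elaborates as a natural number, hence the casts, and
  -- the bound `2` leaves only `ε = 1`. The pushoff lemma itself covers every positive real `ε`.
  have := D.hasLinkingNumber_pushoff (ε := ε) (by exact_mod_cast hε)
  simpa only [Nat.cast_smul_eq_nsmul] using this

end Suspension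

namespace ContactSphere

open DiskMap

/-! ### The standard open book -/

/-- The exchange of the two complex coordinates. -/
noncomputable def swapC : E4 →L[ℝ] E4 := ofC.comp (c2.prod c1)

theorem det4_swapC (p u v w : E4) :
    det4 (swapC p) (swapC u) (swapC v) (swapC w) = det4 p u v w := by
  simp only [det4_eq, swapC, ContinuousLinearMap.comp_apply, ContinuousLinearMap.prod_apply,
    ofC_zero, ofC_one, ofC_two, ofC_three, c1_re, c1_im, c2_re, c2_im]
  ring

/-- The standard open book decomposition of the sphere, with trivial monodromy. -/
noncomputable def standardBook : DiskOpenBook where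
  ψ := id
  diffeo := ⟨mapsTo_id _, contDiffOn_id, id, mapsTo_id _, contDiffOn_id, fun _ _ => rfl,
    fun _ _ => rfl⟩
  eq_id := ⟨1, one_pos, fun _ _ _ => rfl⟩
  Q := bookMap
  shift t x _ := by
    have : circ (t + 1) = circ t := circ_eq_circ_iff.2 ⟨1, by simp⟩
    simp [bookMap, this]
  collapse t t' x hx := by simp [bookMap, hx]
  mem_sphere t x hx := bookMap_mem (by simpa using hx)
  surj p hp := by
    refine ⟨Int.fract (Complex.arg (c2 p) / (2 * π)), ⟨Int.fract_nonneg _, Int.fract_lt_one _⟩,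
      c1 p, ?_, bookMap_eq hp ?_⟩
    · rw [mem_S3_iff] at hp
      rw [mem_closedBall_zero_iff]
      have := norm_nonneg (c1 p)
      nlinarith [sq_nonneg ‖c2 p‖]
    · have hc : circ (Int.fract (Complex.arg (c2 p) / (2 * π)))
          = circ (Complex.arg (c2 p) / (2 * π)) := by
        refine circ_eq_circ_iff.2 ⟨-⌊Complex.arg (c2 p) / (2 * π)⌋, ?_⟩
        rw [Int.fract]; push_cast; ring
      rw [hc, circ_arg]
  inj t ht t' ht' x hx x' _ h := by
    have h1 := congrArg c1 h
    have h2 := congrArg c2 h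
    simp only [c1_bookMap, c2_bookMap] at h1 h2
    refine ⟨h1, ?_⟩
    rw [← h1] at h2
    rcases (mem_closedBall_zero_iff.1 hx).lt_or_eq with h3 | h3
    · left
      have h4 : (Real.sqrt (1 - ‖x‖ ^ 2) : ℂ) ≠ 0 := by
        simpa using (Real.sqrt_pos.2 (one_sub_sq_pos h3)).ne'
      obtain ⟨n, hn⟩ := circ_eq_circ_iff.1 (mul_left_cancel₀ h4 h2)
      have h5 : (-1 : ℝ) < n := by linarith [ht.1, ht'.2]
      have h6 : (n : ℝ) < 1 := by linarith [ht.2, ht'.1]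
      have h7 : n = 0 := by
        have h5' : (-1 : ℤ) < n := by exact_mod_cast h5
        have h6' : n < 1 := by exact_mod_cast h6
        omega
      rw [hn, h7]; simp
    · exact Or.inr h3
  smooth_interior q hq := (contDiffAt_bookMap (by simpa using hq.2)).contDiffWithinAt
  oriented_interior t x hx := by
    rw [det4_bookMap (q := (t, x)) (by simpa using hx)]
    positivity
  near_binding := by
    have hs : ∀ q : ℝ × ℂ, ‖q.2‖ < 1 →
        fderiv ℝ (fun q => swapC (bookMap q)) q = swapC.comp (fderiv ℝ bookMap q) := fun q hq =>
      (swapC.hasFDerivAt.comp q (hasFDerivAt_bookMap hq)).fderiv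
    -- In `S³` the page coordinate and the normal coordinate of the binding play symmetric roles:
    -- the chart along the binding is `bookMap` followed by the exchange of the two complex
    -- coordinates, which has determinant `1`.
    refine ⟨1, one_pos, le_rfl, fun q => swapC (bookMap q), fun q hq => ?_, fun σ t r h0 h1 => ?_,
      fun σ w hw => ?_⟩
    · exact (swapC.contDiff.contDiffAt.comp q
        (contDiffAt_bookMap (by simpa using hq.2))).contDiffWithinAt
    · have e : 0 ≤ 1 - r ^ 2 := by nlinarith
      have e1 : ‖(r : ℂ) * circ t‖ = r := by
        rw [norm_mul, norm_circ, Complex.norm_real, Real.norm_of_nonneg h0, mul_one]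
      have e2 : ‖(Real.sqrt (1 - r ^ 2) : ℂ) * circ σ‖ ^ 2 = 1 - r ^ 2 := by
        rw [norm_mul, norm_circ, Complex.norm_real, Real.norm_of_nonneg (Real.sqrt_nonneg _),
          mul_one, Real.sq_sqrt e]
      apply E4.ext_c
      · simp only [swapC, ContinuousLinearMap.comp_apply, ContinuousLinearMap.prod_apply, c1_ofC,
          c2_bookMap, c1_bookMap, e1]
      · simp only [swapC, ContinuousLinearMap.comp_apply, ContinuousLinearMap.prod_apply, c2_ofC,
          c1_bookMap, c2_bookMap, e2, sub_sub_cancel, Real.sqrt_sq h0]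
    · rw [hs _ (by simpa using hw)]
      simp only [ContinuousLinearMap.comp_apply]
      rw [det4_swapC, det4_bookMap (q := (σ, w)) (by simpa using hw)]
      positivity

theorem det4_smul_two (c : ℝ) (p u v w : E4) : det4 p (c • u) v w = c * det4 p u v w := by
  simp only [det4_eq, PiLp.smul_apply, smul_eq_mul]
  ring

end ContactSphere

/-! ### Compatibility of the contact form with the open book. -/

namespace Suspension

open DiskMap ContactSphere

theorem fderiv_twist_fst (D : Suspension) (q h : ℝ × ℂ) : (fderiv ℝ D.twist q h).1 = h.1 := by
  have h1 : HasFDerivAt D.twist (fderiv ℝ D.twist q) q :=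
    (D.contDiff_twist.differentiable (by simp) _).hasFDerivAt
  have h2 := (hasFDerivAt_fst (𝕜 := ℝ) (p := D.twist q)).comp _ h1
  have h3 : HasFDerivAt (Prod.fst ∘ D.twist) (ContinuousLinearMap.fst ℝ ℝ ℂ) q :=
    hasFDerivAt_fst
  have := congrArg (fun l : ℝ × ℂ →L[ℝ] ℝ => l h) (h2.unique h3)
  simpa using this

/-- The Reeb vector field is positively transverse to the pages. -/
theorem det4_reeb_pos (D : Suspension) {q : ℝ × ℂ} (hq : ‖q.2‖ < 1) {c : ℝ} (hc : 0 < c) :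
    0 < det4 (D.param q) (fderiv ℝ D.param q (c, 0)) (fderiv ℝ bookMap (D.twist q) (0, 1))
      (fderiv ℝ bookMap (D.twist q) (0, Complex.I)) := by
  rw [show ((c, 0) : ℝ × ℂ) = c • ((1 : ℝ), (0 : ℂ)) by simp, map_smul, det4_smul_two,
    D.fderiv_param hq, ContinuousLinearMap.comp_apply,
    show fderiv ℝ D.twist q (1, 0) = (1, (fderiv ℝ D.twist q (1, 0)).2) from
      Prod.ext (D.fderiv_twist_fst _ _) rfl, param, det4_bookMap (D.twist_lt hq)]
  positivity

theorem range_bindingOrbit (D : Suspension) :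
    range D.bindingOrbit.curve = standardBook.binding := by
  ext p
  constructor
  · rintro ⟨t, rfl⟩
    exact ⟨circ t, by simp [norm_circ], bookMap_circ 0 t⟩
  · rintro ⟨x, hx, rfl⟩
    refine ⟨Complex.arg x / (2 * π), ?_⟩
    have h1 := circ_arg x
    rw [mem_sphere_zero_iff_norm.1 hx, Complex.ofReal_one, one_mul] at h1
    change ofC (circ _, 0) = bookMap (0, x)
    rw [← bookMap_circ 0, h1]

theorem isCompatible (D : Suspension) : standardBook.IsCompatible D.lam where
  transverse t x hx v hv := by
    rw [mem_ball_zero_iff] at hx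
    set q := D.untwist (t, x) with hq
    have hqx : D.twist q = (t, x) := D.twist_untwist _
    have hq1 : ‖q.2‖ < 1 := D.norm_Ψ_lt hx
    have e : standardBook.Q (t, x) = D.param q := by rw [param, hqx]; rfl
    have hvu : v = _ := IsReebVector.unique (D.param_mem hq1)
      (D.density_param_pos hq1).ne' (e ▸ hv) (D.isReebVector_param hq1)
    have h := D.det4_reeb_pos hq1 (inv_pos.2 (D.fderiv_S_fst q))
    rw [← hvu, hqx, ← e] at h
    exact h
  tangent s v hv := by
    have e : (fun s => standardBook.Q (0, circ s)) = D.bindingOrbit.curve :=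
      funext fun s => bookMap_circ 0 s
    have hv' : IsReebVector D.lam (D.bindingOrbit.curve s) v := by
      rw [← e]; exact hv
    refine ⟨1, ?_⟩
    rw [e, one_smul]
    exact hv'.unique (D.bindingOrbit.mem_sphere s)
      (D.isContactForm.pos _ (D.bindingOrbit.mem_sphere s)).ne' (D.bindingOrbit.reeb s)

/-! ### The Reeb orbits -/

theorem param_add_nat (D : Suspension) (n : ℕ) (τ : ℝ) (z : ℂ) :
    D.param (τ + n, z) = D.param (τ, D.φ^[n] z) := by
  have : circ (τ + n) = circ τ := circ_eq_circ_iff.2 ⟨n, by simp⟩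
  apply E4.ext_c
  · rw [c1_param, c1_param, D.Φ_add_nat]
  · rw [c2_param, c2_param, D.Φ_add_nat, this]

/-- The fibres of `param` are the orbits of the deck group. The order `τ' ≤ τ` makes the deck
transformation a nonnegative iterate of `φ`. -/
theorem exists_nat_of_param_eq (D : Suspension) {τ τ' : ℝ} {z z' : ℂ} (hz : ‖z‖ < 1)
    (hle : τ' ≤ τ) (h : D.param (τ, z) = D.param (τ', z')) :
    ∃ n : ℕ, τ = τ' + n ∧ D.φ^[n] z = z' := by
  have h1 := congrArg c1 h
  have h2 := congrArg c2 h
  rw [c1_param, c1_param] at h1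
  rw [c2_param, c2_param, ← h1] at h2
  have h3 : (Real.sqrt (1 - ‖D.Φ (τ, z)‖ ^ 2) : ℂ) ≠ 0 := by
    simpa using (Real.sqrt_pos.2 (one_sub_sq_pos (D.norm_Φ_lt (τ := τ) hz))).ne'
  obtain ⟨n, hn⟩ := circ_eq_circ_iff.1 (mul_left_cancel₀ h3 h2)
  have h4 : 0 ≤ n := by
    have : (0 : ℝ) ≤ n := by simp only at hn; linarith
    exact_mod_cast this
  lift n to ℕ using h4
  have hn' : τ = τ' + n := by simpa using hn
  refine ⟨n, hn', ?_⟩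
  rw [hn', D.Φ_add_nat] at h1
  rw [← D.ΨΦ τ' (D.φ^[n] z), h1, D.ΨΦ]

theorem time_add_birkhoffSum (D : Suspension) (n : ℕ) (s : ℝ) (z : ℂ) :
    D.time z (s + birkhoffSum D.φ D.f n z) = D.time (D.φ^[n] z) s + n := by
  rw [D.time_eq_iff, D.S_add_nat, D.S_time]

theorem traj_add_birkhoffSum (D : Suspension) (n : ℕ) (s : ℝ) (z : ℂ) :
    D.traj z (s + birkhoffSum D.φ D.f n z) = D.traj (D.φ^[n] z) s := by
  rw [traj, D.time_add_birkhoffSum, D.param_add_nat, traj]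

/-- A trajectory returns to one of its points only through a periodic point of `φ`, after a time
equal to the sum of `f` over the corresponding iterates. -/
theorem exists_nat_of_traj_eq (D : Suspension) {s s' : ℝ} {z : ℂ} (hz : ‖z‖ < 1)
    (hle : s' ≤ s) (h : D.traj z s = D.traj z s') :
    ∃ n : ℕ, D.φ^[n] z = z ∧ s = s' + birkhoffSum D.φ D.f n z := by
  obtain ⟨n, hn, hnz⟩ := D.exists_nat_of_param_eq hz ((D.strictMono_time z).monotone hle) h
  refine ⟨n, hnz, ?_⟩
  rw [D.time_eq_iff, D.S_add_nat, hnz, D.S_time] at hn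
  exact hn.symm

theorem birkhoffSum_pos (D : Suspension) {n : ℕ} (hn : 0 < n) (z : ℂ) :
    0 < birkhoffSum D.φ D.f n z :=
  Finset.sum_pos (fun _ _ => D.f_pos _) ⟨0, by simpa using hn⟩

theorem birkhoffSum_strictMono (D : Suspension) (z : ℂ) :
    StrictMono fun n => birkhoffSum D.φ D.f n z :=
  strictMono_nat_of_lt_succ fun n => by
    rw [birkhoffSum_succ]
    linarith [D.f_pos (D.φ^[n] z)]

/-- The simple Reeb orbit of a periodic point of `φ`. -/
noncomputable def orbit (D : Suspension) (z : ℂ) (hz : ‖z‖ < 1)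
    (hp : z ∈ Function.periodicPts D.φ) : SimpleReebOrbit D.lam where
  period := birkhoffSum D.φ D.f (Function.minimalPeriod D.φ z) z
  curve := D.traj z
  period_pos := D.birkhoffSum_pos (Function.minimalPeriod_pos_of_mem_periodicPts hp) z
  smooth := D.contDiff_traj hz
  mem_sphere := D.traj_mem hz
  periodic s := by
    rw [D.traj_add_birkhoffSum, Function.iterate_minimalPeriod]
  reeb := D.reeb_traj hz
  simple := by
    -- Two coinciding times differ by the sum of `f` over `n` iterates with `φ^[n] z = z`; being
    -- shorter than the sum over the minimal period, it forces `n = 0`.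
    have key : ∀ s ∈ Ico 0 (birkhoffSum D.φ D.f (Function.minimalPeriod D.φ z) z),
        ∀ s' ∈ Ico 0 (birkhoffSum D.φ D.f (Function.minimalPeriod D.φ z) z),
        s' ≤ s → D.traj z s = D.traj z s' → s = s' := by
      intro s hs s' hs' hle h
      obtain ⟨n, hn, e⟩ := D.exists_nat_of_traj_eq hz hle h
      have h1 : birkhoffSum D.φ D.f n z
          < birkhoffSum D.φ D.f (Function.minimalPeriod D.φ z) z := by
        linarith [hs.2, hs'.1]
      have h2 := (D.birkhoffSum_strictMono z).lt_iff_lt.1 h1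
      have h3 : n = 0 := by
        by_contra h0
        have := Function.IsPeriodicPt.minimalPeriod_le (Nat.pos_of_ne_zero h0)
          (show Function.IsPeriodicPt D.φ n z from hn)
        omega
      rw [e, h3, birkhoffSum_zero, add_zero]
    intro s hs s' hs' h
    rcases le_total s' s with hle | hle
    · exact key s hs s' hs' hle h
    · exact (key s' hs' s hs hle h.symm).symm

/-- A smooth nonvanishing curve in the plane has a smooth argument. -/
theorem exists_smooth_lift {w : ℝ → ℂ} (hw : ContDiff ℝ ∞ w) (hne : ∀ t, w t ≠ 0) :
    ∃ b : ℝ → ℝ, Differentiable ℝ b ∧ ∀ t, (‖w t‖ : ℂ) * circ (b t) = w t := by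
  have hd : ContDiff ℝ ∞ (deriv w) := (contDiff_infty_iff_deriv.1 hw).2
  have hc : Continuous fun t => deriv w t / w t :=
    hd.continuous.div₀ hw.continuous hne
  set g : ℝ → ℂ := fun t => Complex.log (w 0) + ∫ s in (0 : ℝ)..t, deriv w s / w s with hg
  have hgd : ∀ t, HasDerivAt g (deriv w t / w t) t := fun t =>
    (intervalIntegral.integral_hasDerivAt_right (hc.intervalIntegrable _ _)
      (hc.stronglyMeasurableAtFilter _ _) hc.continuousAt).const_add _
  have hwd : ∀ t, HasDerivAt w (deriv w t) t := fun t =>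
    (hw.differentiable (by simp) t).hasDerivAt
  have hconst : ∀ t, w t * Complex.exp (-g t) = 1 := by
    have hF : ∀ t, HasDerivAt (fun t => w t * Complex.exp (-g t)) 0 t := fun t => by
      refine ((hwd t).mul (hgd t).neg.cexp).congr_deriv ?_
      have := hne t
      field_simp
      ring
    intro t
    have h1 := is_const_of_deriv_eq_zero (fun t => (hF t).differentiableAt)
      (fun t => (hF t).deriv) t 0
    rw [h1]
    simp only [hg, intervalIntegral.integral_same, add_zero, Complex.exp_neg,
      Complex.exp_log (hne 0)]
    exact mul_inv_cancel₀ (hne 0)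
  have hexp : ∀ t, Complex.exp (g t) = w t := fun t => by
    have h1 := hconst t
    rw [Complex.exp_neg] at h1
    have h2 := Complex.exp_ne_zero (g t)
    field_simp at h1
    exact h1.symm
  refine ⟨fun t => (g t).im / (2 * π), fun t => ?_, fun t => ?_⟩
  · exact ((Complex.imCLM.hasFDerivAt.comp_hasDerivAt t (hgd t)).differentiableAt).div_const _
  · have h1 : (2 * π * (((g t).im / (2 * π) : ℝ) : ℂ) * Complex.I : ℂ) = (g t).im * Complex.I := by
      push_cast
      field_simp
    rw [circ, h1, ← hexp t, Complex.norm_exp, Complex.ofReal_exp, ← Complex.exp_add,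
      Complex.re_add_im]

/-- A Reeb orbit which avoids the binding is a trajectory through the zeroth page. -/
theorem exists_eq_traj (D : Suspension) (γ : SimpleReebOrbit D.lam)
    (hne : ∀ t, c2 (γ.curve t) ≠ 0) :
    ∃ z c, ‖z‖ < 1 ∧ ∀ t, γ.curve t = D.traj z (t + c) := by
  have hw : ContDiff ℝ ∞ fun t => c2 (γ.curve t) := c2.contDiff.comp γ.smooth
  obtain ⟨b, hb, hbw⟩ := exists_smooth_lift hw hne
  have hlt : ∀ t, ‖c1 (γ.curve t)‖ < 1 := fun t => by
    have h1 := mem_S3_iff.1 (γ.mem_sphere t)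
    have h2 : 0 < ‖c2 (γ.curve t)‖ := norm_pos_iff.2 (hne t)
    have := norm_nonneg (c1 (γ.curve t))
    nlinarith
  set q : ℝ → ℝ × ℂ := fun t => D.untwist (b t, c1 (γ.curve t)) with hq
  have hqlt : ∀ t, ‖(q t).2‖ < 1 := fun t => D.norm_Ψ_lt (hlt t)
  have hpq : ∀ t, D.param (q t) = γ.curve t := fun t => by
    rw [param, hq, D.twist_untwist]
    exact bookMap_eq (γ.mem_sphere t) (hbw t)
  have hγd : ∀ t, HasDerivAt γ.curve (deriv γ.curve t) t := fun t =>
    (γ.smooth.differentiable (by simp) t).hasDerivAt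
  have hqd : Differentiable ℝ q := (D.contDiff_untwist.differentiable (by simp)).comp
    (hb.prodMk (c1.differentiable.comp (γ.smooth.differentiable (by simp))))
  have hqd' : ∀ t, HasDerivAt q (deriv q t) t := fun t => (hqd t).hasDerivAt
  -- For the lift `q = (τ, z)` the Reeb equation reads `z' = 0` and `∂_τ S · τ' = 1`: the point `z`
  -- is constant, and `S` increases at unit speed.
  have hR : ∀ t, (deriv q t).2 = 0 ∧ fderiv ℝ D.S (q t) (1, 0) * (deriv q t).1 = 1 := by
    intro t
    have h1 := (D.hasFDerivAt_param (hqlt t)).comp_hasDerivAt t (hqd' t)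
    rw [show D.param ∘ q = γ.curve from funext hpq] at h1
    refine D.fderiv_param_of_isReebVector (hqlt t) ?_
    rw [h1.unique (hγd t), hpq]
    exact γ.reeb t
  have hz : ∀ t, (q t).2 = (q 0).2 := fun t => by
    have h1 : ∀ t, HasDerivAt (fun t => (q t).2) 0 t := fun t => by
      have := (hasFDerivAt_snd (𝕜 := ℝ) (p := q t)).comp_hasDerivAt t (hqd' t)
      rw [← (hR t).1]
      exact this
    exact is_const_of_deriv_eq_zero (fun t => (h1 t).differentiableAt) (fun t => (h1 t).deriv) t 0
  refine ⟨(q 0).2, D.S (q 0), hqlt 0, fun t => ?_⟩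
  have hS : ∀ t, D.S (q t) - t = D.S (q 0) := fun t => by
    have h1 : ∀ t, HasDerivAt (fun t => D.S (q t) - t) 0 t := fun t => by
      refine (((D.S_smooth.differentiable (by simp) (q t)).hasFDerivAt.comp_hasDerivAt t
        (hqd' t)).sub (hasDerivAt_id t)).congr_deriv ?_
      rw [show deriv q t = (deriv q t).1 • ((1 : ℝ), (0 : ℂ)) by
        ext1 <;> simp [(hR t).1], map_smul, smul_eq_mul, mul_comm, (hR t).2, sub_self]
    have := is_const_of_deriv_eq_zero (fun t => (h1 t).differentiableAt)
      (fun t => (h1 t).deriv) t 0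
    simpa using this
  have hτ : D.time (q 0).2 (t + D.S (q 0)) = (q t).1 := by
    rw [D.time_eq_iff, ← hz t, ← hS t]
    simp
  rw [traj, hτ, ← hz t]
  exact (hpq t).symm

/-- A Reeb orbit which meets the binding stays in it. -/
theorem c2_eq_zero_of_exists (D : Suspension) (γ : SimpleReebOrbit D.lam) {t₀ : ℝ}
    (h₀ : c2 (γ.curve t₀) = 0) (t : ℝ) : c2 (γ.curve t) = 0 := by
  have hγd : ∀ t, HasDerivAt γ.curve (deriv γ.curve t) t := fun t =>
    (γ.smooth.differentiable (by simp) t).hasDerivAt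
  have hcl : IsClosed {t | c2 (γ.curve t) = 0} :=
    isClosed_eq (c2.continuous.comp γ.smooth.continuous) continuous_const
  -- Near the binding `c2` of the curve satisfies a linear rotation equation, so after rotating back
  -- it is constant, and it vanishes on an interval as soon as it vanishes at one time.
  have hop : IsOpen {t | c2 (γ.curve t) = 0} := by
    rw [Metric.isOpen_iff]
    intro t ht
    have h1 : ‖c1 (γ.curve t)‖ = 1 := by
      have h1 := mem_S3_iff.1 (γ.mem_sphere t)
      rw [show c2 (γ.curve t) = 0 from ht, norm_zero] at h1
      have := norm_nonneg (c1 (γ.curve t))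
      nlinarith
    have h2 : ∀ᶠ s in 𝓝 t, D.ρ < ‖c1 (γ.curve s)‖ :=
      (c1.continuous.comp γ.smooth.continuous).norm.continuousAt.eventually_const_lt
        (by simpa only [Function.comp_apply, h1] using D.ρ_lt)
    obtain ⟨ε, hε, hball⟩ := Metric.eventually_nhds_iff_ball.1 h2
    refine ⟨ε, hε, fun s hs => ?_⟩
    have hd : ∀ s ∈ ball t ε, HasDerivAt (fun s => c2 (γ.curve s))
        (2 * π * D.θ₀⁻¹ * Complex.I * c2 (γ.curve s)) s := by
      intro s hs
      have h3 := (γ.reeb s).unique (γ.mem_sphere s)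
        (D.isContactForm.pos _ (γ.mem_sphere s)).ne'
        (D.isReebVector_out (γ.mem_sphere s) (hball s hs))
      have h4 := c2.hasFDerivAt.comp_hasDerivAt s (hγd s)
      rw [h3, linReeb, c2_ofC] at h4
      exact h4
    have hc : ∀ s ∈ ball t ε, HasDerivAt (fun s => circ (-(s / D.θ₀)) * c2 (γ.curve s)) 0 s := by
      intro s hs
      have h5 : HasDerivAt (fun s => circ (-(s / D.θ₀)))
          ((-(1 / D.θ₀)) • (2 * π * Complex.I * circ (-(s / D.θ₀)))) s :=
        HasDerivAt.scomp (h := fun s => -(s / D.θ₀)) s (hasDerivAt_circ (-(s / D.θ₀)))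
          ((hasDerivAt_id s).div_const D.θ₀).neg
      refine (h5.mul (hd s hs)).congr_deriv ?_
      rw [Complex.real_smul]
      push_cast
      ring
    have h6 := (convex_ball t ε).is_const_of_fderivWithin_eq_zero (𝕜 := ℝ)
      (f := fun s => circ (-(s / D.θ₀)) * c2 (γ.curve s))
      (fun s hs => (hc s hs).differentiableAt.differentiableWithinAt)
      (fun s hs => by
        rw [fderivWithin_of_isOpen isOpen_ball hs]
        ext1
        simp [(hc s hs).deriv]) hs (mem_ball_self hε)
    simp only [show c2 (γ.curve t) = 0 from ht, mul_zero] at h6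
    exact (mul_eq_zero.1 h6).resolve_left (circ_ne_zero _)
  have := IsClopen.eq_univ ⟨hcl, hop⟩ ⟨t₀, h₀⟩
  exact eq_univ_iff_forall.1 this t

/-- The only Reeb orbit which meets the binding is the binding. -/
theorem equiv_bindingOrbit (D : Suspension) (γ : SimpleReebOrbit D.lam) {t₀ : ℝ}
    (h₀ : c2 (γ.curve t₀) = 0) : D.bindingOrbit ≈ γ := by
  have h2 := D.c2_eq_zero_of_exists γ h₀
  have h1 : ∀ t, ‖c1 (γ.curve t)‖ = 1 := fun t => by
    have h1 := mem_S3_iff.1 (γ.mem_sphere t)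
    rw [h2, norm_zero] at h1
    have := norm_nonneg (c1 (γ.curve t))
    nlinarith
  have hc : ∀ s, HasDerivAt (fun s => circ (-s) * c1 (γ.curve s)) 0 s := by
    intro s
    have h3 := (γ.reeb s).unique (γ.mem_sphere s)
      (D.isContactForm.pos _ (γ.mem_sphere s)).ne'
      (D.isReebVector_out (γ.mem_sphere s) (by rw [h1]; exact D.ρ_lt))
    have h4 := c1.hasFDerivAt.comp_hasDerivAt s
      ((γ.smooth.differentiable (by simp) s).hasDerivAt)
    rw [h3, linReeb, c1_ofC] at h4
    have h5 : HasDerivAt (fun s => circ (-s)) ((-1 : ℝ) • (2 * π * Complex.I * circ (-s))) s :=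
      (hasDerivAt_circ (-s)).scomp s (hasDerivAt_id s).neg
    refine (h5.mul h4).congr_deriv ?_
    simp only [Function.comp_apply, Complex.real_smul]
    push_cast
    ring
  set a := Complex.arg (c1 (γ.curve 0)) / (2 * π) with ha
  have hcurve : ∀ t, γ.curve t = D.bindingOrbit.curve (t + a) := fun t => by
    have h3 := is_const_of_deriv_eq_zero (fun t => (hc t).differentiableAt)
      (fun t => (hc t).deriv) t 0
    have h4 := circ_arg (c1 (γ.curve 0))
    rw [h1, Complex.ofReal_one, one_mul, ← ha] at h4
    simp only [neg_zero, circ_zero, one_mul] at h3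
    apply E4.ext_c
    · simp only [bindingOrbit, c1_ofC]
      rw [circ_add, h4, ← h3, ← mul_assoc, circ_mul_neg, one_mul]
    · simp [bindingOrbit, h2]
  refine ⟨?_, a, hcurve⟩
  change 1 = γ.period
  have hT := γ.period_pos
  have h3 : γ.curve γ.period = γ.curve 0 := by simpa using γ.periodic 0
  rw [hcurve, hcurve] at h3
  have h4 := congrArg c1 h3
  simp only [bindingOrbit, c1_ofC] at h4
  obtain ⟨n, hn⟩ := circ_eq_circ_iff.1 h4
  have hn1 : γ.period = n := by linarith
  have hn2 : (1 : ℝ) ≤ n := by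
    have : (0 : ℤ) < n := by
      rw [hn1] at hT
      exact_mod_cast hT
    exact_mod_cast this
  -- The period is a positive integer. If it exceeded `1`, the curve would come back at time `1`,
  -- against injectivity.
  by_contra hne
  have h5 : (1 : ℝ) < γ.period := lt_of_le_of_ne (hn1 ▸ hn2) hne
  have h6 : γ.curve 1 = γ.curve 0 := by
    rw [hcurve, hcurve, show (1 : ℝ) + a = (0 + a) + 1 by ring]
    exact D.bindingOrbit.periodic _
  have := γ.simple ⟨zero_le_one, h5⟩ ⟨le_rfl, hT⟩ h6
  exact one_ne_zero this

/-- A Reeb orbit which avoids the binding comes from a periodic point of `φ`. -/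
theorem exists_equiv_orbit (D : Suspension) (γ : SimpleReebOrbit D.lam)
    (hne : ∀ t, c2 (γ.curve t) ≠ 0) :
    ∃ z, ∃ hz : ‖z‖ < 1, ∃ hp : z ∈ Function.periodicPts D.φ, D.orbit z hz hp ≈ γ := by
  obtain ⟨z, c, hz, hcurve⟩ := D.exists_eq_traj γ hne
  have hT := γ.period_pos
  have h3 : γ.curve γ.period = γ.curve 0 := by simpa using γ.periodic 0
  rw [hcurve, hcurve] at h3
  obtain ⟨n, hnz, hn⟩ := D.exists_nat_of_traj_eq hz (by linarith) h3
  have hTn : γ.period = birkhoffSum D.φ D.f n z := by linarith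
  have hn0 : 0 < n := by
    rcases Nat.eq_zero_or_pos n with h | h
    · rw [h, birkhoffSum_zero] at hTn; linarith
    · exact h
  have hp : z ∈ Function.periodicPts D.φ := ⟨n, hn0, hnz⟩
  refine ⟨z, hz, hp, ?_, c, hcurve⟩
  change birkhoffSum D.φ D.f (Function.minimalPeriod D.φ z) z = γ.period
  have hle := Function.IsPeriodicPt.minimalPeriod_le hn0
    (show Function.IsPeriodicPt D.φ n z from hnz)
  rcases hle.lt_or_eq with hlt | heq
  · exfalso
    have h4 := D.birkhoffSum_strictMono z hlt
    have h5 := D.birkhoffSum_pos (Function.minimalPeriod_pos_of_mem_periodicPts hp) z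
    have h6 : γ.curve (birkhoffSum D.φ D.f (Function.minimalPeriod D.φ z) z) = γ.curve 0 := by
      rw [hcurve, hcurve, add_comm, D.traj_add_birkhoffSum, Function.iterate_minimalPeriod,
        zero_add]
    have := γ.simple ⟨h5.le, by rw [hTn]; exact h4⟩ ⟨le_rfl, hT⟩ h6
    linarith
  · rw [heq, hTn]

theorem exists_iterate_of_equiv (D : Suspension) {z z' : ℂ} {hz : ‖z‖ < 1} {hz' : ‖z'‖ < 1}
    {hp : z ∈ Function.periodicPts D.φ} {hp' : z' ∈ Function.periodicPts D.φ}
    (h : D.orbit z hz hp ≈ D.orbit z' hz' hp') : ∃ n : ℕ, D.φ^[n] z = z' := by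
  obtain ⟨-, s, hs⟩ := h
  set T := (D.orbit z hz hp).period with hTdef
  have hT : 0 < T := (D.orbit z hz hp).period_pos
  -- The shift `s` may be negative; adding `m` periods makes the crossing time nonnegative, so that
  -- an iterate of `φ` appears and not an inverse.
  obtain ⟨m, hm⟩ := exists_nat_ge (-s / T)
  rw [div_le_iff₀ hT] at hm
  have h1 : D.param (D.time z (s + m * T), z) = D.param (0, z') := by
    have h2 : D.traj z' 0 = D.traj z (0 + s) := hs 0
    have h3 : D.traj z (s + m * T) = D.traj z s := (D.orbit z hz hp).periodic.nat_mul m s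
    rw [zero_add] at h2
    rw [traj, D.time_zero] at h2
    rw [h2, ← h3]
    rfl
  have h4 : (0 : ℝ) ≤ D.time z (s + m * T) := by
    rw [← D.time_zero z]
    exact (D.strictMono_time z).monotone (by linarith)
  obtain ⟨n, -, hn⟩ := D.exists_nat_of_param_eq hz h4 h1
  exact ⟨n, hn⟩

/-- The linking number of a Reeb orbit with the binding is the number of its returns to a page. -/
theorem hasLinkingNumber_orbit (D : Suspension) {z : ℂ} {hz : ‖z‖ < 1}
    {hp : z ∈ Function.periodicPts D.φ} {γ : SimpleReebOrbit D.lam}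
    (h : D.orbit z hz hp ≈ γ) :
    HasLinkingNumber γ.period γ.curve D.bindingOrbit.period D.bindingOrbit.curve
      (Function.minimalPeriod D.φ z) := by
  obtain ⟨hT, c, hc⟩ := h
  set d := Function.minimalPeriod D.φ z with hd
  have hcurve : ∀ t, γ.curve t = D.traj z (t + c) := hc
  have hT' : γ.period = birkhoffSum D.φ D.f d z := hT.symm
  have htime : D.time z (γ.period + c) = D.time z c + d := by
    rw [hT', add_comm, D.time_add_birkhoffSum, hd, Function.iterate_minimalPeriod]
  -- Over one period the torus time runs through `[time z c, time z c + d)`, which contains exactly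
  -- the `d` integers from `a` to `a + d - 1`. At these times, and only then, the orbit crosses the
  -- zeroth page, a disk bounded by the binding, and each crossing is positive.
  set a := ⌈D.time z c⌉ with ha
  let P : ℤ ↪ ℝ × ℂ := ⟨fun n => (D.S (n, z) - c, D.Φ (n, z)), fun m n hmn => by
    have h1 := (Prod.ext_iff.1 hmn).1
    simp only [sub_left_inj] at h1
    exact_mod_cast (D.strictMono_S z).injective h1⟩
  have hP : ∀ n : ℤ, P n = (D.S (n, z) - c, D.Φ (n, z)) := fun n => rfl
  have hPt : ∀ n : ℤ, D.time z ((P n).1 + c) = n := fun n => by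
    rw [D.time_eq_iff, hP]; simp
  have hcirc : ∀ n : ℤ, circ n = circ 0 := fun n => by rw [circ_int, circ_zero]
  have hbook : ∀ (n : ℤ) (w : ℂ), bookMap (n, w) = bookMap (0, w) := fun n w => by
    simp only [bookMap, hcirc n]
  have hPγ : ∀ n : ℤ, γ.curve (P n).1 = bookMap (0, (P n).2) := fun n => by
    rw [hcurve, traj, hPt, param, ← hbook n]
    rfl
  have hPlt : ∀ n : ℤ, ‖(P n).2‖ < 1 := fun n => D.norm_Φ_lt hz
  have hpage : ∀ (n : ℤ) (w v : ℂ), ‖w‖ < 1 →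
      fderiv ℝ (fun w => bookMap (0, w)) w v = fderiv ℝ bookMap (n, w) (0, v) := by
    intro n w v hw
    have e : (fun w => bookMap (0, w)) = fun w => bookMap ((n : ℝ), w) :=
      funext fun w => (hbook n w).symm
    have h1 : HasFDerivAt (fun w : ℂ => ((n : ℝ), w)) (ContinuousLinearMap.inr ℝ ℝ ℂ) w :=
      hasFDerivAt_prodMk_right _ _
    have h2 := (hasFDerivAt_bookMap (q := ((n : ℝ), w)) hw).comp w h1
    rw [e]
    change fderiv ℝ (bookMap ∘ fun w : ℂ => ((n : ℝ), w)) w v = _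
    rw [h2.fderiv]
    simp
  have hdet : ∀ n : ℤ, 0 < det4 (γ.curve (P n).1) (deriv γ.curve (P n).1)
      (fderiv ℝ (fun w => bookMap (0, w)) (P n).2 1)
      (fderiv ℝ (fun w => bookMap (0, w)) (P n).2 Complex.I) := by
    intro n
    have h1 : HasDerivAt γ.curve (fderiv ℝ D.param ((n : ℝ), z)
        ((fderiv ℝ D.S ((n : ℝ), z) (1, 0))⁻¹, 0)) (P n).1 := by
      have h2 := (D.hasDerivAt_traj hz ((P n).1 + c))
      rw [hPt] at h2
      exact (h2.comp_add_const (P n).1 c).congr_of_eventuallyEq (Eventually.of_forall hcurve)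
    rw [h1.deriv, hcurve, traj, hPt, hpage n _ _ (hPlt n), hpage n _ _ (hPlt n)]
    exact D.det4_reeb_pos (q := ((n : ℝ), z)) hz (inv_pos.2 (D.fderiv_S_fst _))
  refine ⟨fun s t h => ?_, fun w => bookMap (0, w), mapsTo_page 0,
    (continuous_bookMap.comp (by fun_prop)).continuousOn, contDiffOn_page 0, fun s => ?_,
    (Finset.Ico a (a + d)).map P, fun q => ?_, fun q hq => ?_, ?_⟩
  · have h1 : c2 (γ.curve s) = 0 := by rw [h]; simp [bindingOrbit]
    rw [hcurve] at h1
    exact D.c2_param_ne_zero (q := (_, z)) hz h1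
  · simp only [bookMap_circ]
    simp [bindingOrbit]
  · rw [Finset.mem_map]
    constructor
    · rintro ⟨n, hn, rfl⟩
      rw [Finset.mem_Ico] at hn
      have h1 : D.time z c ≤ n := (Int.le_ceil _).trans (by exact_mod_cast hn.1)
      have h2 : (n : ℝ) < D.time z c + d := by
        have h3 : n - d < a := by omega
        have := Int.lt_ceil.1 h3
        push_cast at this
        linarith
      refine ⟨⟨?_, ?_⟩, by simpa using hPlt n, (hPγ n).symm⟩
      · have : c ≤ (P n).1 + c := by
          rw [← (D.strictMono_time z).le_iff_le, hPt]
          exact h1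
        linarith
      · have : (P n).1 + c < γ.period + c := by
          rw [← (D.strictMono_time z).lt_iff_lt, hPt, htime]
          exact h2
        linarith
    · rintro ⟨⟨h1, h2⟩, h3, h4⟩
      rw [mem_ball_zero_iff] at h3
      rw [hcurve, traj, param] at h4
      have e1 := congrArg c1 h4
      have e2 := congrArg c2 h4
      simp only [c1_bookMap, c2_bookMap] at e1 e2
      rw [← e1] at e2
      have h5 : (Real.sqrt (1 - ‖q.2‖ ^ 2) : ℂ) ≠ 0 := by
        simpa using (Real.sqrt_pos.2 (one_sub_sq_pos h3)).ne'
      obtain ⟨n, hn⟩ := circ_eq_circ_iff.1 (mul_left_cancel₀ h5 e2).symm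
      have hn' : D.time z (q.1 + c) = n := by simpa [twist] using hn
      have hq1 : D.S (n, z) = q.1 + c := D.time_eq_iff.1 hn'
      refine ⟨n, ?_, ?_⟩
      · rw [Finset.mem_Ico]
        constructor
        · rw [ha, Int.ceil_le, ← hn']
          exact (D.strictMono_time z).monotone (by linarith)
        · have h6 : D.time z (q.1 + c) < D.time z c + d := by
            rw [← htime]
            exact D.strictMono_time z (by linarith)
          rw [hn'] at h6
          have : n - d < a := by
            rw [ha, Int.lt_ceil]
            push_cast
            linarith
          omega
      · ext1
        · rw [hP, hq1, add_sub_cancel_right]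
        · rw [e1, hP, twist, hn']
  · obtain ⟨n, -, rfl⟩ := Finset.mem_map.1 hq
    exact (hdet n).ne'
  · rw [Finset.sum_map, Finset.sum_congr rfl (fun n _ => by rw [sign_pos (hdet n)])]
    simp

end Suspension

/-! ### Periodic orbits as cycles -/

/-- After rotating the cycle to start at `x`, the chain condition makes its entries the successive
iterates of `x` and closes them up after one turn; absence of repetitions makes the length the
minimal period. -/
theorem Cycle.eq_periodicOrbit {α : Type*} {f : α → α} {c : Cycle α} (hnd : c.Nodup)
    (hch : c.Chain fun x y => f x = y) {x : α} (hx : x ∈ c) :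
    x ∈ Function.periodicPts f ∧ c = Function.periodicOrbit f x := by
  obtain ⟨l, rfl⟩ := Quotient.exists_rep c
  have hx' : x ∈ l := hx
  obtain ⟨a, b, rfl⟩ := List.append_of_mem hx'
  have e : (Quotient.mk _ (a ++ x :: b) : Cycle α) = ((x :: (b ++ a) : List α) : Cycle α) :=
    Cycle.coe_eq_coe.2 (List.isRotated_append (l := a) (l' := x :: b))
  rw [e] at hnd hch ⊢
  generalize b ++ a = t at *
  rw [Cycle.nodup_coe_iff] at hnd
  rw [Cycle.chain_coe_cons, List.isChain_iff_getElem] at hch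
  have hlen : (x :: (t ++ [x])).length = t.length + 2 := by simp
  have hit : ∀ i, ∀ hi : i < (x :: (t ++ [x])).length, (x :: (t ++ [x]))[i] = f^[i] x := by
    intro i
    induction i with
    | zero => intro _; rfl
    | succ i ih =>
      intro hi
      rw [Function.iterate_succ_apply', ← ih (by omega)]
      exact (hch i hi).symm
  have hd : f^[t.length + 1] x = x := by
    rw [← hit (t.length + 1) (by omega)]
    simp
  have hl : x :: t = (List.range (t.length + 1)).map fun n => f^[n] x := by
    apply List.ext_getElem (by simp)
    intro i h1 h2
    rw [List.getElem_map, List.getElem_range, ← hit i (by simp at h1; omega)]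
    exact (List.getElem_append_left (as := x :: t) (bs := [x]) h1).symm
  have hp : x ∈ Function.periodicPts f := ⟨t.length + 1, by omega, hd⟩
  have hm : Function.minimalPeriod f x = t.length + 1 := by
    have hle := Function.IsPeriodicPt.minimalPeriod_le (Nat.succ_pos t.length)
      (show Function.IsPeriodicPt f (t.length + 1) x from hd)
    rcases hle.lt_or_eq with hlt | heq
    · exfalso
      -- A minimal period shorter than the list would make the entry at that index equal to the
      -- entry at index `0`.
      rw [hl] at hnd
      have h1 := List.inj_on_of_nodup_map hnd (x := Function.minimalPeriod f x) (y := 0)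
        (by simpa using hlt) (by simp) (by simp)
      have := Function.minimalPeriod_pos_of_mem_periodicPts hp
      omega
    · exact heq
  exact ⟨hp, by rw [Function.periodicOrbit, hm, ← hl]⟩

/-! ### Matching periodic orbits of `φ` with Reeb orbits. -/

namespace Suspension

open DiskMap ContactSphere

/-- Rotating `φ z` back by `θ₀` gives a point of the collar with the same image as `z`, and `φ` is
injective. -/
theorem norm_φ_eq (D : Suspension) {z : ℂ} (h : D.ρ < ‖D.φ z‖) : ‖D.φ z‖ = ‖z‖ := by
  have h1 : D.φ (circ (-D.θ₀) * D.φ z) = D.φ z := by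
    rw [D.φ_out _ (by rw [norm_mul, norm_circ, one_mul]; exact h.le), ← mul_assoc, circ_mul_neg,
      one_mul]
  have h2 := congrArg D.φi h1
  rw [D.φiφ, D.φiφ] at h2
  conv_rhs => rw [← h2, norm_mul, norm_circ, one_mul]

theorem norm_φ_le (D : Suspension) {z : ℂ} (h : ‖z‖ ≤ D.ρ) : ‖D.φ z‖ ≤ D.ρ := by
  by_contra! h1
  rw [D.norm_φ_eq h1] at h1
  linarith

theorem mapsTo_φ (D : Suspension) : MapsTo D.φ disk disk := by
  intro z hz
  rw [mem_closedBall_zero_iff] at hz ⊢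
  by_contra! h1
  rw [D.norm_φ_eq (D.ρ_lt.trans h1)] at h1
  linarith

/-- Since `φ` is a rotation on a collar of the boundary, the closed disk and the open disk are
in bijection by a map which commutes with `φ` and preserves `f`. -/
theorem exists_retract (D : Suspension) : ∃ k : ℂ → ℂ, (∀ z ∈ disk, ‖k z‖ < 1) ∧ InjOn k disk ∧
    (∀ w : ℂ, ‖w‖ < 1 → ∃ z ∈ disk, k z = w) ∧ (∀ z ∈ disk, k (D.φ z) = D.φ (k z)) ∧
    ∀ z ∈ disk, D.f (k z) = D.f z := by
  -- Any bijection of radii will do, and a cardinality argument supplies one: no continuity is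
  -- needed, since on the collar `φ` is the same rotation on every circle and `f` is constant. It
  -- pushes the orbits on the boundary circle, which have no Reeb orbit off the binding, into the
  -- open disk.
  obtain ⟨e⟩ : Nonempty (Ioc D.ρ 1 ≃ Ioo D.ρ 1) := by
    rw [← Cardinal.eq, Cardinal.mk_Ioc_real D.ρ_lt, Cardinal.mk_Ioo_real D.ρ_lt]
  classical
  let r : ℝ → ℝ := fun s => if h : s ∈ Ioc D.ρ 1 then e ⟨s, h⟩ else s
  have hr : ∀ s (h : s ∈ Ioc D.ρ 1), r s = e ⟨s, h⟩ := fun s h => dif_pos h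
  have hr' : ∀ s, s ≤ D.ρ → r s = s := fun s h => dif_neg fun h1 => h1.1.not_ge h
  have hr1 : ∀ s, D.ρ < s → s ≤ 1 → D.ρ < r s ∧ r s < 1 := fun s h h' => by
    rw [hr s ⟨h, h'⟩]; exact (e _).2
  have hρ := D.ρ_pos
  have hinj : ∀ s ≤ 1, ∀ s' ≤ 1, r s = r s' → s = s' := by
    intro s hs s' hs' h
    rcases le_or_gt s D.ρ with h1 | h1 <;> rcases le_or_gt s' D.ρ with h2 | h2
    · rwa [hr' s h1, hr' s' h2] at h
    · rw [hr' s h1] at h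
      linarith [(hr1 s' h2 hs').1]
    · rw [hr' s' h2] at h
      linarith [(hr1 s h1 hs).1]
    · rw [hr s ⟨h1, hs⟩, hr s' ⟨h2, hs'⟩] at h
      exact Subtype.ext_iff.1 (e.injective (Subtype.ext h))
  have hr0 : ∀ s, 0 ≤ s → s ≤ 1 → 0 ≤ r s := fun s h h' => by
    rcases le_or_gt s D.ρ with h1 | h1
    · rwa [hr' s h1]
    · exact (hρ.trans (hr1 s h1 h').1).le
  let k : ℂ → ℂ := fun z => ((r ‖z‖ / ‖z‖ : ℝ) : ℂ) * z
  have hk0 : k 0 = 0 := by simp [k]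
  have hkn : ∀ z ∈ disk, ‖k z‖ = r ‖z‖ := by
    intro z hz
    rw [mem_closedBall_zero_iff] at hz
    rcases eq_or_ne z 0 with rfl | h0
    · rw [hk0, norm_zero, hr' 0 hρ.le]
    · have h1 := norm_ne_zero_iff.2 h0
      simp only [k]
      rw [norm_mul, Complex.norm_real, Real.norm_of_nonneg
        (div_nonneg (hr0 _ (norm_nonneg _) hz) (norm_nonneg _))]
      field_simp
  have hkid : ∀ z : ℂ, ‖z‖ ≤ D.ρ → k z = z := by
    intro z hz
    rcases eq_or_ne z 0 with rfl | h0
    · exact hk0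
    · simp only [k]
      rw [hr' _ hz, div_self (norm_ne_zero_iff.2 h0), Complex.ofReal_one, one_mul]
  refine ⟨k, fun z hz => ?_, fun z hz z' hz' h => ?_, fun w hw => ?_, fun z hz => ?_,
    fun z hz => ?_⟩
  · rw [hkn z hz]
    rw [mem_closedBall_zero_iff] at hz
    rcases le_or_gt ‖z‖ D.ρ with h1 | h1
    · rw [hr' _ h1]; exact h1.trans_lt D.ρ_lt
    · exact (hr1 _ h1 hz).2
  · have h1 := congrArg norm h
    rw [hkn z hz, hkn z' hz'] at h1
    rw [mem_closedBall_zero_iff] at hz hz'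
    have h2 := hinj _ hz _ hz' h1
    rcases le_or_gt ‖z‖ D.ρ with h3 | h3
    · rwa [hkid z h3, hkid z' (h2 ▸ h3)] at h
    · simp only [k] at h
      rw [← h2] at h
      refine mul_left_cancel₀ ?_ h
      have h4 := (hr1 _ h3 hz).1
      have : 0 < r ‖z‖ / ‖z‖ := div_pos (hρ.trans h4) (hρ.trans h3)
      exact_mod_cast this.ne'
  · rcases le_or_gt ‖w‖ D.ρ with h1 | h1
    · exact ⟨w, by rw [mem_closedBall_zero_iff]; exact hw.le, hkid w h1⟩
    · set s := e.symm ⟨‖w‖, h1, hw⟩ with hs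
      have hs1 : r s = ‖w‖ := by
        rw [hr s s.2, hs]
        simp
      have hs0 : (0 : ℝ) < s := hρ.trans s.2.1
      have hw0 : 0 < ‖w‖ := hρ.trans h1
      have hn : ‖((s / ‖w‖ : ℝ) : ℂ) * w‖ = s := by
        rw [norm_mul, Complex.norm_real, Real.norm_of_nonneg (by positivity)]
        field_simp
      refine ⟨((s / ‖w‖ : ℝ) : ℂ) * w, ?_, ?_⟩
      · rw [mem_closedBall_zero_iff, hn]
        exact s.2.2
      · simp only [k]
        rw [hn, hs1, ← mul_assoc, ← Complex.ofReal_mul,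
          show ‖w‖ / (s : ℝ) * (s / ‖w‖) = 1 by field_simp, Complex.ofReal_one, one_mul]
  · have hz' := hz
    rw [mem_closedBall_zero_iff] at hz
    rcases le_or_gt ‖z‖ D.ρ with h1 | h1
    · rw [hkid z h1, hkid _ (D.norm_φ_le h1)]
    · have h2 : D.ρ ≤ ‖k z‖ := by
        rw [hkn z hz']; exact (hr1 _ h1 hz).1.le
      rw [D.φ_out z h1.le, D.φ_out _ h2]
      simp only [k]
      rw [norm_mul, norm_circ, one_mul]
      ring
  · have hz' := hz
    rw [mem_closedBall_zero_iff] at hz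
    rcases le_or_gt ‖z‖ D.ρ with h1 | h1
    · rw [hkid z h1]
    · rw [D.f_out z h1.le, D.f_out]
      rw [hkn z hz']; exact (hr1 _ h1 hz).1.le

/-- The periodic orbits of `φ` and the Reeb orbits other than the binding. -/
theorem exists_equiv_reebOrbits (D : Suspension) {φ : ℂ → ℂ} {f : ℂ → ℝ}
    (hφ : EqOn D.φ φ disk) (hf : EqOn D.f f disk) :
    ∃ e : Option (PeriodicOrbit φ) ≃ ReebOrbits D.lam, e none = ⟦D.bindingOrbit⟧ ∧
      ∀ (c : PeriodicOrbit φ) (γ : SimpleReebOrbit D.lam), e (some c) = ⟦γ⟧ →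
        HasLinkingNumber γ.period γ.curve D.bindingOrbit.period D.bindingOrbit.curve
          (c.period : ℤ) ∧ γ.action = c.totalAction f := by
  obtain ⟨k, hk1, hkinj, hksurj, hkφ, hkf⟩ := D.exists_retract
  have hmem : ∀ n, ∀ x ∈ disk, D.φ^[n] x ∈ disk := fun n => D.mapsTo_φ.iterate n
  have hiter : ∀ n, ∀ x ∈ disk, φ^[n] x = D.φ^[n] x := by
    intro n x hx
    induction n with
    | zero => rfl
    | succ n ih =>
      rw [Function.iterate_succ_apply', Function.iterate_succ_apply', ih, ← hφ (hmem n x hx)]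
  have hkiter : ∀ n, ∀ x ∈ disk, k (D.φ^[n] x) = D.φ^[n] (k x) := by
    intro n x hx
    induction n with
    | zero => rfl
    | succ n ih =>
      rw [Function.iterate_succ_apply', Function.iterate_succ_apply', hkφ _ (hmem n x hx), ih]
  have hper : ∀ n, ∀ x ∈ disk, Function.IsPeriodicPt D.φ n (k x) ↔
      Function.IsPeriodicPt D.φ n x := by
    intro n x hx
    simp only [Function.IsPeriodicPt, Function.IsFixedPt]
    rw [← hkiter n x hx]
    exact ⟨fun h => hkinj (hmem n x hx) hx h, fun h => by rw [h]⟩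
  have hminφ : ∀ x ∈ disk, Function.minimalPeriod φ x = Function.minimalPeriod D.φ x := by
    intro x hx
    rw [Function.minimalPeriod_eq_minimalPeriod_iff]
    intro n
    simp only [Function.IsPeriodicPt, Function.IsFixedPt, hiter n x hx]
  have hmink : ∀ x ∈ disk, Function.minimalPeriod D.φ (k x) = Function.minimalPeriod D.φ x := by
    intro x hx
    rw [Function.minimalPeriod_eq_minimalPeriod_iff]
    exact fun n => hper n x hx
  have horb : ∀ x ∈ disk, Function.periodicOrbit φ x = Function.periodicOrbit D.φ x := by
    intro x hx
    rw [Function.periodicOrbit, Function.periodicOrbit, hminφ x hx]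
    congr 1
    exact List.map_congr_left fun n _ => hiter n x hx
  have hc : ∀ (c : PeriodicOrbit φ), ∃ x ∈ disk, x ∈ Function.periodicPts D.φ ∧
      c.pts = Function.periodicOrbit D.φ x := by
    intro c
    obtain ⟨x, hx⟩ : ∃ x, x ∈ c.pts := by
      by_contra! h
      refine c.ne_nil ?_
      rw [← Cycle.toMultiset_eq_nil]
      refine Multiset.eq_zero_of_forall_notMem fun x hx => h x ?_
      obtain ⟨l, hl⟩ := Quotient.exists_rep c.pts
      rw [← hl] at hx ⊢
      exact hx
    have hxd := c.mem_disk x hx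
    obtain ⟨h1, h2⟩ := Cycle.eq_periodicOrbit c.nodup c.chain hx
    refine ⟨x, hxd, ?_, by rw [h2, horb x hxd]⟩
    rw [← Function.minimalPeriod_pos_iff_mem_periodicPts, ← hminφ x hxd]
    exact Function.minimalPeriod_pos_of_mem_periodicPts h1
  choose pt hptd hptp hpts using hc
  have hkp : ∀ x ∈ disk, x ∈ Function.periodicPts D.φ → k x ∈ Function.periodicPts D.φ := by
    rintro x hx ⟨n, hn, h⟩
    exact ⟨n, hn, (hper n x hx).2 h⟩
  let F : Option (PeriodicOrbit φ) → ReebOrbits D.lam := fun o => o.elim ⟦D.bindingOrbit⟧ fun c =>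
    ⟦D.orbit (k (pt c)) (hk1 _ (hptd c)) (hkp _ (hptd c) (hptp c))⟧
  have hFnone : ∀ c, F none ≠ F (some c) := by
    intro c h
    obtain ⟨-, s, hs⟩ := Quotient.exact h
    have h1 : D.traj (k (pt c)) 0 = D.bindingOrbit.curve (0 + s) := hs 0
    have h2 := congrArg c2 h1
    refine D.c2_param_ne_zero (q := (D.time (k (pt c)) 0, k (pt c))) (hk1 _ (hptd c)) ?_
    change c2 (D.traj (k (pt c)) 0) = 0
    rw [h2]
    simp [bindingOrbit]
  have hinj : Function.Injective F := by
    rintro (_ | c) (_ | c') h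
    · rfl
    · exact (hFnone c' h).elim
    · exact (hFnone c h.symm).elim
    · obtain ⟨n, hn⟩ := D.exists_iterate_of_equiv (Quotient.exact h)
      rw [← hkiter n _ (hptd c)] at hn
      have h1 := hkinj (hmem n _ (hptd c)) (hptd c') hn
      have h2 : c.pts = c'.pts := by
        rw [hpts, hpts, ← h1, Function.periodicOrbit_apply_iterate_eq (hptp c)]
      rcases c with ⟨p, _, _, _, _⟩
      rcases c' with ⟨p', _, _, _, _⟩
      simp only at h2
      subst h2
      rfl
  have hsurj : Function.Surjective F := by
    intro o
    obtain ⟨γ, rfl⟩ := Quotient.exists_rep o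
    by_cases h0 : ∃ t, c2 (γ.curve t) = 0
    · obtain ⟨t, ht⟩ := h0
      exact ⟨none, Quotient.sound (D.equiv_bindingOrbit γ ht)⟩
    · push Not at h0
      obtain ⟨w, hw, hp, hγ⟩ := D.exists_equiv_orbit γ h0
      obtain ⟨x, hx, rfl⟩ := hksurj w hw
      have hxp : x ∈ Function.periodicPts D.φ := by
        obtain ⟨n, hn, h⟩ := hp
        exact ⟨n, hn, (hper n x hx).1 h⟩
      have hxp' : x ∈ Function.periodicPts φ := by
        rw [← Function.minimalPeriod_pos_iff_mem_periodicPts, hminφ x hx]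
        exact Function.minimalPeriod_pos_of_mem_periodicPts hxp
      let c : PeriodicOrbit φ :=
        { pts := Function.periodicOrbit φ x
          ne_nil := by simpa using hxp'
          mem_disk := fun y hy => by
            obtain ⟨n, rfl⟩ := (Function.mem_periodicOrbit_iff hxp').1 hy
            rw [hiter n x hx]
            exact hmem n x hx
          nodup := Function.nodup_periodicOrbit
          chain := (Function.periodicOrbit_chain' _ hxp').2 fun n =>
            (Function.iterate_succ_apply' φ n x).symm }
      have h1 : x ∈ Function.periodicOrbit D.φ (pt c) := by
        rw [← hpts c]
        exact Function.self_mem_periodicOrbit hxp'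
      obtain ⟨n, hn⟩ := (Function.mem_periodicOrbit_iff (hptp c)).1 h1
      refine ⟨some c, Quotient.sound (Setoid.trans ?_ hγ)⟩
      have hkn : D.φ^[n] (k (pt c)) = k x := by rw [← hkiter n _ (hptd c), hn]
      have hkp' := hkp _ (hptd c) (hptp c)
      refine ⟨?_, birkhoffSum D.φ D.f n (k (pt c)), fun t => ?_⟩
      · change birkhoffSum D.φ D.f (Function.minimalPeriod D.φ (k (pt c))) (k (pt c))
          = birkhoffSum D.φ D.f (Function.minimalPeriod D.φ (k x)) (k x)
        rw [← hkn, Function.minimalPeriod_apply_iterate hkp']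
        set d := Function.minimalPeriod D.φ (k (pt c)) with hd
        -- Splitting the sum over `n + d` iterates in both orders shows that the sum of `f` over one
        -- period does not depend on the starting point.
        have e1 := birkhoffSum_add D.φ D.f n d (k (pt c))
        have e2 := birkhoffSum_add D.φ D.f d n (k (pt c))
        rw [hd, Function.iterate_minimalPeriod, ← hd, add_comm d n] at e2
        linarith
      · change D.traj (k x) t = D.traj (k (pt c)) (t + birkhoffSum D.φ D.f n (k (pt c)))
        rw [D.traj_add_birkhoffSum, hkn]
  refine ⟨Equiv.ofBijective F ⟨hinj, hsurj⟩, rfl, fun c γ h => ?_⟩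
  have hγ := Quotient.exact h
  have hlen : c.period = Function.minimalPeriod D.φ (pt c) := by
    rw [PeriodicOrbit.period, hpts, Function.periodicOrbit_length]
  constructor
  · rw [hlen, ← hmink _ (hptd c)]
    exact D.hasLinkingNumber_orbit hγ
  · rw [γ.action_eq, ← hγ.1, PeriodicOrbit.totalAction, hpts, Function.periodicOrbit,
      Cycle.coe_toMultiset, Multiset.map_coe, Multiset.sum_coe, List.map_map]
    change birkhoffSum D.φ D.f (Function.minimalPeriod D.φ (k (pt c))) (k (pt c)) = _
    rw [hmink _ (hptd c), birkhoffSum, ← Multiset.sum_coe, ← Multiset.map_coe]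
    refine Finset.sum_congr rfl fun n _ => ?_
    rw [← hkiter n _ (hptd c), hkf _ (hmem n _ (hptd c)), hf (hmem n _ (hptd c))]
    rfl

end Suspension

namespace ContactSphere

open DiskMap

/-! ### Integration over the sphere -/

/-- Polar coordinates: a function constant along rays contributes the radial factor `∫₀¹ r³ dr =
1/4`. This converts the surface integral into a Lebesgue integral on `ℝ⁴`, where the change of
variables formula applies. -/
theorem setIntegral_ball_normalize (g : E4 → ℝ) :
    ∫ x in ball (0 : E4) 1, g (normalize x)
      = (∫ p : S3, g p ∂(volume : Measure E4).toSphere) * 4⁻¹ := by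
  have hdim : Module.finrank ℝ E4 - 1 = 3 := by simp
  have h1 : ∫ x in ball (0 : E4) 1, g (normalize x)
      = ∫ x : E4, g (‖x‖⁻¹ • x) * (Iio (1 : ℝ)).indicator 1 ‖x‖ := by
    rw [← integral_indicator measurableSet_ball]
    refine integral_congr_ae (Eventually.of_forall fun x => ?_)
    by_cases hx : ‖x‖ < 1 <;> simp [indicator, hx, normalize]
  have h2 : ∫ x : E4, g (‖x‖⁻¹ • x) * (Iio (1 : ℝ)).indicator 1 ‖x‖
      = ∫ x : ({0}ᶜ : Set E4), g (‖x.1‖⁻¹ • x.1) * (Iio (1 : ℝ)).indicator 1 ‖x.1‖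
          ∂((volume : Measure E4).comap (↑)) := by
    rw [integral_subtype_comap (measurableSet_singleton _).compl
      fun x : E4 => g (‖x‖⁻¹ • x) * (Iio (1 : ℝ)).indicator 1 ‖x‖, restrict_compl_singleton]
  have h3 : ∫ x : ({0}ᶜ : Set E4), g (‖x.1‖⁻¹ • x.1) * (Iio (1 : ℝ)).indicator 1 ‖x.1‖
          ∂((volume : Measure E4).comap (↑))
      = ∫ y : S3 × Ioi (0 : ℝ), g y.1 * (Iio (1 : ℝ)).indicator 1 (y.2 : ℝ)
          ∂((volume : Measure E4).toSphere.prod (Measure.volumeIoiPow 3)) := by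
    rw [← hdim]
    simpa using (volume : Measure E4).measurePreserving_homeomorphUnitSphereProd.integral_comp
      (Homeomorph.measurableEmbedding _)
      (fun y : S3 × Ioi (0 : ℝ) => g y.1 * (Iio (1 : ℝ)).indicator 1 (y.2 : ℝ))
  have h4 : ∫ r : Ioi (0 : ℝ), (Iio (1 : ℝ)).indicator (1 : ℝ → ℝ) (r : ℝ)
      ∂(Measure.volumeIoiPow 3) = 4⁻¹ := by
    have h5 : (fun r : Ioi (0 : ℝ) => (Iio (1 : ℝ)).indicator (1 : ℝ → ℝ) (r : ℝ))
        = (Iio (⟨1, mem_Ioi.2 one_pos⟩ : Ioi (0 : ℝ))).indicator 1 := by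
      funext r
      by_cases hr : (r : ℝ) < 1
      · rw [indicator_of_mem (mem_Iio.2 hr), indicator_of_mem]
        · rfl
        · exact hr
      · rw [indicator_of_notMem (by simpa using hr), indicator_of_notMem]
        exact fun h => hr h
    rw [h5, integral_indicator_one measurableSet_Iio, Measure.real,
      Measure.volumeIoiPow_apply_Iio]
    norm_num
  rw [h1, h2, h3, integral_prod_mul (fun p : S3 => g p)
    (fun r : Ioi (0 : ℝ) => (Iio (1 : ℝ)).indicator (1 : ℝ → ℝ) (r : ℝ)), h4]

theorem det_eq_det4 (l : E4 →L[ℝ] E4) :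
    l.det = det4 (l (EuclideanSpace.single 0 1)) (l (EuclideanSpace.single 1 1))
      (l (EuclideanSpace.single 2 1)) (l (EuclideanSpace.single 3 1)) := by
  rw [ContinuousLinearMap.det,
    ← LinearMap.det_toMatrix (EuclideanSpace.basisFun (Fin 4) ℝ).toBasis, det4,
    ← Matrix.det_transpose]
  congr 1
  ext i j
  rw [Matrix.transpose_apply, LinearMap.toMatrix_apply]
  fin_cases i <;> simp

/-- Coordinates on `ℝ⁴`: the second one, and the first one together with the last two. -/
noncomputable def cyl (a : E4) : ℝ × (ℝ × ℂ) := (a 1, (a 0, c2 a))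

theorem cyl_injective : Function.Injective cyl := by
  intro a b h
  simp only [cyl, Prod.mk.injEq] at h
  have h2 : a 2 = b 2 := by rw [← c2_re, h.2.2, c2_re]
  have h3 : a 3 = b 3 := by rw [← c2_im, h.2.2, c2_im]
  ext i
  fin_cases i
  exacts [h.2.1, h.1, h2, h3]

theorem continuous_cyl : Continuous cyl := by
  unfold cyl
  fun_prop

theorem measurePreserving_cyl : MeasurePreserving cyl volume volume := by
  have h1 := PiLp.volume_preserving_ofLp (Fin 4)
  have h2 := volume_preserving_piFinSuccAbove (fun _ : Fin 4 => ℝ) 1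
  have h3 := volume_preserving_piFinSuccAbove (fun _ : Fin 3 => ℝ) 0
  have h4 := Complex.volume_preserving_equiv_pi.symm Complex.measurableEquivPi
  have h5 := ((MeasurePreserving.id (volume : Measure ℝ)).prod
    (((MeasurePreserving.id (volume : Measure ℝ)).prod h4).comp h3)).comp (h2.comp h1)
  have h6 : cyl = Prod.map id (Prod.map id Complex.measurableEquivPi.symm ∘
      MeasurableEquiv.piFinSuccAbove (fun _ : Fin 3 => ℝ) 0) ∘
      MeasurableEquiv.piFinSuccAbove (fun _ : Fin 4 => ℝ) 1 ∘ WithLp.ofLp := by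
    funext a
    refine Prod.ext rfl (Prod.ext rfl ?_)
    apply Complex.ext <;>
      simp [cyl, Complex.measurableEquivPi_symm_apply, MeasurableEquiv.piFinSuccAbove,
        Fin.insertNthEquiv, Fin.removeNth, Fin.succAbove] <;> rfl
  rw [h6]
  exact h5

theorem measurableEmbedding_cyl : MeasurableEmbedding cyl :=
  continuous_cyl.measurable.measurableEmbedding cyl_injective

end ContactSphere

namespace Suspension

open DiskMap ContactSphere

/-! ### The contact volume -/

/-- The cone over the parametrization of the complement of the binding. -/
noncomputable def cone (D : Suspension) (a : E4) : E4 := a 1 • D.param (a 0, c2 a)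

/-- The derivative of `cone`. -/
noncomputable def coneDeriv (D : Suspension) (a : E4) : E4 →L[ℝ] E4 :=
  a 1 • (fderiv ℝ D.param (a 0, c2 a)).comp
      ((EuclideanSpace.proj (0 : Fin 4) : E4 →L[ℝ] ℝ).prod c2)
    + (EuclideanSpace.proj (1 : Fin 4) : E4 →L[ℝ] ℝ).smulRight (D.param (a 0, c2 a))

theorem hasFDerivAt_cone (D : Suspension) {a : E4} (ha : ‖c2 a‖ < 1) :
    HasFDerivAt D.cone (D.coneDeriv a) a := by
  have h1 : HasFDerivAt (fun a : E4 => (a 0, c2 a))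
      ((EuclideanSpace.proj (0 : Fin 4) : E4 →L[ℝ] ℝ).prod c2) a :=
    ((EuclideanSpace.proj (0 : Fin 4) : E4 →L[ℝ] ℝ).prod c2).hasFDerivAt
  have h2 : HasFDerivAt (fun a : E4 => a 1) (EuclideanSpace.proj (1 : Fin 4) : E4 →L[ℝ] ℝ) a :=
    (EuclideanSpace.proj (1 : Fin 4) : E4 →L[ℝ] ℝ).hasFDerivAt
  have h3 : HasFDerivAt D.param (fderiv ℝ D.param (a 0, c2 a)) (a 0, c2 a) :=
    D.hasFDerivAt_param ha
  exact h2.smul (HasFDerivAt.comp (g := D.param) (f := fun a : E4 => (a 0, c2 a)) a h3 h1)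

/-- The minus sign appears because the radius is the second coordinate `a 1`, whereas `det4` expects
the radial vector first. -/
theorem det_coneDeriv (D : Suspension) (a : E4) :
    (D.coneDeriv a).det = -(a 1 ^ 3 * det4 (D.param (a 0, c2 a))
      (fderiv ℝ D.param (a 0, c2 a) (1, 0)) (fderiv ℝ D.param (a 0, c2 a) (0, 1))
      (fderiv ℝ D.param (a 0, c2 a) (0, Complex.I))) := by
  have e0 : D.coneDeriv a (EuclideanSpace.single 0 1)
      = a 1 • fderiv ℝ D.param (a 0, c2 a) (1, 0) := by
    simp [coneDeriv, c2]
  have e1 : D.coneDeriv a (EuclideanSpace.single 1 1) = D.param (a 0, c2 a) := by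
    simp [coneDeriv, c2, Prod.mk_zero_zero]
  have e2 : D.coneDeriv a (EuclideanSpace.single 2 1)
      = a 1 • fderiv ℝ D.param (a 0, c2 a) (0, 1) := by
    simp [coneDeriv, c2]
  have e3 : D.coneDeriv a (EuclideanSpace.single 3 1)
      = a 1 • fderiv ℝ D.param (a 0, c2 a) (0, Complex.I) := by
    simp [coneDeriv, c2]
  rw [det_eq_det4, e0, e1, e2, e3, det4_eq, det4_eq]
  simp only [PiLp.smul_apply, smul_eq_mul]
  ring

/-- The domain of the cone parametrization. -/
def coneDomain : Set E4 := cyl ⁻¹' (Ioo 0 1 ×ˢ (Ico 0 1 ×ˢ ball 0 1))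

theorem mem_coneDomain {a : E4} :
    a ∈ coneDomain ↔ a 1 ∈ Ioo (0 : ℝ) 1 ∧ a 0 ∈ Ico (0 : ℝ) 1 ∧ ‖c2 a‖ < 1 := by
  rw [← mem_ball_zero_iff]; rfl

theorem measurableSet_coneDomain : MeasurableSet coneDomain :=
  continuous_cyl.measurable
    (measurableSet_Ioo.prod (measurableSet_Ico.prod measurableSet_ball))

theorem norm_cone (D : Suspension) {a : E4} (ha : a ∈ coneDomain) : ‖D.cone a‖ = a 1 := by
  rw [mem_coneDomain] at ha
  rw [cone, norm_smul, mem_sphere_zero_iff_norm.1 (D.param_mem ha.2.2), mul_one,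
    Real.norm_of_nonneg ha.1.1.le]

theorem normalize_cone (D : Suspension) {a : E4} (ha : a ∈ coneDomain) :
    normalize (D.cone a) = D.param (a 0, c2 a) := by
  rw [ContactSphere.normalize, D.norm_cone ha, cone, smul_smul,
    inv_mul_cancel₀ (mem_coneDomain.1 ha).1.1.ne', one_smul]

theorem injOn_param (D : Suspension) : InjOn D.param (Ico 0 1 ×ˢ ball 0 1) := by
  have key : ∀ {τ τ' : ℝ} {z z' : ℂ}, τ < 1 → 0 ≤ τ' → ‖z‖ < 1 → τ' ≤ τ →
      D.param (τ, z) = D.param (τ', z') → (τ, z) = (τ', z') := by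
    intro τ τ' z z' h1 h0 hz hle h
    obtain ⟨n, hn, hz'⟩ := D.exists_nat_of_param_eq hz hle h
    have hn0 : n = 0 := by
      have : (n : ℝ) < 1 := by linarith
      exact_mod_cast Nat.lt_one_iff.1 (by exact_mod_cast this)
    subst hn0
    simp_all
  rintro ⟨τ, z⟩ ⟨h1, h2⟩ ⟨τ', z'⟩ ⟨h1', h2'⟩ h
  rcases le_total τ' τ with hle | hle
  · exact key h1.2 h1'.1 (mem_ball_zero_iff.1 h2) hle h
  · exact (key h1'.2 h1.1 (mem_ball_zero_iff.1 h2') hle h.symm).symm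

theorem injOn_cone (D : Suspension) : InjOn D.cone coneDomain := by
  intro a ha b hb h
  have h1 : a 1 = b 1 := by rw [← D.norm_cone ha, h, D.norm_cone hb]
  have h2 : D.param (a 0, c2 a) = D.param (b 0, c2 b) := by
    rw [← D.normalize_cone ha, h, D.normalize_cone hb]
  exact cyl_injective (Prod.ext h1 (D.injOn_param ha.2 hb.2 h2))

/-- What is missing from the ball is the cone over the binding, a proper linear subspace and hence a
null set. -/
theorem image_cone (D : Suspension) :
    D.cone '' coneDomain = ball 0 1 \ (LinearMap.ker (c2 : E4 →ₗ[ℝ] ℂ) : Set E4) := by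
  ext x
  simp only [Set.mem_sdiff, mem_ball_zero_iff, SetLike.mem_coe, LinearMap.mem_ker,
    ContinuousLinearMap.coe_coe]
  constructor
  · rintro ⟨a, ha, rfl⟩
    refine ⟨by rw [D.norm_cone ha]; exact (mem_coneDomain.1 ha).1.2, ?_⟩
    rw [cone, map_smul]
    exact smul_ne_zero (mem_coneDomain.1 ha).1.1.ne'
      (D.c2_param_ne_zero (mem_coneDomain.1 ha).2.2)
  · rintro ⟨hx, hc⟩
    have hx0 : x ≠ 0 := fun h => hc (by rw [h, map_zero])
    have hn : 0 < ‖x‖ := norm_pos_iff.2 hx0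
    obtain ⟨q, hq1, hq2, hq⟩ := D.exists_param_eq (p := ‖x‖⁻¹ • x)
      (by rw [mem_sphere_zero_iff_norm, norm_smul, norm_inv, norm_norm, inv_mul_cancel₀ hn.ne'])
      (by rw [map_smul]; exact smul_ne_zero (inv_ne_zero hn.ne') hc)
    refine ⟨ofC (⟨q.1, ‖x‖⟩, q.2), ?_, ?_⟩
    · rw [mem_coneDomain]
      simpa using ⟨⟨hx0, hx⟩, hq1, hq2⟩
    · simp only [cone, ofC_one, ofC_zero, c2_ofC, Prod.mk.eta]
      rw [hq, smul_smul, mul_inv_cancel₀ hn.ne', one_smul]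

theorem ker_c2_ne_top : LinearMap.ker (c2 : E4 →ₗ[ℝ] ℂ) ≠ ⊤ := by
  intro h
  have h1 : ofC (0, 1) ∈ LinearMap.ker (c2 : E4 →ₗ[ℝ] ℂ) := h ▸ Submodule.mem_top
  simp at h1

/-- In the change of variables the Jacobian of `cone` combines with the contact density, by
`density_param`, into `∂_τ S · π⁻¹`, with `r³` left as radial factor. -/
theorem setIntegral_ball_density (D : Suspension) :
    ∫ x in ball (0 : E4) 1, contactDensity D.lam (normalize x)
      = ∫ a in coneDomain, a 1 ^ 3 * (fderiv ℝ D.S (a 0, c2 a) (1, 0) * π⁻¹) := by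
  have h0 : (ball 0 1 \ (LinearMap.ker (c2 : E4 →ₗ[ℝ] ℂ) : Set E4) : Set E4)
      =ᵐ[volume] ball (0 : E4) 1 :=
    sdiff_null_ae_eq_self (Measure.addHaar_submodule _ _ ker_c2_ne_top)
  rw [← setIntegral_congr_set h0, ← D.image_cone,
    integral_image_eq_integral_abs_det_fderiv_smul volume measurableSet_coneDomain
      (fun a ha => (D.hasFDerivAt_cone (mem_coneDomain.1 ha).2.2).hasFDerivWithinAt) D.injOn_cone]
  refine setIntegral_congr_fun measurableSet_coneDomain fun a ha => ?_
  have ha' := mem_coneDomain.1 ha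
  have hd := D.det4_param_pos (q := (a 0, c2 a)) ha'.2.2
  have h3 : 0 < a 1 ^ 3 := pow_pos ha'.1.1 3
  simp only [smul_eq_mul]
  rw [D.normalize_cone ha, D.det_coneDeriv, abs_neg, abs_of_pos (mul_pos h3 hd),
    ← D.density_param ha'.2.2]
  ring

/-- Integrating first over `τ` gives `S (1, z) - S (0, z) = f z`. Passing from the open to the
closed disk costs only the circle, a null set. -/
theorem setIntegral_fderiv_S (D : Suspension) :
    ∫ q in (Ico (0 : ℝ) 1 ×ˢ ball (0 : ℂ) 1), fderiv ℝ D.S q (1, 0) * π⁻¹ = calabi D.f := by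
  have hc : Continuous fun q : ℝ × ℂ => fderiv ℝ D.S q (1, 0) * π⁻¹ :=
    ((D.S_smooth.continuous_fderiv (by simp)).clm_apply continuous_const).mul continuous_const
  have hi : IntegrableOn (fun q : ℝ × ℂ => fderiv ℝ D.S q (1, 0) * π⁻¹)
      (Ico (0 : ℝ) 1 ×ˢ ball (0 : ℂ) 1) (volume.prod volume) :=
    (hc.continuousOn.integrableOn_compact
      (isCompact_Icc.prod (isCompact_closedBall (0 : ℂ) 1))).mono_set
      (prod_mono Ico_subset_Icc_self ball_subset_closedBall)
  have hS : ∀ z, ∫ τ in Ico (0 : ℝ) 1, fderiv ℝ D.S (τ, z) (1, 0) * π⁻¹ = D.f z * π⁻¹ := by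
    intro z
    rw [integral_Ico_eq_integral_Ioo, ← integral_Ioc_eq_integral_Ioo, integral_mul_const,
      ← intervalIntegral.integral_of_le zero_le_one,
      intervalIntegral.integral_eq_sub_of_hasDerivAt (fun τ _ => D.hasDerivAt_S τ z)]
    · have h := D.S_shift 0 z
      rw [zero_add, D.S_zero, zero_add] at h
      rw [h, D.S_zero, sub_zero]
    · have : Continuous fun τ : ℝ => fderiv ℝ D.S (τ, z) (1, 0) :=
        ((D.S_smooth.continuous_fderiv (by simp)).comp (by fun_prop)).clm_apply continuous_const
      exact this.intervalIntegrable _ _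
  have hsph : (ball (0 : ℂ) 1 : Set ℂ) =ᵐ[volume] disk := by
    rw [← closedBall_sdiff_sphere]
    exact sdiff_null_ae_eq_self (Measure.addHaar_sphere _ _ _)
  rw [Measure.volume_eq_prod, ← Measure.prod_restrict, integral_prod_symm _
    (by rwa [Measure.prod_restrict])]
  simp only [hS]
  exact setIntegral_congr_set hsph

theorem contactVolume_lam (D : Suspension) : contactVolume D.lam = calabi D.f := by
  have h1 := setIntegral_ball_normalize (contactDensity D.lam)
  rw [D.setIntegral_ball_density] at h1
  have h2 : ∫ a in coneDomain, a 1 ^ 3 * (fderiv ℝ D.S (a 0, c2 a) (1, 0) * π⁻¹)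
      = ∫ y in (Ioo (0 : ℝ) 1 ×ˢ (Ico (0 : ℝ) 1 ×ˢ ball (0 : ℂ) 1)),
          y.1 ^ 3 * (fderiv ℝ D.S y.2 (1, 0) * π⁻¹) :=
    measurePreserving_cyl.setIntegral_preimage_emb measurableEmbedding_cyl
      (fun y : ℝ × (ℝ × ℂ) => y.1 ^ 3 * (fderiv ℝ D.S y.2 (1, 0) * π⁻¹)) _
  have h3 : ∫ r in Ioo (0 : ℝ) 1, r ^ 3 = 4⁻¹ := by
    rw [← integral_Ioc_eq_integral_Ioo, ← intervalIntegral.integral_of_le zero_le_one,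
      integral_pow]
    norm_num
  -- The radial factor `1/4` appears on both sides and cancels.
  rw [h2, Measure.volume_eq_prod, setIntegral_prod_mul (fun r : ℝ => r ^ 3)
    (fun q : ℝ × ℂ => fderiv ℝ D.S q (1, 0) * π⁻¹), h3, D.setIntegral_fderiv_S] at h1
  rw [contactVolume]
  linarith

end Suspension

theorem mainTheorem7 (θ₀ : ℝ) (φ : ℂ → ℂ) (f : ℂ → ℝ)
    (hφ : DiskMap.IsDiskDiffeo φ) (harea : DiskMap.PreservesArea φ)
    (hrot : DiskMap.IsRotationNearBoundary φ θ₀)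
    (hf : DiskMap.IsActionFunction φ θ₀ f)
    (hpos : ∀ z ∈ DiskMap.disk, 0 < f z) :
    ∃ lam : ContactSphere.OneForm, ContactSphere.IsContactForm lam ∧
      ∃ b : ContactSphere.DiskOpenBook, b.IsCompatible lam ∧
      ∃ B : ContactSphere.SimpleReebOrbit lam, Set.range B.curve = b.binding ∧
        (B.action = 1 ∧ B.IsElliptic ∧ B.HasRotationNumber θ₀⁻¹) ∧
        (∃ e : Option (DiskMap.PeriodicOrbit φ) ≃ ContactSphere.ReebOrbits lam,
          e none = ⟦B⟧ ∧
          ∀ (c : DiskMap.PeriodicOrbit φ) (γ : ContactSphere.SimpleReebOrbit lam),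
            e (some c) = ⟦γ⟧ →
              ContactSphere.HasLinkingNumber γ.period γ.curve B.period B.curve (c.period : ℤ) ∧
              γ.action = c.totalAction f) ∧
        ContactSphere.contactVolume lam = DiskMap.calabi f := by
  obtain ⟨D, hθ, hDφ, hDf⟩ := DiskMap.exists_suspension hφ hrot hf hpos
  subst hθ
  refine ⟨D.lam, D.isContactForm, ContactSphere.standardBook, D.isCompatible, D.bindingOrbit,
    D.range_bindingOrbit, ⟨D.bindingOrbit.action_eq, D.isElliptic_binding,
      D.hasRotationNumber_binding⟩, D.exists_equiv_reebOrbits hDφ hDf, ?_⟩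
  rw [D.contactVolume_lam]
  exact setIntegral_congr_fun isClosed_closedBall.measurableSet fun z hz =>
    congrArg (· * π⁻¹) (hDf hz)
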